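/- Let $G$ be a finite group and let $k$ be an algebraically closed field of odd prime characteristic $p$; all modules are finite-dimensional. Let $\mathbf{B}$ be a real $p$-block of $G$ (that is, $\mathbf{B}$ equals its contragredient block, the image of $\mathbf{B}$ under $g\mapsto g^{-1}$) with a non-trivial cyclic defect group $D$, let $D_1$ be the subgroup of $D$ of order $p$, let $N_1=\operatorname{N}_G(D_1)$, and let $\mathbf{B}_1$ be the block of $N_1$ with $\mathbf{B}_1^G=\mathbf{B}$ (the Brauer correspondent of $\mathbf{B}$). For a subgroup $1\neq Q\leq D$ one has $\operatorname{N}_G(Q)\leq N_1$; an indecomposable $kG$-module $M$ with vertex $Q$ and an indecomposable $kN_1$-module $N$ with vertex $Q$ are Green correspondents if $N$ is isomorphic to a direct summand of the restriction $M{\downarrow_{N_1}}$. Green correspondence (for all $1\ne Q\le D$ together) is a bijection between the isomorphism classes of non-projective indecomposable $\mathbf{B}$-modules and the isomorphism classes of non-projective indecomposable $\mathbf{B}_1$-modules. This bijection restricts to a bijection between the isomorphism classes of self-dual non-projective indecomposable $\mathbf{B}$-modules and the isomorphism classes of self-dual non-projective indecomposable $\mathbf{B}_1$-modules. Moreover it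 preserves type: if $M$ is a self-dual non-projective indecomposable $\mathbf{B}$-module with Green correspondent $N$ in $\mathbf{B}_1$, then $M$ affords a non-degenerate $G$-invariant quadratic form (orthogonal type) if and only if $N$ affords a non-degenerate $N_1$-invariant quadratic form, and $M$ affords a non-degenerate $G$-invariant alternating bilinear form (symplectic type) if and only if $N$ affords a non-degenerate $N_1$-invariant alternating bilinear form. -/

import Mathlib

universe u v w w'

namespace BlockTheory

noncomputable section

/-! ### Modules over group algebras, as representations -/

section Modules

variable {k : Type u} [Field k] {G : Type v} [Group G]
  {V : Type w} [AddCommGroup V] [Module k V] {W : Type w'} [AddCommGroup W] [Module k W]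

/-- The two modules are isomorphic. -/
def Isomorphic (ρ : Representation k G V) (σ : Representation k G W) : Prop :=
  Nonempty (ρ.Equiv σ)

/-- `ρ` is isomorphic to a direct summand of `σ`. -/
def IsDirectSummand (ρ : Representation k G V) (σ : Representation k G W) : Prop :=
  ∃ (i : ρ.IntertwiningMap σ) (q : σ.IntertwiningMap ρ), q.comp i = .id ρ

/-- The restriction of a `G`-module to a subgroup. -/
abbrev restrict (ρ : Representation k G V) (H : Subgroup G) : Representation k H V :=
  MonoidHom.comp ρ H.subtype

/-- A module is indecomposable if it is non-zero and it is not the direct sum of two non-zero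
submodules. -/
def IsIndecomposable (ρ : Representation k G V) : Prop :=
  Nontrivial V ∧ ∀ U U' : Subrepresentation ρ, IsCompl U U' → U = ⊥ ∨ U' = ⊥

/-- Projectivity as a module over the group algebra. -/
def IsProjective (ρ : Representation k G V) : Prop :=
  Module.Projective (MonoidAlgebra k G) ρ.asModule

/-- A module is isomorphic to its contragredient dual. -/
def IsSelfDual (ρ : Representation k G V) : Prop :=
  Isomorphic ρ ρ.dual

/-- Orthogonal (`+`) type: the module affords a non-degenerate `G`-invariant quadratic form. -/
def IsOrthogonal (ρ : Representation k G V) : Prop :=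
  ∃ Q : QuadraticForm k V, (∀ (g : G) (x : V), Q (ρ g x) = Q x) ∧
    (QuadraticMap.polarBilin Q).Nondegenerate

/-- Symplectic (`-`) type: the module affords a non-degenerate `G`-invariant alternating
bilinear form. -/
def IsSymplectic (ρ : Representation k G V) : Prop :=
  ∃ b : LinearMap.BilinForm k V, (∀ (g : G) (x y : V), b (ρ g x) (ρ g y) = b x y) ∧
    b.IsAlt ∧ b.Nondegenerate

/-- `ρ` is projective relative to the subgroup `H`: it is a direct summand of a module induced
from `H`. -/
def IsRelativelyProjective (ρ : Representation k G V) (H : Subgroup G) : Prop :=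
  ∃ L : Rep.{w} k H, FiniteDimensional k L ∧ IsDirectSummand ρ (L.ρ.ind H.subtype)

/-- `Q` is a (Green) vertex of `ρ`: it is minimal among the subgroups relative to which `ρ` is
projective. -/
def IsVertex (ρ : Representation k G V) (Q : Subgroup G) : Prop :=
  Minimal (IsRelativelyProjective ρ) Q

/-- For a subgroup `H` containing the normalizer of `Q`, an indecomposable `G`-module `ρ` with
vertex `Q` and an indecomposable `H`-module `σ` with vertex `Q` are Green correspondents of each
other (with respect to `G`, `Q`, `H`) if `σ` is a direct summand of the restriction of `ρ`. -/
structure IsGreenCorrespondent (Q H : Subgroup G) (ρ : Representation k G V)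
    (σ : Representation k H W) : Prop where
  normalizer_le : Subgroup.normalizer (Q : Set G) ≤ H
  indecomposable_left : IsIndecomposable ρ
  indecomposable_right : IsIndecomposable σ
  vertex_left : IsVertex ρ Q
  vertex_right : IsVertex σ (Q.subgroupOf H)
  summand : IsDirectSummand σ (restrict ρ H)

end Modules

/-! ### Blocks -/

/-- A block of the group algebra `kG`, given by its block idempotent: a primitive idempotent `e`
of the centre of `kG`. (The corresponding two-sided ideal is `kGe`.) -/
structure Block (k : Type u) [Field k] (G : Type v) [Group G] where
  idem : MonoidAlgebra k G
  mem_center : idem ∈ Subalgebra.center k (MonoidAlgebra k G)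
  isIdempotentElem : IsIdempotentElem idem
  ne_zero : idem ≠ 0
  primitive : ∀ f ∈ Subalgebra.center k (MonoidAlgebra k G),
    IsIdempotentElem f → idem * f = f → f = 0 ∨ f = idem

section Blocks

variable {k : Type u} [Field k] {G : Type v} [Group G]

/-- The linear map `kG → kH` which is the identity on `H` and zero on `G \ H`. -/
def truncate (H : Subgroup G) (z : MonoidAlgebra k G) : MonoidAlgebra k H :=
  MonoidAlgebra.comapDomain H.subtype H.subtype_injective z

theorem truncate_mem_center (H : Subgroup G) {z : MonoidAlgebra k G}
    (hz : z ∈ Subalgebra.center k (MonoidAlgebra k G)) :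
    truncate H z ∈ Subalgebra.center k (MonoidAlgebra k H) := by
  rw [Subalgebra.mem_center_iff] at hz ⊢
  intro b
  induction b using MonoidAlgebra.induction_linear with
  | zero => simp
  | add x y hx hy => rw [add_mul, mul_add, hx, hy]
  | single h r =>
    ext x
    have h1 := congrArg (fun y => y.coeff (x : G)) (hz (MonoidAlgebra.single (h : G) r))
    simpa [truncate] using h1

namespace Block

/-- The block is real: it coincides with the contragredient block, whose idempotent is the image
of the block idempotent under the anti-automorphism `g ↦ g⁻¹` of `kG`. -/
def IsReal (B : Block k G) : Prop :=
  ∀ g : G, B.idem.coeff g⁻¹ = B.idem.coeff g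

/-- `D` is a defect group of the block: it is minimal among the subgroups `D` for which the block
idempotent is a relative trace `∑ gag⁻¹` (over `g ∈ G/D`) of some `a` in `kG` which is fixed under
conjugation by `D`. -/
def IsDefectGroup (B : Block k G) (D : Subgroup G) : Prop :=
  Minimal (fun P : Subgroup G => ∃ a : MonoidAlgebra k G,
    (∀ x ∈ P, MonoidAlgebra.of k G x * a = a * MonoidAlgebra.of k G x) ∧
    B.idem = ∑ᶠ q : G ⧸ P,
      MonoidAlgebra.of k G q.out * a * MonoidAlgebra.of k G (q.out)⁻¹) D

/-- `ω` is the central character of the block. -/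
def IsCentralCharacter (B : Block k G)
    (ω : Subalgebra.center k (MonoidAlgebra k G) →ₐ[k] k) : Prop :=
  ω ⟨B.idem, B.mem_center⟩ = 1

/-- `b ^ G = B` in the sense of Brauer: the central character of `B` is the composition of the
truncation `Z(kG) → Z(kH)` with the central character of the block `b` of `H`. -/
def IsBrauerInduced {H : Subgroup G} (b : Block k H) (B : Block k G) : Prop :=
  ∃ (ω : Subalgebra.center k (MonoidAlgebra k G) →ₐ[k] k)
    (ω' : Subalgebra.center k (MonoidAlgebra k H) →ₐ[k] k),
    B.IsCentralCharacter ω ∧ b.IsCentralCharacter ω' ∧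
      ∀ z, ω z = ω' ⟨truncate H z, truncate_mem_center H z.2⟩

/-- The module belongs to the block: the block idempotent acts as the identity. -/
def Contains (B : Block k G) {V : Type w} [AddCommGroup V] [Module k V]
    (ρ : Representation k G V) : Prop :=
  ρ.asAlgebraHom B.idem = 1

/-- The finite-dimensional non-projective indecomposable modules in a block. -/
def NonprojIndec (B : Block k G) : Type _ :=
  { M : Rep.{max u v} k G // FiniteDimensional k M ∧ IsIndecomposable M.ρ ∧
    ¬ IsProjective M.ρ ∧ B.Contains M.ρ }

/-- The representation on a non-projective indecomposable module in a block. -/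
abbrev NonprojIndec.rep {B : Block k G} (M : B.NonprojIndec) : Representation k G M.1 := M.1.ρ

instance NonprojIndec.setoid (B : Block k G) : Setoid B.NonprojIndec where
  r M N := Isomorphic M.rep N.rep
  iseqv :=
    ⟨fun M => ⟨Representation.Equiv.refl M.rep⟩, fun ⟨e⟩ => ⟨e.symm⟩, fun ⟨e⟩ ⟨e'⟩ => ⟨e.trans e'⟩⟩

/-- The isomorphism classes of non-projective indecomposable modules in a block. -/
def IsoClass (B : Block k G) : Type _ := Quotient (NonprojIndec.setoid B)

/-- The isomorphism class of a module. -/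
def NonprojIndec.isoClass {B : Block k G} (M : B.NonprojIndec) : B.IsoClass :=
  Quotient.mk _ M

/-- The isomorphism classes of the self-dual non-projective indecomposable modules in a block. -/
def selfDualClasses (B : Block k G) : Set B.IsoClass :=
  NonprojIndec.isoClass '' { M | IsSelfDual M.rep }

end Block

end Blocks

end

end BlockTheory

/-!
Throughout, "projective map" means a `k`-linear map which is a trace `∑ g α g⁻¹` from the trivial
subgroup, and `X ≡ Y` means that the difference is such a trace. By Higman's criterion
(`isProjective_of_mem`, `mem_of_isProjective`, `isRelativelyProjective_iff`) a module is projective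
relative to a subgroup `P` if and only if its identity map is a trace from `P`. By Fitting's lemma
(`isNilpotent_or_isUnit`) an endomorphism of a non-projective indecomposable module which is `≡` the
identity is invertible.

Let `N₁` be the normalizer of the subgroup `D₁` of order `p` of the cyclic defect group `D`. Every
non-trivial subgroup of `D` contains `D₁`, so `N₁` controls the fusion of the non-trivial elements
of `D` (`mem_normalizer_of_conj_mem`). The block idempotent `e` of `B` is a trace from `D`, and the
idempotent of the Brauer correspondent is its image `e₁` under the Brauer map of `D₁`
(`inclusion_idem_eq_brauerMap`). What is used of this is collected in the structure `LocalPair`,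
and holds by `localPair_of_isCyclic`. It has two consequences.

* Let `β : V → W` be an `N₁`-homomorphism between `G`-modules with `e₁ β = β`. Writing `e₁` as the
  trace of an element `c` from `D` to `N₁`, Mackey's formula shows that the trace `Φ` of `c β` from
  `D` to `G` satisfies `e₁ Φ ≡ β` (`LocalPair.exists_lift`): the double cosets outside `N₁` only
  contribute projective maps.
* If `e₁` acts on a module of `B` as a trace from a subgroup `P ≤ N₁`, then the module is projective
  relative to `P` (`LocalPair.mem_of_mem_restrict`).

Let `M` be a non-projective indecomposable `B`-module. By the second fact its restriction to `N₁`
has a non-projective indecomposable summand `N` in `e₁`, and lifting the projection `π` to `N` gives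
an automorphism of `M`, from which `e₁ ≡ π` on `M` (`LocalPair.sub_comp_mem`). So `N` is unique.
Lifting the homomorphisms between two modules through a common `N` shows that `M` is determined by
`N`, and every `N` occurs for a summand of the `B`-part of the coinduced module. Traces from
subgroups of `D` pass back and forth by the same formulas, so `M` and `N` have a common vertex
(`LocalPair.exists_isVertex`).

Invariant bilinear forms are homomorphisms `M → M*`. As `B` is real, `e₁` is invariant under
inversion of the group elements and acts on `M*` as the transpose of its action on `M`. Hence the
adjoint of `π` with respect to a non-degenerate form on `M` is again `≡ e₁ ≡ π`, so the form remains
non-degenerate on `N` (`LocalPair.injective_form_of_summand`). Conversely, a non-degenerate form on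
`N`, extended by zero, is an `N₁`-homomorphism `M → M*` in `e₁` and has a lift, which is invertible
because its composition with a lift of the inverse is (`LocalPair.injective_of_lift_form`). If the
form is symmetric or alternating, then the lift can be replaced by its symmetric or alternating
part, since `p` is odd (`LocalPair.hasForm_iff_of_summand`).
-/

namespace BlockTheory
noncomputable section

/-! ### Sums of equivariant families -/

section Trace

variable {k : Type*} [Field k] {G : Type*} [Group G]
  {X : Type*} [AddCommGroup X] [Module k X] {Y : Type*} [AddCommGroup Y] [Module k Y]
  (τ : Representation k G X)

/-- For a finite `G`-set `S`, the sums `∑ s, φ s` over all equivariant families `φ : S → X`.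
For `S = G ⧸ H` this is the image of the relative trace from the `H`-fixed points of `X`, and for
`S = G` the image of the trace from the trivial subgroup. -/
def traceModule (S : Type*) [MulAction G S] [Finite S] : Submodule k X where
  carrier := {z | ∃ φ : S → X, (∀ (g : G) (s : S), φ (g • s) = τ g (φ s)) ∧ ∑ᶠ s, φ s = z}
  add_mem' := by
    rintro _ _ ⟨φ, hφ, rfl⟩ ⟨ψ, hψ, rfl⟩
    exact ⟨fun s => φ s + ψ s, fun g s => by simp only [hφ, hψ, map_add],
      finsum_add_distrib (Set.toFinite _) (Set.toFinite _)⟩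
  zero_mem' := ⟨fun _ => 0, by simp, by simp⟩
  smul_mem' := by
    rintro c _ ⟨φ, hφ, rfl⟩
    exact ⟨fun s => c • φ s, fun g s => by simp only [hφ, map_smul],
      (smul_finsum' c (Set.toFinite _)).symm⟩

variable {τ} {S : Type*} [MulAction G S] [Finite S] {T : Type*} [MulAction G T] [Finite T]

theorem map_finsum_of_finite {ι M N F : Type*} [Finite ι] [AddCommMonoid M] [AddCommMonoid N]
    [FunLike F M N] [AddMonoidHomClass F M N] (f : F) (φ : ι → M) :
    f (∑ᶠ i, φ i) = ∑ᶠ i, f (φ i) :=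
  (f : M →+ N).map_finsum (Set.toFinite _)

theorem rho_apply_of_mem_traceModule {z : X} (hz : z ∈ traceModule τ S) (g : G) : τ g z = z := by
  obtain ⟨φ, hφ, rfl⟩ := hz
  rw [map_finsum_of_finite]
  simp_rw [← hφ]
  exact finsum_comp_equiv (MulAction.toPerm g) (f := φ)

theorem map_mem_traceModule {τ' : Representation k G Y} (f : X →ₗ[k] Y)
    (hf : ∀ g x, f (τ g x) = τ' g (f x)) {z : X} (hz : z ∈ traceModule τ S) :
    f z ∈ traceModule τ' S := by
  obtain ⟨φ, hφ, rfl⟩ := hz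
  exact ⟨fun s => f (φ s), fun g s => by simp only [hφ, hf], (map_finsum_of_finite f φ).symm⟩

theorem finsum_fiberwise {ι κ M : Type*} [Finite ι] [Finite κ] [AddCommMonoid M] (f : ι → κ)
    (φ : ι → M) : ∑ᶠ j, ∑ᶠ i : {i // f i = j}, φ i = ∑ᶠ i, φ i := by
  classical
  cases nonempty_fintype ι
  cases nonempty_fintype κ
  simp_rw [finsum_eq_sum_of_fintype]
  exact Fintype.sum_fiberwise f φ

theorem traceModule_mono (f : S → T) (hf : ∀ (g : G) (s : S), f (g • s) = g • f s) :
    traceModule τ S ≤ traceModule τ T := by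
  rintro _ ⟨φ, hφ, rfl⟩
  refine ⟨fun t => ∑ᶠ s : {s // f s = t}, φ s, fun g t => ?_, finsum_fiberwise f φ⟩
  rw [map_finsum_of_finite]
  simp_rw [← hφ]
  refine (finsum_eq_of_bijective
    (fun s : {s // f s = t} => (⟨g • s.1, by rw [hf, s.2]⟩ : {s // f s = g • t}))
    ⟨fun a b h => ?_, fun b => ⟨⟨g⁻¹ • b.1, by rw [hf, b.2, inv_smul_smul]⟩, ?_⟩⟩
    fun s => rfl).symm
  · have := congrArg Subtype.val h
    exact Subtype.ext (by simpa using this)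
  · exact Subtype.ext (by simp)

/-- An equivariant family which vanishes outside the points with trivial stabilizer sums to a
trace from the trivial subgroup: choose a representative in each orbit. -/
theorem finsum_mem_traceModule_self [Finite G] (φ : S → X)
    (hφ : ∀ (g : G) (s : S), φ (g • s) = τ g (φ s))
    (hfree : ∀ s, φ s ≠ 0 → ∀ g : G, g • s = s → g = 1) :
    ∑ᶠ s, φ s ∈ traceModule τ G := by
  classical
  cases nonempty_fintype S
  cases nonempty_fintype G
  rw [← finsum_fiberwise (fun s => (Quotient.mk (MulAction.orbitRel G S) s)) φ]
  rw [finsum_eq_sum_of_fintype]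
  refine Submodule.sum_mem _ fun ω _ => ?_
  by_cases h0 : φ ω.out = 0
  · have : ∀ s : {s // Quotient.mk (MulAction.orbitRel G S) s = ω}, φ s = 0 := by
      rintro ⟨s, hs⟩
      have h : (MulAction.orbitRel G S) s ω.out := Quotient.exact (hs.trans ω.out_eq.symm)
      obtain ⟨g, rfl⟩ := MulAction.mem_orbit_iff.1 (MulAction.orbitRel_apply.1 h)
      simp only [hφ, h0, map_zero]
    simp [this]
  · refine ⟨fun g => τ g (φ ω.out), fun g s => by simp, ?_⟩
    refine finsum_eq_of_bijective (fun g : G => ⟨g • ω.out, ?_⟩) ⟨fun a b h => ?_, ?_⟩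
      fun g => (hφ g _).symm
    · conv_rhs => rw [← ω.out_eq]
      exact Quotient.sound (MulAction.mem_orbit _ _)
    · have h1 : a • ω.out = b • ω.out := congrArg Subtype.val h
      have h2 := hfree _ h0 (b⁻¹ * a) (by rw [mul_smul, h1, inv_smul_smul])
      exact (inv_mul_eq_one.1 h2).symm
    · rintro ⟨s, hs⟩
      have h : (MulAction.orbitRel G S) s ω.out := Quotient.exact (hs.trans ω.out_eq.symm)
      obtain ⟨g, rfl⟩ := MulAction.mem_orbit_iff.1 (MulAction.orbitRel_apply.1 h)
      exact ⟨g, rfl⟩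

theorem mem_traceModule_self [Finite G] {z : X} :
    z ∈ traceModule τ G ↔ ∃ x, ∑ᶠ g, τ g x = z := by
  constructor
  · rintro ⟨φ, hφ, rfl⟩
    exact ⟨φ 1, finsum_congr fun g => by rw [← hφ, smul_eq_mul, mul_one]⟩
  · rintro ⟨x, rfl⟩
    exact ⟨fun g => τ g x, fun g s => by simp, rfl⟩

theorem traceModule_self_le [Finite G] [Nonempty S] : traceModule τ G ≤ traceModule τ S :=
  traceModule_mono (fun g => g • Classical.arbitrary S) fun g s => by rw [smul_eq_mul, mul_smul]

theorem traceModule_quotient_bot_le [Finite G] :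
    traceModule τ (G ⧸ (⊥ : Subgroup G)) ≤ traceModule τ G := by
  rintro _ ⟨φ, hφ, rfl⟩
  refine finsum_mem_traceModule_self φ hφ fun s _ g hg => ?_
  induction s using QuotientGroup.induction_on with
  | H x =>
    have := QuotientGroup.eq.1 (show ((g * x : G) : G ⧸ (⊥ : Subgroup G)) = x from hg)
    rw [Subgroup.mem_bot, inv_mul_eq_one] at this
    simpa using this

/-- A trace from the trivial subgroup of `G` is one for every subgroup. -/
theorem traceModule_self_le_restrict [Finite G] (K : Subgroup G) :
    traceModule τ G ≤ traceModule (restrict τ K) K := by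
  rintro _ ⟨φ, hφ, rfl⟩
  exact finsum_mem_traceModule_self φ (fun g s => hφ g s) fun s _ g hg =>
    Subtype.ext (by simpa [Subgroup.smul_def] using hg)

variable (τ) in
/-- The relative trace `∑ g x` over the cosets `g H`, meaningful when `x` is fixed by `H`. -/
def relTrace (H : Subgroup G) (x : X) : X := ∑ᶠ q : G ⧸ H, τ q.out x

theorem rho_out_apply {H : Subgroup G} {x : X} (hx : ∀ h ∈ H, τ h x = x) (g : G) :
    τ (g : G ⧸ H).out x = τ g x := by
  obtain ⟨h, hh⟩ := QuotientGroup.mk_out_eq_mul H g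
  rw [hh, map_mul, Module.End.mul_apply, hx _ h.2]

theorem rho_out_smul {H : Subgroup G} {x : X} (hx : ∀ h ∈ H, τ h x = x) (g : G) (q : G ⧸ H) :
    τ (g • q).out x = τ g (τ q.out x) := by
  induction q using QuotientGroup.induction_on with
  | H y =>
    rw [rho_out_apply hx, ← Module.End.mul_apply, ← map_mul]
    exact rho_out_apply hx (g * y)

theorem relTrace_mem [Finite G] {H : Subgroup G} {x : X} (hx : ∀ h ∈ H, τ h x = x) :
    relTrace τ H x ∈ traceModule τ (G ⧸ H) :=
  ⟨fun q => τ q.out x, rho_out_smul hx, rfl⟩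

theorem mem_traceModule_quotient [Finite G] {H : Subgroup G} {z : X} :
    z ∈ traceModule τ (G ⧸ H) ↔ ∃ x, (∀ h ∈ H, τ h x = x) ∧ relTrace τ H x = z := by
  constructor
  · rintro ⟨φ, hφ, rfl⟩
    have hx : ∀ h ∈ H, τ h (φ (1 : G)) = φ (1 : G) := fun h hh => by
      rw [← hφ]
      exact congrArg φ (QuotientGroup.eq.2 (by simpa using hh))
    refine ⟨φ (1 : G), hx, finsum_congr fun q => ?_⟩
    induction q using QuotientGroup.induction_on with
    | H y =>
      rw [rho_out_apply hx, ← hφ]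
      exact congrArg φ (by simp [MulAction.Quotient.smul_mk])
  · rintro ⟨x, hx, rfl⟩
    exact relTrace_mem hx

theorem map_relTrace [Finite G] {τ' : Representation k G Y} (f : X →ₗ[k] Y)
    (hf : ∀ g x, f (τ g x) = τ' g (f x)) (H : Subgroup G) (x : X) :
    f (relTrace τ H x) = relTrace τ' H (f x) := by
  rw [relTrace, map_finsum_of_finite]
  exact finsum_congr fun q => hf _ _

theorem relTrace_add [Finite G] (H : Subgroup G) (x y : X) :
    relTrace τ H (x + y) = relTrace τ H x + relTrace τ H y := by
  simp only [relTrace, map_add]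
  exact finsum_add_distrib (Set.toFinite _) (Set.toFinite _)

/-- Transitivity of the relative trace. -/
theorem relTrace_relTrace [Finite G] {P K : Subgroup G} (hPK : P ≤ K) {x : X}
    (hx : ∀ h ∈ P, τ h x = x) :
    relTrace τ K (relTrace (restrict τ K) (P.subgroupOf K) x) = relTrace τ P x := by
  classical
  have := Fintype.ofFinite (G ⧸ K)
  have := Fintype.ofFinite (G ⧸ P)
  have := Fintype.ofFinite (K ⧸ P.subgroupOf K)
  simp only [relTrace, finsum_eq_sum_of_fintype, map_sum]
  rw [← Fintype.sum_prod_type', ← (Subgroup.quotientEquivProdOfLE hPK).symm.sum_comp]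
  refine Finset.sum_congr rfl fun a _ => ?_
  obtain ⟨q, s⟩ := a
  induction s using QuotientGroup.induction_on with
  | H y =>
    have hx' : ∀ h ∈ P.subgroupOf K, (restrict τ K) h x = x := fun h hh => hx _ hh
    have h1 : (restrict τ K) (y : K ⧸ P.subgroupOf K).out x = τ (y : G) x := rho_out_apply hx' y
    have h2 : (Subgroup.quotientEquivProdOfLE hPK).symm (q, (y : K ⧸ P.subgroupOf K)) =
      ((q.out * y : G) : G ⧸ P) := rfl
    rw [h2, rho_out_apply hx]
    simp only [h1, map_mul, Module.End.mul_apply]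

theorem relTrace_mem_of_mem [Finite G] {P K : Subgroup G} (hPK : P ≤ K) {y : X}
    (hy : y ∈ traceModule (restrict τ K) (K ⧸ P.subgroupOf K)) :
    relTrace τ K y ∈ traceModule τ (G ⧸ P) := by
  obtain ⟨x, hx, rfl⟩ := mem_traceModule_quotient.1 hy
  have hx' : ∀ h ∈ P, τ h x = x := fun h hh => hx ⟨h, hPK hh⟩ (Subgroup.mem_subgroupOf.2 hh)
  rw [relTrace_relTrace hPK hx']
  exact relTrace_mem hx'

theorem relTrace_mem_of_mem_self [Finite G] {K : Subgroup G} {y : X}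
    (hy : y ∈ traceModule (restrict τ K) K) : relTrace τ K y ∈ traceModule τ G :=
  traceModule_quotient_bot_le (relTrace_mem_of_mem bot_le (traceModule_self_le hy))

theorem relTrace_of_forall [Finite G] (K : Subgroup G) {x : X} (hx : ∀ g, τ g x = x) :
    relTrace τ K x = (K.index : k) • x := by
  simp only [relTrace, hx]
  have := Fintype.ofFinite (G ⧸ K)
  rw [finsum_eq_sum_of_fintype, Finset.sum_const, Finset.card_univ, Subgroup.index_eq_card,
    Nat.card_eq_fintype_card, Nat.cast_smul_eq_nsmul]

/-- If the index of `P` in `D` is invertible in `k`, every trace from `D` is one from `P`. -/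
theorem traceModule_quotient_le_of_index [Finite G] {P D : Subgroup G} (hPD : P ≤ D)
    (h : ((P.subgroupOf D).index : k) ≠ 0) :
    traceModule τ (G ⧸ D) ≤ traceModule τ (G ⧸ P) := by
  intro z hz
  obtain ⟨x, hx, rfl⟩ := mem_traceModule_quotient.1 hz
  have h1 : relTrace (restrict τ D) (P.subgroupOf D) x ∈
      traceModule (restrict τ D) (D ⧸ P.subgroupOf D) :=
    relTrace_mem fun (d : D) _ => hx _ d.2
  rw [relTrace_of_forall _ fun d : D => hx _ d.2] at h1
  have h2 := Submodule.smul_mem _ ((P.subgroupOf D).index : k)⁻¹ h1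
  rw [smul_smul, inv_mul_cancel₀ h, one_smul] at h2
  exact relTrace_mem_of_mem hPD h2

theorem out_mem_iff {H K : Subgroup G} (hHK : H ≤ K) (g : G) :
    (g : G ⧸ H).out ∈ K ↔ g ∈ K := by
  obtain ⟨h, hh⟩ := QuotientGroup.mk_out_eq_mul H g
  rw [hh, K.mul_mem_cancel_right (hHK h.2)]

/-- Splitting a trace from `H` to `G` at an intermediate subgroup `K`: the cosets inside `K` give
the trace from `H` to `K`, and the others form a `K`-equivariant family. -/
theorem exists_relTrace_eq_add [Finite G] {H K : Subgroup G} (hHK : H ≤ K) {x : X}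
    (hx : ∀ h ∈ H, τ h x = x) :
    ∃ φ : G ⧸ H → X, (∀ (g : K) (q : G ⧸ H), φ (g • q) = (restrict τ K) g (φ q)) ∧
      (∀ q, φ q ≠ 0 → q.out ∉ K) ∧
      relTrace τ H x = relTrace (restrict τ K) (H.subgroupOf K) x + ∑ᶠ q, φ q := by
  classical
  have := Fintype.ofFinite (G ⧸ H)
  have := Fintype.ofFinite (K ⧸ H.subgroupOf K)
  refine ⟨fun q => if q.out ∈ K then 0 else τ q.out x, fun g q => ?_, fun q hq hK => ?_, ?_⟩
  · have h1 : (g • q).out ∈ K ↔ q.out ∈ K := by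
      induction q using QuotientGroup.induction_on with
      | H y =>
        rw [out_mem_iff hHK]
        exact (out_mem_iff hHK ((g : G) * y)).trans (K.mul_mem_cancel_left g.2)
    simp only [h1]
    split_ifs
    · rw [map_zero]
    · exact rho_out_smul hx (g : G) q
  · simp [hK] at hq
  simp only [relTrace, finsum_eq_sum_of_fintype]
  rw [← Fintype.sum_subtype_add_sum_subtype (fun q : G ⧸ H => q.out ∈ K),
    ← Fintype.sum_subtype_add_sum_subtype (fun q : G ⧸ H => q.out ∈ K)
      (fun q : G ⧸ H => if q.out ∈ K then 0 else τ q.out x)]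
  rw [Finset.sum_eq_zero (s := Finset.univ)
      (f := fun q : {q : G ⧸ H // q.out ∈ K} => if q.1.out ∈ K then (0 : X) else τ q.1.out x)
      fun q _ => if_pos q.2, zero_add]
  congr 1
  · symm
    have hx' : ∀ h ∈ H.subgroupOf K, (restrict τ K) h x = x := fun h hh => hx _ hh
    refine Fintype.sum_bijective (fun s : K ⧸ H.subgroupOf K =>
      (⟨((s.out : K) : G), (out_mem_iff hHK _).2 s.out.2⟩ : {q : G ⧸ H // q.out ∈ K}))
      ⟨fun a b hab => ?_, fun b => ?_⟩ _ _ fun s => ?_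
    · have h1 : (((a.out : K) : G) : G ⧸ H) = ((b.out : K) : G) := congrArg Subtype.val hab
      rw [QuotientGroup.eq] at h1
      rw [← QuotientGroup.out_eq' a, ← QuotientGroup.out_eq' b, QuotientGroup.eq]
      exact h1
    · refine ⟨((⟨b.1.out, b.2⟩ : K) : K ⧸ H.subgroupOf K), Subtype.ext ?_⟩
      obtain ⟨h, hh⟩ := QuotientGroup.mk_out_eq_mul (H.subgroupOf K) (⟨b.1.out, b.2⟩ : K)
      simp only [hh]
      conv_rhs => rw [← QuotientGroup.out_eq' b.1]
      rw [eq_comm, QuotientGroup.eq]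
      simpa using Subgroup.mem_subgroupOf.1 h.2
    · rw [rho_out_apply hx]
      rfl
  · exact Finset.sum_congr rfl fun q _ => (if_neg q.2).symm

end Trace

/-! ### Intertwining maps and direct summands -/

section Intertwining

variable {k : Type*} [Field k] {G : Type*} [Group G]
  {V : Type*} [AddCommGroup V] [Module k V] {W : Type*} [AddCommGroup W] [Module k W]
  {U : Type*} [AddCommGroup U] [Module k U]
  {ρ : Representation k G V} {σ : Representation k G W} {τ : Representation k G U}

theorem linHom_apply_eq_iff {f : V →ₗ[k] W} :
    (∀ g, (ρ.linHom σ) g f = f) ↔ ρ.IsIntertwiningMap σ f := by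
  constructor
  · refine fun h => ⟨fun g v => ?_⟩
    conv_lhs => rw [← h g]
    simp
  · intro h g
    ext v
    simp [← h.isIntertwining]

theorem isIntertwiningMap_of_mem_traceModule {S : Type*} [MulAction G S] [Finite S]
    {f : V →ₗ[k] W} (hf : f ∈ traceModule (ρ.linHom σ) S) : ρ.IsIntertwiningMap σ f :=
  linHom_apply_eq_iff.1 (rho_apply_of_mem_traceModule hf)

theorem isIntertwiningMap_id : ρ.IsIntertwiningMap ρ LinearMap.id := ⟨fun _ _ => rfl⟩

theorem isIntertwiningMap_comp {f : W →ₗ[k] U} {g : V →ₗ[k] W} (hf : σ.IsIntertwiningMap τ f)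
    (hg : ρ.IsIntertwiningMap σ g) : ρ.IsIntertwiningMap τ (f ∘ₗ g) :=
  ⟨fun x v => by simp [hg.isIntertwining, hf.isIntertwining]⟩

theorem isIntertwiningMap_add {f g : V →ₗ[k] W} (hf : ρ.IsIntertwiningMap σ f)
    (hg : ρ.IsIntertwiningMap σ g) : ρ.IsIntertwiningMap σ (f + g) :=
  ⟨fun x v => by simp [hg.isIntertwining, hf.isIntertwining]⟩

theorem isIntertwiningMap_smul (c : k) {f : V →ₗ[k] W} (hf : ρ.IsIntertwiningMap σ f) :
    ρ.IsIntertwiningMap σ (c • f) :=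
  ⟨fun x v => by simp [hf.isIntertwining]⟩

theorem isIntertwiningMap_restrict {f : V →ₗ[k] W} (hf : ρ.IsIntertwiningMap σ f)
    (H : Subgroup G) : (restrict ρ H).IsIntertwiningMap (restrict σ H) f :=
  ⟨fun x v => hf.isIntertwining x v⟩

/-- The inverse of a bijective intertwining map. -/
theorem isIntertwiningMap_of_comp_eq_id {f : V →ₗ[k] W} {g : W →ₗ[k] V}
    (hf : ρ.IsIntertwiningMap σ f) (h₁ : g ∘ₗ f = LinearMap.id) (h₂ : f ∘ₗ g = LinearMap.id) :
    σ.IsIntertwiningMap ρ g := by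
  refine ⟨fun x w => ?_⟩
  have h1 : ∀ v, g (f v) = v := fun v => LinearMap.congr_fun h₁ v
  have h2 : ∀ v, f (g v) = v := fun v => LinearMap.congr_fun h₂ v
  conv_lhs => rw [← h2 w, ← hf.isIntertwining, h1]

theorem comp_mem_traceModule {S : Type*} [MulAction G S] [Finite S] {f : W →ₗ[k] U}
    {g : V →ₗ[k] W} (hf : σ.IsIntertwiningMap τ f) (hg : g ∈ traceModule (ρ.linHom σ) S) :
    f ∘ₗ g ∈ traceModule (ρ.linHom τ) S := by
  refine map_mem_traceModule (LinearMap.llcomp k V W U f) (fun x a => ?_) hg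
  ext v
  simp [hf.isIntertwining]

theorem mem_traceModule_comp {S : Type*} [MulAction G S] [Finite S] {f : W →ₗ[k] U}
    {g : V →ₗ[k] W} (hf : f ∈ traceModule (σ.linHom τ) S) (hg : ρ.IsIntertwiningMap σ g) :
    f ∘ₗ g ∈ traceModule (ρ.linHom τ) S := by
  refine map_mem_traceModule (LinearMap.lcomp k U g) (fun x a => ?_) hf
  ext v
  simp [hg.isIntertwining]

theorem isDirectSummand_iff : IsDirectSummand ρ σ ↔
    ∃ (i : V →ₗ[k] W) (q : W →ₗ[k] V), ρ.IsIntertwiningMap σ i ∧ σ.IsIntertwiningMap ρ q ∧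
      q ∘ₗ i = LinearMap.id := by
  constructor
  · rintro ⟨i, q, h⟩
    exact ⟨i.toLinearMap, q.toLinearMap, ⟨Representation.IntertwiningMap.isIntertwining _ _ i⟩,
      ⟨Representation.IntertwiningMap.isIntertwining _ _ q⟩, congrArg (fun f => f.toLinearMap) h⟩
  · rintro ⟨i, q, hi, hq, h⟩
    exact ⟨i.intertwiningMap_of_isIntertwiningMap ρ σ hi.isIntertwining,
      q.intertwiningMap_of_isIntertwiningMap σ ρ hq.isIntertwining,
      Representation.IntertwiningMap.ext h⟩

theorem IsDirectSummand.trans {σ : Representation k G W} (h₁ : IsDirectSummand ρ σ)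
    (h₂ : IsDirectSummand σ τ) : IsDirectSummand ρ τ := by
  obtain ⟨i, q, hi, hq, h⟩ := isDirectSummand_iff.1 h₁
  obtain ⟨i', q', hi', hq', h'⟩ := isDirectSummand_iff.1 h₂
  refine isDirectSummand_iff.2 ⟨i' ∘ₗ i, q ∘ₗ q', isIntertwiningMap_comp hi' hi,
    isIntertwiningMap_comp hq hq', ?_⟩
  rw [LinearMap.comp_assoc, ← LinearMap.comp_assoc i, h', LinearMap.id_comp, h]

theorem IsDirectSummand.restrict (h : IsDirectSummand ρ σ) (H : Subgroup G) :
    IsDirectSummand (restrict ρ H) (restrict σ H) := by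
  obtain ⟨i, q, hi, hq, h⟩ := isDirectSummand_iff.1 h
  exact isDirectSummand_iff.2 ⟨i, q, isIntertwiningMap_restrict hi H,
    isIntertwiningMap_restrict hq H, h⟩

theorem Isomorphic.isDirectSummand (h : Isomorphic ρ σ) : IsDirectSummand ρ σ := by
  obtain ⟨e⟩ := h
  refine ⟨e.toIntertwiningMap, e.symm.toIntertwiningMap, ?_⟩
  ext v
  simp

theorem Isomorphic.symm (h : Isomorphic ρ σ) : Isomorphic σ ρ := ⟨h.some.symm⟩

theorem isomorphic_of_bijective {f : V →ₗ[k] W} (hf : ρ.IsIntertwiningMap σ f)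
    (h : Function.Bijective f) : Isomorphic ρ σ :=
  ⟨(f.intertwiningMap_of_isIntertwiningMap ρ σ hf.isIntertwining).ofBijective h⟩

theorem mem_of_isDirectSummand {S : Type*} [MulAction G S] [Finite S]
    (h : IsDirectSummand ρ σ)
    (hσ : LinearMap.id ∈ traceModule (σ.linHom σ) S) :
    LinearMap.id ∈ traceModule (ρ.linHom ρ) S := by
  obtain ⟨i, q, hi, hq, h⟩ := isDirectSummand_iff.1 h
  have := comp_mem_traceModule hq (mem_traceModule_comp hσ hi)
  rwa [LinearMap.id_comp, h] at this

/-- The kernel of an intertwining map as a subrepresentation. -/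
def kerSubrep (f : V →ₗ[k] W) (hf : ρ.IsIntertwiningMap σ f) : Subrepresentation ρ where
  toSubmodule := LinearMap.ker f
  apply_mem_toSubmodule g v hv := by
    rw [LinearMap.mem_ker] at hv ⊢
    rw [hf.isIntertwining, hv, map_zero]

/-- The range of an intertwining map as a subrepresentation. -/
def rangeSubrep (f : V →ₗ[k] W) (hf : ρ.IsIntertwiningMap σ f) : Subrepresentation σ where
  toSubmodule := LinearMap.range f
  apply_mem_toSubmodule g v hv := by
    obtain ⟨x, rfl⟩ := hv
    exact ⟨ρ g x, hf.isIntertwining g x⟩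

theorem isCompl_toSubmodule_iff {A B : Subrepresentation ρ} :
    IsCompl A.toSubmodule B.toSubmodule ↔ IsCompl A B := by
  rw [isCompl_iff, isCompl_iff, disjoint_iff, disjoint_iff, codisjoint_iff, codisjoint_iff,
    ← Subrepresentation.toSubmodule_inf, ← Subrepresentation.toSubmodule_sup]
  exact and_congr (Subrepresentation.toSubmodule_injective.eq_iff (b := ⊥))
    (Subrepresentation.toSubmodule_injective.eq_iff (b := ⊤))

theorem eq_bot_or_eq_bot_of_isCompl (h : IsIndecomposable ρ) {A B : Subrepresentation ρ}
    (hAB : IsCompl A.toSubmodule B.toSubmodule) : A.toSubmodule = ⊥ ∨ B.toSubmodule = ⊥ :=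
  (h.2 A B (isCompl_toSubmodule_iff.1 hAB)).imp
    (congrArg Subrepresentation.toSubmodule) (congrArg Subrepresentation.toSubmodule)

theorem isIntertwiningMap_pow {f : V →ₗ[k] V} (hf : ρ.IsIntertwiningMap ρ f) (n : ℕ) :
    ρ.IsIntertwiningMap ρ (f ^ n) := by
  induction n with
  | zero => exact isIntertwiningMap_id
  | succ n ih =>
    rw [pow_succ]
    exact isIntertwiningMap_comp ih hf

/-- Fitting's lemma for an endomorphism of an indecomposable module. -/
theorem isNilpotent_or_isUnit [FiniteDimensional k V] (h : IsIndecomposable ρ)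
    {f : V →ₗ[k] V} (hf : ρ.IsIntertwiningMap ρ f) :
    IsNilpotent (f : Module.End k V) ∨ IsUnit (f : Module.End k V) := by
  obtain ⟨n, hn⟩ := Filter.eventually_atTop.1 (LinearMap.eventually_isCompl_ker_pow_range_pow f)
  have hn' := hn (n + 1) (by lia)
  have hi := isIntertwiningMap_pow hf (n + 1)
  rcases eq_bot_or_eq_bot_of_isCompl h (A := kerSubrep _ hi) (B := rangeSubrep _ hi) hn'
    with h1 | h1
  · right
    have h2 : IsUnit (f ^ (n + 1) : Module.End k V) := LinearMap.isUnit_iff_ker_eq_bot _ |>.2 h1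
    exact (isUnit_pow_iff (by lia)).1 h2
  · left
    exact ⟨n + 1, LinearMap.range_eq_bot.1 h1⟩

/-- The endomorphism ring of an indecomposable module is local. -/
theorem isUnit_of_add_eq_one [FiniteDimensional k V] (h : IsIndecomposable ρ)
    {f g : V →ₗ[k] V} (hf : ρ.IsIntertwiningMap ρ f)
    (hfg : (f : Module.End k V) + g = 1) : IsUnit (f : Module.End k V) ∨
      IsUnit (g : Module.End k V) := by
  rcases isNilpotent_or_isUnit h hf with h1 | h1
  · right
    rw [eq_sub_of_add_eq' hfg]
    exact h1.isUnit_one_sub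
  · exact Or.inl h1

/-- A non-zero direct summand of an indecomposable module is all of it. -/
theorem isomorphic_of_isUnit_comp [Nontrivial V] (h : IsIndecomposable σ)
    {i : V →ₗ[k] W} {q : W →ₗ[k] V} (hi : ρ.IsIntertwiningMap σ i)
    (hq : σ.IsIntertwiningMap ρ q) (hu : IsUnit (q ∘ₗ i : Module.End k V)) :
    Isomorphic ρ σ := by
  have hinj : Function.Injective (q ∘ₗ i) := ((Module.End.isUnit_iff _).1 hu).injective
  have hsurj : Function.Surjective (q ∘ₗ i) := ((Module.End.isUnit_iff _).1 hu).surjective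
  have hii : Function.Injective i := fun x y hxy => hinj (by simp [hxy])
  have hc : IsCompl (LinearMap.range i) (LinearMap.ker q) := by
    rw [isCompl_iff, disjoint_iff, codisjoint_iff, Submodule.eq_bot_iff, Submodule.eq_top_iff']
    constructor
    · rintro _ ⟨⟨x, rfl⟩, hx⟩
      have : (q ∘ₗ i) x = (q ∘ₗ i) 0 := by simpa using hx
      rw [hinj this, map_zero]
    · intro w
      obtain ⟨x, hx⟩ := hsurj (q w)
      rw [show w = i x + (w - i x) by abel]
      exact Submodule.add_mem_sup ⟨x, rfl⟩ (by
        rw [LinearMap.mem_ker, map_sub, ← hx, LinearMap.comp_apply, sub_self])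
  rcases eq_bot_or_eq_bot_of_isCompl h (A := rangeSubrep i hi) (B := kerSubrep q hq) hc with h1 | h1
  · obtain ⟨x, hx⟩ := exists_ne (0 : V)
    exact absurd (hii ((LinearMap.congr_fun (LinearMap.range_eq_bot.1 h1) x).trans
      (map_zero i).symm)) hx
  · refine isomorphic_of_bijective hi ⟨hii, fun w => ?_⟩
    have h2 : LinearMap.range i = ⊤ := by
      have := hc.sup_eq_top
      rw [show LinearMap.ker q = ⊥ from h1, sup_bot_eq] at this
      exact this
    exact LinearMap.range_eq_top.1 h2 w

end Intertwining

/-! ### Projectivity and relative traces -/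

section Higman

variable {k : Type*} [Field k] {G : Type*} [Group G] [Finite G]
  {V : Type*} [AddCommGroup V] [Module k V]

/-- One half of Higman's criterion for projectivity: averaging a `k`-linear section of a surjection
against `α`, where the identity is `∑ g α g⁻¹`, gives an equivariant section. -/
theorem isProjective_of_mem {ρ : Representation k G V}
    (h : LinearMap.id ∈ traceModule (ρ.linHom ρ) G) : IsProjective ρ := by
  cases nonempty_fintype G
  obtain ⟨α, hα⟩ := mem_traceModule_self.1 h
  rw [finsum_eq_sum_of_fintype] at hα
  have hα' : ∀ v, ∑ g : G, ρ g (α (ρ g⁻¹ v)) = v := fun v => by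
    simpa using LinearMap.congr_fun hα v
  refine Module.Projective.of_lifting_property'' fun f hf => ?_
  obtain ⟨s, hs⟩ := LinearMap.exists_rightInverse_of_surjective (f.restrictScalars k)
    (LinearMap.range_eq_top.2 hf)
  have hs' : ∀ v, f (s v) = v := fun v => LinearMap.congr_fun hs v
  -- the average of the `k`-linear section `s`, twisted by `α`
  let T : ρ.asModule →ₗ[k] (ρ.asModule →₀ MonoidAlgebra k G) :=
    ∑ g : G, (Algebra.lsmul k k _ (MonoidAlgebra.single g (1 : k))) ∘ₗ s ∘ₗ
      (ρ.asModuleEquiv.symm.toLinearMap ∘ₗ α ∘ₗ (ρ g⁻¹) ∘ₗ ρ.asModuleEquiv.toLinearMap)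
  have hT : ∀ v : ρ.asModule, T v = ∑ g : G, (MonoidAlgebra.single g (1 : k)) •
      s (ρ.asModuleEquiv.symm (α (ρ g⁻¹ (ρ.asModuleEquiv v)))) := fun v => by
    simp [T, LinearMap.sum_apply]
  refine ⟨MonoidAlgebra.equivariantOfLinearOfComm T fun g v => ?_, LinearMap.ext fun v => ?_⟩
  · rw [hT, hT, Finset.smul_sum]
    refine Fintype.sum_equiv (Equiv.mulLeft g⁻¹) _ _ fun x => ?_
    rw [smul_smul, MonoidAlgebra.single_mul_single, Representation.single_smul]
    simp [Representation.asModuleEquiv]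
    rfl
  · rw [LinearMap.comp_apply, MonoidAlgebra.equivariantOfLinearOfComm_apply, hT, map_sum]
    simp_rw [map_smul, hs', Representation.single_smul, one_smul]
    exact hα' v

/-- The other half of Higman's criterion: a projective module is a summand of the coinduced module
of all functions on `G`, where the projection to the functions supported at `1` has the identity as
its trace. -/
theorem mem_of_isProjective {ρ : Representation k G V} (h : IsProjective ρ) :
    LinearMap.id ∈ traceModule (ρ.linHom ρ) G := by
  cases nonempty_fintype G
  -- the coinduced module of all functions `G → V`
  let ℓ : Representation k G (G → V) :=
    { toFun := fun g => LinearMap.funLeft k V fun x => g⁻¹ * x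
      map_one' := by ext; simp [LinearMap.funLeft]
      map_mul' := fun a b => by ext; simp [LinearMap.funLeft, mul_assoc] }
  have hℓ : ∀ g f x, ℓ g f x = f (g⁻¹ * x) := fun _ _ _ => rfl
  let π : (G → V) →ₗ[k] V := ∑ g : G, ρ g ∘ₗ LinearMap.proj g
  have hπ : ∀ f, π f = ∑ g, ρ g (f g) := fun f => by simp [π, LinearMap.sum_apply]
  have hi : ∀ g f, π (ℓ g f) = ρ g (π f) := fun g f => by
    rw [hπ, hπ, map_sum]
    refine Fintype.sum_equiv (Equiv.mulLeft g⁻¹) _ _ fun x => ?_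
    simp [hℓ]
  let πi : ℓ.IntertwiningMap ρ := π.intertwiningMap_of_isIntertwiningMap ℓ ρ hi
  have hsurj : Function.Surjective π := fun v => by
    classical
    refine ⟨Pi.single 1 v, ?_⟩
    rw [hπ, Finset.sum_eq_single 1] <;> simp +contextual
  have : Module.Projective (MonoidAlgebra k G) ρ.asModule := h
  obtain ⟨s, hs⟩ := Module.projective_lifting_property
    (Representation.IntertwiningMap.equivLinearMapAsModule ℓ ρ πi) LinearMap.id hsurj
  let si : ρ.IntertwiningMap ℓ :=
    (Representation.IntertwiningMap.equivLinearMapAsModule ρ ℓ).symm s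
  have hs' : ∀ v, π (si v) = v := fun v => LinearMap.congr_fun hs v
  refine mem_traceModule_self.2 ⟨LinearMap.proj 1 ∘ₗ si.toLinearMap, ?_⟩
  rw [finsum_eq_sum_of_fintype]
  ext v
  conv_rhs => rw [LinearMap.id_apply, ← hs' v, hπ]
  rw [LinearMap.sum_apply]
  refine Finset.sum_congr rfl fun g _ => ?_
  simp [si.isIntertwining, hℓ]

end Higman

section RelativeHigman

variable {k : Type u} [Field k] {G : Type v} [Group G] [Finite G]
  {V : Type w} [AddCommGroup V] [Module k V]

theorem isRelativelyProjective_of_mem [FiniteDimensional k V] {ρ : Representation k G V}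
    {H : Subgroup G} (h : LinearMap.id ∈ traceModule (ρ.linHom ρ) (G ⧸ H)) :
    IsRelativelyProjective ρ H := by
  obtain ⟨α, hα, hsum⟩ := mem_traceModule_quotient.1 h
  have hα' : ∀ (h : H) v, ρ h (α v) = α (ρ h v) := fun h v => by
    conv_rhs => rw [← hα h h.2]
    simp
  refine ⟨Rep.of (restrict ρ H), ‹_›, isDirectSummand_iff.2 ?_⟩
  let L := restrict ρ H
  let σ := L.ind H.subtype
  let m : V →ₗ[k] Representation.IndV H.subtype L := Representation.IndV.mk H.subtype L 1
  have hm : ∀ (h : H) v, σ h (m v) = m (ρ h v) := fun h v => by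
    have h1 := Representation.Coinvariants.mk_self_apply
      (Representation.tprod ((Representation.leftRegular k G).comp H.subtype) L) h
      (MonoidAlgebra.single (h : G)⁻¹ 1 ⊗ₜ v)
    simp only [Representation.tprod_apply, TensorProduct.map_tmul] at h1
    simp only [MonoidHom.comp_apply, Subgroup.subtype_apply,
      Representation.ofMulAction_single, smul_eq_mul, mul_inv_cancel] at h1
    rw [Representation.ind_mk, one_mul]
    exact h1.symm
  let i : V →ₗ[k] Representation.IndV H.subtype L := relTrace (ρ.linHom σ) H (m ∘ₗ α)
  let q : Representation.IndV H.subtype L →ₗ[k] V :=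
    Representation.Coinvariants.lift _ (TensorProduct.lift
      ((Finsupp.lift _ _ _ fun g => ρ g⁻¹) ∘ₗ (MonoidAlgebra.coeffLinearEquiv k).toLinearMap))
      fun g => by
        ext h x
        simp [L]
  have hq : ∀ g v, q (Representation.IndV.mk H.subtype L g v) = ρ g⁻¹ v := fun g v => by
    simp [q]
  have hmα : ∀ h ∈ H, (ρ.linHom σ) h (m ∘ₗ α) = m ∘ₗ α := fun h hh => by
    ext v
    have h1 := hm ⟨h, hh⟩ (α (ρ h⁻¹ v))
    have h2 := hα' ⟨h, hh⟩ (ρ h⁻¹ v)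
    simp only [Representation.self_inv_apply] at h2
    rw [h2] at h1
    exact h1
  have hqi : σ.IsIntertwiningMap ρ q := by
    refine ⟨fun g v => ?_⟩
    suffices h : q ∘ₗ σ g = ρ g ∘ₗ q from LinearMap.congr_fun h v
    refine Representation.IndV.hom_ext _ _ fun x => LinearMap.ext fun y => ?_
    change q (σ g (Representation.IndV.mk H.subtype L x y)) =
      ρ g (q (Representation.IndV.mk H.subtype L x y))
    rw [Representation.ind_mk, hq, hq]
    simp
  refine ⟨i, q, isIntertwiningMap_of_mem_traceModule (relTrace_mem hmα), hqi, ?_⟩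
  have h1 := map_relTrace (τ := ρ.linHom σ) (τ' := ρ.linHom ρ)
    (LinearMap.llcomp k V _ V q) (fun g f => by
      ext v
      simp [hqi.isIntertwining]) H (m ∘ₗ α)
  refine h1.trans ?_
  rw [← hsum]
  congr 1
  ext v
  exact (hq 1 (α v)).trans (by simp)

theorem mem_of_isRelativelyProjective {ρ : Representation k G V}
    {H : Subgroup G} (h : IsRelativelyProjective ρ H) :
    LinearMap.id ∈ traceModule (ρ.linHom ρ) (G ⧸ H) := by
  obtain ⟨L, -, hL⟩ := h
  refine mem_of_isDirectSummand hL ?_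
  classical
  cases nonempty_fintype (G ⧸ H)
  let σ := L.ρ.ind H.subtype
  -- the projection of the induced module onto its summand `1 ⊗ L`
  let P : Representation.IndV H.subtype L.ρ →ₗ[k] Representation.IndV H.subtype L.ρ :=
    Representation.Coinvariants.lift _ (TensorProduct.lift
      ((Finsupp.lift _ _ _ fun g =>
        if g ∈ H then Representation.IndV.mk H.subtype L.ρ g else 0) ∘ₗ
          (MonoidAlgebra.coeffLinearEquiv k).toLinearMap))
      fun g => by
        ext h x
        by_cases hh : h ∈ H
        · have h1 := Representation.Coinvariants.mk_self_apply
            (Representation.tprod ((Representation.leftRegular k G).comp H.subtype) L.ρ) g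
            (MonoidAlgebra.single h 1 ⊗ₜ x)
          simpa [hh, H.mul_mem_cancel_left g.2] using h1
        · simp [hh, H.mul_mem_cancel_left g.2]
  have hP : ∀ g v, P (Representation.IndV.mk H.subtype L.ρ g v) =
      if g ∈ H then Representation.IndV.mk H.subtype L.ρ g v else 0 := fun g v => by
    by_cases hg : g ∈ H <;> simp [P, hg]
  have hPf : ∀ h ∈ H, (σ.linHom σ) h P = P := fun h hh => by
    refine Representation.IndV.hom_ext _ _ fun x => LinearMap.ext fun y => ?_
    change σ h (P (σ h⁻¹ (Representation.IndV.mk H.subtype L.ρ x y))) =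
      P (Representation.IndV.mk H.subtype L.ρ x y)
    rw [Representation.ind_mk, hP, hP, inv_inv, H.mul_mem_cancel_right hh]
    split_ifs
    · rw [Representation.ind_mk, mul_inv_cancel_right]
    · rw [map_zero]
  refine mem_traceModule_quotient.2 ⟨P, hPf, ?_⟩
  refine Representation.IndV.hom_ext _ _ fun x => LinearMap.ext fun y => ?_
  rw [relTrace, finsum_eq_sum_of_fintype]
  simp only [LinearMap.comp_apply, LinearMap.sum_apply, LinearMap.id_apply]
  have hterm : ∀ q : G ⧸ H, (σ.linHom σ) q.out P (Representation.IndV.mk H.subtype L.ρ x y) =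
      if q = ((x⁻¹ : G) : G ⧸ H) then Representation.IndV.mk H.subtype L.ρ x y else 0 := fun q => by
    change σ q.out (P (σ q.out⁻¹ (Representation.IndV.mk H.subtype L.ρ x y))) = _
    rw [Representation.ind_mk, hP, inv_inv]
    have : x * q.out ∈ H ↔ q = ((x⁻¹ : G) : G ⧸ H) := by
      conv_rhs => rw [← QuotientGroup.out_eq' q, eq_comm, QuotientGroup.eq, inv_inv]
    simp only [this]
    split_ifs
    · rw [Representation.ind_mk, mul_inv_cancel_right]
    · rw [map_zero]
  have := Finset.sum_congr (rfl : (Finset.univ : Finset (G ⧸ H)) = _) fun q _ => hterm q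
  refine this.trans ?_
  rw [Finset.sum_ite_eq' Finset.univ, if_pos (Finset.mem_univ _)]
  rfl

/-- Higman's criterion for relative projectivity. -/
theorem isRelativelyProjective_iff [FiniteDimensional k V] {ρ : Representation k G V}
    {H : Subgroup G} : IsRelativelyProjective ρ H ↔
      LinearMap.id ∈ traceModule (ρ.linHom ρ) (G ⧸ H) :=
  ⟨mem_of_isRelativelyProjective, isRelativelyProjective_of_mem⟩

end RelativeHigman

/-! ### The conjugation action on the group algebra and the Brauer map -/

section Conj

variable {k : Type*} [Field k] {G : Type*} [Group G]

variable (k G) in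
/-- The group algebra as a representation of the group, acting by conjugation. -/
def conjRep : Representation k G (MonoidAlgebra k G) where
  toFun g := LinearMap.mulLeft k (MonoidAlgebra.of k G g) ∘ₗ
    LinearMap.mulRight k (MonoidAlgebra.of k G g⁻¹)
  map_one' := by ext; simp
  map_mul' a b := by
    refine LinearMap.ext fun x => ?_
    simp only [LinearMap.comp_apply, LinearMap.mulLeft_apply, LinearMap.mulRight_apply, mul_inv_rev,
      map_mul, Module.End.mul_apply, mul_assoc]

theorem conjRep_apply (g : G) (a : MonoidAlgebra k G) :
    conjRep k G g a = MonoidAlgebra.of k G g * a * MonoidAlgebra.of k G g⁻¹ := by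
  simp only [conjRep, MonoidHom.coe_mk, OneHom.coe_mk, LinearMap.comp_apply,
    LinearMap.mulLeft_apply, LinearMap.mulRight_apply, mul_assoc]

theorem of_mul_of_inv (g : G) : MonoidAlgebra.of k G g * MonoidAlgebra.of k G g⁻¹ = 1 := by
  rw [← map_mul, mul_inv_cancel, map_one]

theorem of_inv_mul_of (g : G) : MonoidAlgebra.of k G g⁻¹ * MonoidAlgebra.of k G g = 1 := by
  rw [← map_mul, inv_mul_cancel, map_one]

theorem conjRep_eq_iff {g : G} {a : MonoidAlgebra k G} :
    conjRep k G g a = a ↔ MonoidAlgebra.of k G g * a = a * MonoidAlgebra.of k G g := by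
  rw [conjRep_apply]
  constructor
  · intro h
    conv_rhs => rw [← h, mul_assoc, of_inv_mul_of, mul_one]
  · intro h
    rw [h, mul_assoc, of_mul_of_inv, mul_one]

theorem conjRep_mul (g : G) (a b : MonoidAlgebra k G) :
    conjRep k G g (a * b) = conjRep k G g a * conjRep k G g b := by
  simp only [conjRep_apply]
  calc _ = MonoidAlgebra.of k G g * a * 1 * b * MonoidAlgebra.of k G g⁻¹ := by
        rw [mul_one, mul_assoc _ a b]
    _ = _ := by rw [← of_inv_mul_of g]; simp only [mul_assoc]

theorem coeff_conjRep (g : G) (a : MonoidAlgebra k G) (x : G) :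
    (conjRep k G g a).coeff x = a.coeff (g⁻¹ * x * g) := by
  rw [conjRep_apply]
  simp [mul_assoc]

theorem mem_center_iff_conjRep {a : MonoidAlgebra k G} :
    a ∈ Subalgebra.center k (MonoidAlgebra k G) ↔ ∀ g, conjRep k G g a = a := by
  simp only [conjRep_eq_iff]
  rw [Subalgebra.mem_center_iff]
  refine ⟨fun h g => h _, fun h b => ?_⟩
  induction b using MonoidAlgebra.induction_linear with
  | zero => simp
  | add x y hx hy => rw [add_mul, mul_add, hx, hy]
  | single g r =>
    have h1 : MonoidAlgebra.single g r = r • MonoidAlgebra.of k G g := by simp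
    rw [h1, smul_mul_assoc, mul_smul_comm, h g]

theorem traceModule_conjRep_le_center {S : Type*} [MulAction G S] [Finite S]
    {z : MonoidAlgebra k G} (hz : z ∈ traceModule (conjRep k G) S) :
    z ∈ Subalgebra.center k (MonoidAlgebra k G) :=
  mem_center_iff_conjRep.2 (rho_apply_of_mem_traceModule hz)

/-- The elements of `G`, with `G` acting by conjugation. A separate type, as `G` itself carries the
action by left multiplication. -/
structure ConjPoint (G : Type*) where
  /-- The underlying element. -/
  pt : G

/-- The points of `ConjPoint G` are the elements of `G`. -/
def conjPointEquiv (G : Type*) : G ≃ ConjPoint G := ⟨.mk, ConjPoint.pt, fun _ => rfl, fun _ => rfl⟩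

instance [Finite G] : Finite (ConjPoint G) := .of_equiv G (conjPointEquiv G)

instance : MulAction G (ConjPoint G) where
  smul g x := ⟨g * x.pt * g⁻¹⟩
  one_smul x := congrArg ConjPoint.mk (show 1 * x.pt * 1⁻¹ = x.pt by simp)
  mul_smul a b x := congrArg ConjPoint.mk
    (show a * b * x.pt * (a * b)⁻¹ = a * (b * x.pt * b⁻¹) * a⁻¹ by group)

/-- An element fixed by `K`, whose support consists of points with trivial stabilizer in `K`, is a
trace from the trivial subgroup of `K`. -/
theorem mem_traceModule_conjRep_of_free [Finite G] {K : Subgroup G} {a : MonoidAlgebra k G}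
    (ha : ∀ x ∈ K, conjRep k G x a = a)
    (hfree : ∀ x, a.coeff x ≠ 0 → ∀ d ∈ K, d * x * d⁻¹ = x → d = 1) :
    a ∈ traceModule (restrict (conjRep k G) K) K := by
  classical
  cases nonempty_fintype G
  have h := finsum_mem_traceModule_self (G := K) (τ := restrict (conjRep k G) K)
    (fun x : ConjPoint G => MonoidAlgebra.single x.pt (a.coeff x.pt)) (fun d x => ?_)
    (fun x hx d hd => ?_)
  · convert h
    rw [← finsum_comp_equiv (conjPointEquiv G), finsum_eq_sum_of_fintype]
    ext y
    simp [MonoidAlgebra.coeff_sum, conjPointEquiv]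
  · change MonoidAlgebra.single ((d : G) * x.pt * (d : G)⁻¹)
      (a.coeff ((d : G) * x.pt * (d : G)⁻¹)) =
      conjRep k G d (MonoidAlgebra.single x.pt (a.coeff x.pt))
    have h1 : a.coeff ((d : G) * x.pt * (d : G)⁻¹) = a.coeff x.pt := by
      conv_lhs => rw [← ha d d.2, coeff_conjRep]
      simp [mul_assoc]
    rw [h1, conjRep_apply]
    simp
  · refine Subtype.ext (hfree x.pt (fun h0 => hx ?_) d d.2 (congrArg ConjPoint.pt hd))
    simp only [h0, MonoidAlgebra.single_zero]

open Classical in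
/-- The Brauer map of a subgroup `P`: the coefficients outside the centralizer of `P` are replaced
by zero. -/
def brauerMap (P : Subgroup G) : MonoidAlgebra k G →ₗ[k] MonoidAlgebra k G where
  toFun a := .ofCoeff (a.coeff.filter (· ∈ Subgroup.centralizer (P : Set G)))
  map_add' a b := by rw [MonoidAlgebra.coeff_add, Finsupp.filter_add, MonoidAlgebra.ofCoeff_add]
  map_smul' c a := by
    rw [MonoidAlgebra.coeff_smul, Finsupp.filter_smul, MonoidAlgebra.ofCoeff_smul]
    rfl

open Classical in
theorem coeff_brauerMap (P : Subgroup G) (a : MonoidAlgebra k G) (x : G) :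
    (brauerMap P a).coeff x =
      if x ∈ Subgroup.centralizer (P : Set G) then a.coeff x else 0 :=
  Finsupp.filter_apply _ _ _

theorem conj_mem_centralizer_iff {P : Subgroup G} {g : G}
    (hg : g ∈ Subgroup.normalizer (P : Set G)) (x : G) :
    g⁻¹ * x * g ∈ Subgroup.centralizer (P : Set G) ↔ x ∈ Subgroup.centralizer (P : Set G) := by
  rw [Subgroup.mem_normalizer_iff] at hg
  simp only [Subgroup.mem_centralizer_iff, SetLike.mem_coe]
  constructor
  · intro h d hd
    have h1 := h (g⁻¹ * d * g) ((hg _).2 (by simpa [mul_assoc] using hd))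
    have h2 := congrArg (fun y => g * y * g⁻¹) h1
    simpa [mul_assoc] using h2
  · intro h d hd
    have h1 := h _ ((hg d).1 hd)
    have h2 := congrArg (fun y => g⁻¹ * y * g) h1
    simpa [mul_assoc] using h2

theorem brauerMap_conjRep {P : Subgroup G} {g : G} (hg : g ∈ Subgroup.normalizer (P : Set G))
    (a : MonoidAlgebra k G) : brauerMap P (conjRep k G g a) = conjRep k G g (brauerMap P a) := by
  classical
  ext x
  rw [coeff_brauerMap, coeff_conjRep, coeff_conjRep, coeff_brauerMap, conj_mem_centralizer_iff hg]

theorem brauerMap_brauerMap (P : Subgroup G) (a : MonoidAlgebra k G) :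
    brauerMap P (brauerMap P a) = brauerMap P a := by
  classical
  ext x
  simp only [coeff_brauerMap]
  split_ifs <;> rfl

variable {P : Subgroup G}

theorem brauerMap_eq_zero_of_mem [Finite G] (hP : (Nat.card P : k) = 0) {z : MonoidAlgebra k G}
    (hz : z ∈ traceModule (restrict (conjRep k G) P) P) : brauerMap P z = 0 := by
  classical
  cases nonempty_fintype P
  obtain ⟨x, rfl⟩ := mem_traceModule_self.1 hz
  ext c
  rw [coeff_brauerMap]
  split_ifs with hc
  · rw [finsum_eq_sum_of_fintype, MonoidAlgebra.coeff_sum, Finset.sum_apply']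
    have h1 : ∀ d : P, ((restrict (conjRep k G) P) d x).coeff c = x.coeff c := fun d => by
      refine (coeff_conjRep (d : G) x c).trans ?_
      rw [mul_assoc, ← Subgroup.mem_centralizer_iff.1 hc d d.2, inv_mul_cancel_left]
    simp only [h1]
    rw [Finset.sum_const, Finset.card_univ, ← Nat.card_eq_fintype_card, ← Nat.cast_smul_eq_nsmul k,
      hP, zero_smul]
    rfl
  · rfl

theorem eq_one_of_conj_eq {p : ℕ} [Fact p.Prime] (hP : Nat.card P = p) {x d : G}
    (hx : x ∉ Subgroup.centralizer (P : Set G)) (hd : d ∈ P) (h : d * x * d⁻¹ = x) : d = 1 := by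
  by_contra hd1
  refine hx (Subgroup.mem_centralizer_iff.2 fun y hy => ?_)
  have h1 := zpowers_eq_top_of_prime_card hP (g := (⟨d, hd⟩ : P)) fun h =>
    hd1 (congrArg Subtype.val h)
  have h2 : (⟨y, hy⟩ : P) ∈ Subgroup.zpowers (⟨d, hd⟩ : P) := h1 ▸ Subgroup.mem_top _
  obtain ⟨n, hn⟩ := Subgroup.mem_zpowers_iff.1 h2
  have h3 : y = d ^ n := by
    have := congrArg Subtype.val hn
    simpa using this.symm
  have hc : Commute d x := mul_inv_eq_iff_eq_mul.1 h
  rw [h3]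
  exact hc.zpow_left n

/-- The Brauer map differs from the identity by a trace from the trivial subgroup, as a group of
order `p` acts freely on the elements which it does not centralize. -/
theorem sub_brauerMap_mem [Finite G] {p : ℕ} [Fact p.Prime] (hP : Nat.card P = p)
    {a : MonoidAlgebra k G} (ha : ∀ x ∈ P, conjRep k G x a = a) :
    a - brauerMap P a ∈ traceModule (restrict (conjRep k G) P) P := by
  classical
  refine mem_traceModule_conjRep_of_free (fun x hx => ?_) fun x hx d hd h => ?_
  · rw [map_sub, ← brauerMap_conjRep (Subgroup.le_normalizer hx), ha x hx]
  · refine eq_one_of_conj_eq hP (fun hc => hx ?_) hd h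
    simp [coeff_brauerMap, hc]

theorem mul_mem_traceModule_conjRep {K : Subgroup G} {S : Type*} [MulAction K S] [Finite S]
    {a z : MonoidAlgebra k G} (ha : ∀ x ∈ K, conjRep k G x a = a)
    (hz : z ∈ traceModule (restrict (conjRep k G) K) S) :
    a * z ∈ traceModule (restrict (conjRep k G) K) S :=
  map_mem_traceModule (LinearMap.mulLeft k a) (fun g x => by
    change a * conjRep k G g x = conjRep k G g (a * x)
    rw [conjRep_mul, ha g g.2]) hz

theorem mem_traceModule_conjRep_mul {K : Subgroup G} {S : Type*} [MulAction K S] [Finite S]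
    {a z : MonoidAlgebra k G} (ha : ∀ x ∈ K, conjRep k G x a = a)
    (hz : z ∈ traceModule (restrict (conjRep k G) K) S) :
    z * a ∈ traceModule (restrict (conjRep k G) K) S :=
  map_mem_traceModule (LinearMap.mulRight k a) (fun g x => by
    change conjRep k G g x * a = conjRep k G g (x * a)
    rw [conjRep_mul, ha g g.2]) hz

/-- The product of two elements supported on the centralizer is again supported there. -/
theorem brauerMap_brauerMap_mul [Finite G] (P : Subgroup G) (a b : MonoidAlgebra k G) :
    brauerMap P (brauerMap P a * brauerMap P b) = brauerMap P a * brauerMap P b := by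
  classical
  cases nonempty_fintype G
  ext x
  rw [coeff_brauerMap]
  split_ifs with hx
  · rfl
  · have key : ∀ c : MonoidAlgebra k G, c.coeff.sum (fun y r => MonoidAlgebra.single y r) = c :=
      MonoidAlgebra.sum_coeff_single
    conv_rhs => rw [← key (brauerMap P a)]
    rw [Finsupp.sum, Finset.sum_mul, MonoidAlgebra.coeff_sum, Finset.sum_apply']
    symm
    refine Finset.sum_eq_zero fun y hy => ?_
    rw [MonoidAlgebra.coeff_single_mul_apply, coeff_brauerMap, coeff_brauerMap]
    by_cases h1 : y ∈ Subgroup.centralizer (P : Set G)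
    · rw [if_neg (c := y⁻¹ * x ∈ _), mul_zero]
      rwa [Subgroup.mul_mem_cancel_left _ (inv_mem h1)]
    · rw [if_neg h1, zero_mul]

/-- The Brauer map is multiplicative on the fixed points of `P`. -/
theorem brauerMap_mul [Finite G] {p : ℕ} [Fact p.Prime] [CharP k p] (hP : Nat.card P = p)
    {a b : MonoidAlgebra k G} (ha : ∀ x ∈ P, conjRep k G x a = a)
    (hb : ∀ x ∈ P, conjRep k G x b = b) :
    brauerMap P (a * b) = brauerMap P a * brauerMap P b := by
  have hP0 : (Nat.card P : k) = 0 := by rw [hP, CharP.cast_eq_zero]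
  have hba : ∀ x ∈ P, conjRep k G x (brauerMap P a) = brauerMap P a := fun x hx => by
    rw [← brauerMap_conjRep (Subgroup.le_normalizer hx), ha x hx]
  have h : a * b = brauerMap P a * brauerMap P b +
      ((a - brauerMap P a) * b + brauerMap P a * (b - brauerMap P b)) := by noncomm_ring
  have h' := brauerMap_eq_zero_of_mem hP0
    (add_mem (mem_traceModule_conjRep_mul hb (sub_brauerMap_mem hP ha))
      (mul_mem_traceModule_conjRep hba (sub_brauerMap_mem hP hb)))
  rw [h, map_add, brauerMap_brauerMap_mul, h', add_zero]

theorem brauerMap_pow [Finite G] {p : ℕ} [Fact p.Prime] [CharP k p] (hP : Nat.card P = p)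
    {a : MonoidAlgebra k G} (ha : ∀ x ∈ P, conjRep k G x a = a) (n : ℕ) :
    brauerMap P (a ^ (n + 1)) = brauerMap P a ^ (n + 1) := by
  have hpow : ∀ n, ∀ x ∈ P, conjRep k G x (a ^ (n + 1)) = a ^ (n + 1) := fun n x hx => by
    rw [conjRep_eq_iff]
    exact (Commute.pow_right (conjRep_eq_iff.1 (ha x hx)) _)
  induction n with
  | zero => simp
  | succ n ih => rw [pow_succ, brauerMap_mul hP (hpow n) ha, ih, ← pow_succ]

end Conj

section NormalSubgroup

variable {k : Type*} [Field k] {G : Type*} [Group G] [Finite G] {P : Subgroup G}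
  {p : ℕ} [Fact p.Prime] [CharP k p]

/-- A group of order `p` has non-zero fixed points on every non-zero module. -/
theorem exists_fixed_vector {V : Type*} [AddCommGroup V] [Module k V] [Nontrivial V]
    (ρ : Representation k G V) (hP : Nat.card P = p) :
    ∃ v ≠ (0 : V), ∀ x ∈ P, ρ x v = v := by
  have hp : p.Prime := Fact.out
  have hnt : Nontrivial P := Finite.one_lt_card_iff_nontrivial.1 (hP ▸ hp.one_lt)
  obtain ⟨d, hd⟩ := exists_ne (1 : P)
  have : CharP (Module.End k V) p := charP_of_injective_algebraMap (algebraMap k _).injective p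
  have h1 : (ρ d - 1) ^ p = 0 := by
    rw [sub_pow_char_of_commute p (Commute.one_right _), ← map_pow, one_pow]
    have : d ^ p = 1 := hP ▸ pow_card_eq_one'
    have : (d : G) ^ p = 1 := by simpa using congrArg Subtype.val this
    rw [this, map_one, sub_self]
  have h2 : ¬ Function.Injective (ρ d - 1 : Module.End k V) := fun h => by
    obtain ⟨v, hv⟩ := exists_ne (0 : V)
    refine hv ((Module.End.iterate_injective h p) ?_)
    rw [h1]
    simp
  rw [← LinearMap.ker_eq_bot, Submodule.eq_bot_iff] at h2
  push Not at h2
  obtain ⟨v, hv, hv0⟩ := h2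
  refine ⟨v, hv0, fun x hx => ?_⟩
  have hdv : ρ d v = v := by
    rw [LinearMap.mem_ker, LinearMap.sub_apply] at hv
    exact sub_eq_zero.1 hv
  have h3 : (⟨x, hx⟩ : P) ∈ Subgroup.zpowers d :=
    zpowers_eq_top_of_prime_card hP hd ▸ Subgroup.mem_top _
  rw [← mem_powers_iff_mem_zpowers] at h3
  obtain ⟨n, hn⟩ := Submonoid.mem_powers_iff _ _ |>.1 h3
  have h4 : x = (d : G) ^ n := by simpa using (congrArg Subtype.val hn).symm
  rw [h4]
  clear h4 hn
  induction n with
  | zero => simp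
  | succ n ih => rw [pow_succ, map_mul, Module.End.mul_apply, hdv, ih]

/-- A central element in the kernel of the Brauer map of a normal subgroup of order `p` is a trace
from the trivial subgroup, so it acts as `p = 0` times another element on the fixed points of that
subgroup. In particular it does not act injectively on any non-zero module. -/
theorem exists_ne_zero_asAlgebraHom_apply_eq_zero [P.Normal] (hP : Nat.card P = p)
    {z : MonoidAlgebra k G} (hz : z ∈ Subalgebra.center k (MonoidAlgebra k G))
    (hbr : brauerMap P z = 0) {V : Type*} [AddCommGroup V] [Module k V] [Nontrivial V]
    (ρ : Representation k G V) : ∃ v ≠ (0 : V), ρ.asAlgebraHom z v = 0 := by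
  cases nonempty_fintype P
  obtain ⟨v, hv0, hv⟩ := exists_fixed_vector ρ hP
  refine ⟨v, hv0, ?_⟩
  have h1 := sub_brauerMap_mem hP (a := z) fun x _ => mem_center_iff_conjRep.1 hz x
  rw [hbr, sub_zero] at h1
  obtain ⟨y, hy⟩ := mem_traceModule_self.1 h1
  have h2 : ∀ y : MonoidAlgebra k G, ∀ x ∈ P, ρ x (ρ.asAlgebraHom y v) = ρ.asAlgebraHom y v := by
    intro y x hx
    induction y using MonoidAlgebra.induction_linear with
    | zero => simp
    | add a b ha hb => simp [ha, hb]
    | single g r =>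
      have h3 : x * g = g * (g⁻¹ * x * g) := by group
      have h4 : g⁻¹ * x * g ∈ P := by
        simpa using ‹P.Normal›.conj_mem x hx g⁻¹
      simp only [Representation.asAlgebraHom_single, LinearMap.smul_apply, map_smul]
      rw [← Module.End.mul_apply, ← map_mul, h3, map_mul, Module.End.mul_apply, hv _ h4]
  have h5 : ∀ d : P, ρ.asAlgebraHom ((restrict (conjRep k G) P) d y) v = ρ.asAlgebraHom y v := by
    intro d
    change ρ.asAlgebraHom (conjRep k G d y) v = _
    rw [conjRep_apply, map_mul, map_mul, Representation.asAlgebraHom_of,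
      Representation.asAlgebraHom_of, Module.End.mul_apply, Module.End.mul_apply,
      hv _ (inv_mem d.2), h2 _ _ d.2]
  rw [← hy, finsum_eq_sum_of_fintype, map_sum, LinearMap.sum_apply]
  simp only [h5]
  rw [Finset.sum_const, Finset.card_univ, ← Nat.card_eq_fintype_card, hP,
    ← Nat.cast_smul_eq_nsmul k, CharP.cast_eq_zero, zero_smul]

/-- The kernel of the Brauer map on the centre is nil: on the Fitting component of the group algebra
on which the element is injective, it has a non-zero kernel unless that component is zero. -/
theorem isNilpotent_of_brauerMap_eq_zero [P.Normal] (hP : Nat.card P = p)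
    {z : MonoidAlgebra k G} (hz : z ∈ Subalgebra.center k (MonoidAlgebra k G))
    (hbr : brauerMap P z = 0) : IsNilpotent z := by
  have hfd : FiniteDimensional k (MonoidAlgebra k G) :=
    Module.Finite.equiv (MonoidAlgebra.coeffLinearEquiv k).symm
  let L : Module.End k (MonoidAlgebra k G) := LinearMap.mulLeft k z
  obtain ⟨n, hn⟩ := Filter.eventually_atTop.1 (LinearMap.eventually_isCompl_ker_pow_range_pow L)
  have hn' := hn (n + 1) (by lia)
  have hL : ∀ m x, (L ^ m) x = z ^ m * x := fun m x => by
    rw [LinearMap.pow_mulLeft, LinearMap.mulLeft_apply]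
  have hcomm : ∀ b, b * z = z * b := Subalgebra.mem_center_iff.1 hz
  let lr : Representation k G (MonoidAlgebra k G) :=
    { toFun := fun g => LinearMap.mulLeft k (MonoidAlgebra.of k G g)
      map_one' := by ext; simp
      map_mul' := fun a b => by
        refine LinearMap.ext fun x => ?_
        simp only [map_mul, LinearMap.mulLeft_apply, Module.End.mul_apply, mul_assoc] }
  have hlr : ∀ a x, lr.asAlgebraHom a x = a * x := fun a x => by
    induction a using MonoidAlgebra.induction_linear with
    | zero => simp
    | add a b ha hb => simp [ha, hb, add_mul]
    | single g r =>
      have h1 : MonoidAlgebra.single g r = r • MonoidAlgebra.of k G g := by simp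
      rw [h1, map_smul, Representation.asAlgebraHom_of, LinearMap.smul_apply, smul_mul_assoc]
      rfl
  let U : Subrepresentation lr :=
    { toSubmodule := LinearMap.range (L ^ (n + 1))
      apply_mem_toSubmodule := by
        rintro g _ ⟨x, rfl⟩
        refine ⟨MonoidAlgebra.of k G g * x, ?_⟩
        rw [hL, hL, ← mul_assoc, ((show Commute _ z from hcomm _).pow_right (n + 1)).eq.symm,
          mul_assoc]
        rfl }
  have hU : LinearMap.range (L ^ (n + 1)) = ⊥ := by
    by_contra hne
    have : Nontrivial U.toSubmodule := Submodule.nontrivial_iff_ne_bot.2 hne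
    obtain ⟨v, hv0, hv⟩ := exists_ne_zero_asAlgebraHom_apply_eq_zero hP hz hbr U.toRepresentation
    have hsub : ∀ (a : MonoidAlgebra k G) (v : U.toSubmodule),
        ((U.toRepresentation.asAlgebraHom a v : U.toSubmodule) : MonoidAlgebra k G) = a * v := by
      intro a v
      induction a using MonoidAlgebra.induction_linear with
      | zero => simp
      | add a b ha hb => simp [ha, hb, add_mul]
      | single g r =>
        rw [← hlr, Representation.asAlgebraHom_single, Representation.asAlgebraHom_single]
        rfl
    refine hv0 (Subtype.ext ?_)
    have h1 : (v : MonoidAlgebra k G) ∈ LinearMap.ker (L ^ (n + 1)) := by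
      rw [LinearMap.mem_ker, hL, pow_succ, mul_assoc, ← hsub, hv, ZeroMemClass.coe_zero, mul_zero]
    exact (Submodule.disjoint_def.1 hn'.disjoint) _ h1 v.2
  refine ⟨n + 1, ?_⟩
  have := hL (n + 1) 1
  rw [LinearMap.range_eq_bot.1 hU, mul_one] at this
  exact this.symm

end NormalSubgroup

/-! ### Cyclic defect groups -/

section CyclicGroup

variable {G : Type*} [Group G] [Finite G] {p : ℕ} [Fact p.Prime] {D D₁ : Subgroup G}

/-- In a cyclic `p`-group, the subgroup of order `p` is contained in every non-trivial one. -/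
theorem le_of_isCyclic_of_ne_bot (hcyc : IsCyclic D) (hD : IsPGroup p D) (hD₁ : D₁ ≤ D)
    (hcard : Nat.card D₁ = p) {Q : Subgroup G} (hQ : Q ≤ D) (hne : Q ≠ ⊥) : D₁ ≤ Q := by
  classical
  have hp : p.Prime := Fact.out
  cases nonempty_fintype D
  have hQp : IsPGroup p Q := hD.to_le hQ
  have hnt : Nontrivial Q := (Subgroup.nontrivial_iff_ne_bot Q).2 hne
  obtain ⟨n, hn0, hn⟩ := hQp.nontrivial_iff_card.1 hnt
  obtain ⟨x, hx⟩ := exists_prime_orderOf_dvd_card' (G := Q) p (hn ▸ dvd_pow_self p hn0.ne')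
  -- the solutions of `y ^ p = 1` in `D`
  let S : Finset D := {y | y ^ p = 1}
  have hS : S.card ≤ p := IsCyclic.card_pow_eq_one_le hp.pos
  have hsub : ∀ R : Subgroup G, ∀ hR : R ≤ D, Nat.card R = p →
      (Finset.univ.filter fun y : D => (y : G) ∈ R) = S := by
    intro R hR hRp
    cases nonempty_fintype R
    refine Finset.eq_of_subset_of_card_le (fun y hy => ?_) (hS.trans ?_)
    · rw [Finset.mem_filter] at hy
      refine Finset.mem_filter.2 ⟨Finset.mem_univ _, Subtype.ext ?_⟩
      have : (⟨y, hy.2⟩ : R) ^ p = 1 := hRp ▸ pow_card_eq_one'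
      simpa using congrArg Subtype.val this
    · rw [← hRp, Nat.card_eq_fintype_card, ← Fintype.card_subtype]
      exact Fintype.card_le_of_injective
        (fun r : R => (⟨⟨r, hR r.2⟩, r.2⟩ : {y : D // (y : G) ∈ R}))
        fun a b h => Subtype.ext (by simpa using h)
  have hR : Subgroup.zpowers (x : G) ≤ Q := by simp [Subgroup.zpowers_le]
  have hRp : Nat.card (Subgroup.zpowers (x : G)) = p := by
    rw [Nat.card_zpowers, Subgroup.orderOf_coe, hx]
  intro y hy
  have h1 : (⟨y, hD₁ hy⟩ : D) ∈ S := by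
    rw [← hsub D₁ hD₁ hcard]
    simpa using hy
  rw [← hsub _ (hR.trans hQ) hRp] at h1
  exact hR (Finset.mem_filter.1 h1).2

/-- The subgroup of order `p` of a cyclic `p`-group `D` controls the fusion of the non-trivial
elements of `D`. -/
theorem mem_normalizer_of_conj_mem (hcyc : IsCyclic D) (hD : IsPGroup p D) (hD₁ : D₁ ≤ D)
    (hcard : Nat.card D₁ = p) {x g : G} (hx : x ∈ D) (hx1 : x ≠ 1) (hg : g * x * g⁻¹ ∈ D) :
    g ∈ Subgroup.normalizer (D₁ : Set G) := by
  have h1 : D₁ ≤ Subgroup.zpowers x :=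
    le_of_isCyclic_of_ne_bot hcyc hD hD₁ hcard (by simpa [Subgroup.zpowers_le] using hx)
      (by simpa using hx1)
  let c := (MulAut.conj g).toMonoidHom
  have h2 : D₁.map c ≤ D := by
    refine (Subgroup.map_mono h1).trans ?_
    rw [MonoidHom.map_zpowers, Subgroup.zpowers_le]
    exact hg
  have hc : Function.Injective c := (MulAut.conj g).injective
  have h3 : Nat.card (D₁.map c) = p := by
    rw [← hcard]
    exact (Nat.card_congr (D₁.equivMapOfInjective c hc).toEquiv).symm
  have hne : D₁.map c ≠ ⊥ := fun h => by
    rw [h, Subgroup.card_bot] at h3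
    exact (Fact.out : p.Prime).one_lt.ne h3
  have h4 : D₁ ≤ D₁.map c := le_of_isCyclic_of_ne_bot hcyc hD hD₁ hcard h2 hne
  have h5 : D₁ = D₁.map c := Subgroup.eq_of_le_of_card_ge h4 (by rw [h3, hcard])
  rw [Subgroup.mem_normalizer_iff]
  intro y
  conv_rhs => rw [h5]
  constructor
  · exact fun hy => ⟨y, hy, rfl⟩
  · rintro ⟨z, hz, hzy⟩
    have : z = y := hc hzy
    exact this ▸ hz

end CyclicGroup

/-! ### Block idempotents and the Brauer map -/

section Idempotents

theorem eq_of_isNilpotent_sub {R : Type*} [Ring R] {a b : R} (ha : IsIdempotentElem a)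
    (hb : IsIdempotentElem b) (hab : Commute a b) (h : IsNilpotent (a - b)) : a = b := by
  have key : ∀ {x y : R}, IsIdempotentElem x → IsIdempotentElem y → Commute x y →
      IsNilpotent (x - y) → x = x * y := by
    intro x y hx hy hxy hn
    have h1 : x * (1 - y) = x * (x - y) := by rw [mul_sub, mul_sub, mul_one, hx.eq]
    have h2 : IsIdempotentElem (x * (1 - y)) :=
      hx.mul_of_commute ((Commute.one_right x).sub_right hxy) hy.one_sub
    have h3 : IsNilpotent (x * (1 - y)) := by
      rw [h1]
      exact ((Commute.refl x).sub_right hxy).isNilpotent_mul_left hn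
    obtain ⟨n, hn⟩ := h3
    have h4 : x * (1 - y) = 0 := by
      rw [← h2.pow_succ_eq n, pow_succ, hn, zero_mul]
    rw [mul_sub, mul_one] at h4
    exact sub_eq_zero.1 h4
  rw [key ha hb hab h, hab.eq, ← key hb ha hab.symm (by rw [← neg_sub]; exact h.neg)]

variable {k : Type*} [Field k] {G : Type*} [Group G]

theorem isDefectGroup_iff [Finite G] (B : Block k G) (D : Subgroup G) : B.IsDefectGroup D ↔
    Minimal (fun P : Subgroup G => B.idem ∈ traceModule (conjRep k G) (G ⧸ P)) D := by
  unfold Block.IsDefectGroup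
  refine iff_of_eq (congrArg (fun f => Minimal f D) (funext fun P => propext ?_))
  rw [mem_traceModule_quotient]
  refine exists_congr fun a => and_congr (forall₂_congr fun x _ => conjRep_eq_iff.symm) ?_
  simp only [relTrace, conjRep_apply]
  exact eq_comm

/-- Defect groups are `p`-groups. -/
theorem isPGroup_of_isDefectGroup [Finite G] {p : ℕ} [Fact p.Prime] [CharP k p] {B : Block k G}
    {D : Subgroup G} (hD : B.IsDefectGroup D) : IsPGroup p D := by
  rw [isDefectGroup_iff] at hD
  let S : Sylow p D := default
  let P : Subgroup G := (S : Subgroup D).map D.subtype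
  have hPD : P ≤ D := Subgroup.map_subtype_le _
  have h1 : P.subgroupOf D = S := Subgroup.comap_map_eq_self_of_injective D.subtype_injective _
  have h2 : ((P.subgroupOf D).index : k) ≠ 0 := by
    rw [h1, Ne, CharP.cast_eq_zero_iff k p]
    exact S.not_dvd_index
  have h3 : D ≤ P := hD.2 (traceModule_quotient_le_of_index hPD h2 hD.1) hPD
  exact (S.isPGroup'.map D.subtype).to_le h3

/-- The centre of a block is a local ring. -/
theorem isNilpotent_or_exists_mul_eq_idem [Finite G] (B : Block k G) {z : MonoidAlgebra k G}
    (hz : z ∈ Subalgebra.center k (MonoidAlgebra k G)) :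
    IsNilpotent (z * B.idem) ∨
      ∃ w ∈ Subalgebra.center k (MonoidAlgebra k G), z * B.idem * w = B.idem := by
  have hfd : FiniteDimensional k (MonoidAlgebra k G) :=
    Module.Finite.equiv (MonoidAlgebra.coeffLinearEquiv k).symm
  let Z := Subalgebra.center k (MonoidAlgebra k G)
  let e : Z := ⟨B.idem, B.mem_center⟩
  have he : e * e = e := Subtype.ext B.isIdempotentElem
  let x : Z := ⟨z, hz⟩ * e
  have hxe : e * x = x := by
    simp only [x]
    rw [mul_comm, mul_assoc, he]
  have : IsArtinianRing Z := IsArtinianRing.of_finite k Z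
  obtain ⟨n, y, hy⟩ := IsArtinian.exists_pow_succ_smul_dvd x (1 : Z)
  simp only [smul_eq_mul, mul_one, Nat.succ_eq_add_one] at hy
  have h1 : ∀ m, x ^ (n + m) * y ^ m = x ^ n := by
    intro m
    induction m with
    | zero => simp
    | succ m ih =>
      calc x ^ (n + (m + 1)) * y ^ (m + 1) = (x ^ (n + 1) * y) * x ^ m * y ^ m := by ring
        _ = x ^ (n + m) * y ^ m := by rw [hy, pow_add]
        _ = x ^ n := ih
  -- the idempotent attached to the Fitting decomposition of `x`
  let f : Z := x ^ (n + 1) * y ^ (n + 1)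
  have hx' : x ^ (n + 1) * f = x ^ (n + 1) := by
    have h2 := h1 (n + 1)
    calc x ^ (n + 1) * f = x * (x ^ (n + (n + 1)) * y ^ (n + 1)) := by simp only [f]; ring
      _ = x ^ (n + 1) := by rw [h2, pow_succ']
  have hf : f * f = f := by
    calc f * f = (x ^ (n + 1) * f) * y ^ (n + 1) := by simp only [f]; ring
      _ = f := by rw [hx']
  have hef : e * f = f := by
    calc e * f = (e * x) * x ^ n * y ^ (n + 1) := by simp only [f]; ring
      _ = f := by rw [hxe]; simp only [f]; ring
  rcases B.primitive f f.2 (congrArg Subtype.val hf) (congrArg Subtype.val hef) with h2 | h2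
  · left
    refine ⟨n + 1, ?_⟩
    have h3 : f = 0 := Subtype.ext h2
    rw [h3, mul_zero] at hx'
    exact (congrArg Subtype.val hx'.symm)
  · right
    have h3 : f = e := Subtype.ext h2
    refine ⟨(x ^ n * y ^ (n + 1) : Z), Subtype.mem _, ?_⟩
    have h4 : x * (x ^ n * y ^ (n + 1)) = e := by rw [← h3]; simp only [f]; ring
    exact congrArg Subtype.val h4

end Idempotents

section Correspondent

variable {k : Type*} [Field k] {G : Type*} [Group G]

/-- The inclusion of the group algebra of a subgroup. -/
abbrev inclusion (H : Subgroup G) : MonoidAlgebra k H →ₐ[k] MonoidAlgebra k G :=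
  MonoidAlgebra.mapDomainAlgHom k k H.subtype

theorem inclusion_injective (H : Subgroup G) : Function.Injective (inclusion (k := k) H) :=
  MonoidAlgebra.mapDomain_injective H.subtype_injective

theorem coeff_truncate (H : Subgroup G) (z : MonoidAlgebra k G) (h : H) :
    (truncate H z).coeff h = z.coeff h := by
  simp [truncate]

theorem coeff_inclusion (H : Subgroup G) (z : MonoidAlgebra k H) (h : H) :
    (inclusion H z).coeff h = z.coeff h := by
  exact Finsupp.mapDomain_apply H.subtype_injective _ _

theorem coeff_inclusion_of_notMem (H : Subgroup G) (z : MonoidAlgebra k H) {x : G} (hx : x ∉ H) :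
    (inclusion H z).coeff x = 0 := by
  refine Finsupp.mapDomain_of_notMem_range _ _ ?_
  rintro ⟨y, rfl⟩
  exact hx y.2

theorem inclusion_conjRep (H : Subgroup G) (h : H) (z : MonoidAlgebra k H) :
    inclusion H (conjRep k H h z) = conjRep k G h (inclusion H z) := by
  rw [conjRep_apply, conjRep_apply, map_mul, map_mul]
  simp

theorem mem_centralizer_subgroupOf {H P : Subgroup G} (hP : P ≤ H) (h : H) :
    h ∈ Subgroup.centralizer (P.subgroupOf H : Set H) ↔
      (h : G) ∈ Subgroup.centralizer (P : Set G) := by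
  simp only [Subgroup.mem_centralizer_iff, SetLike.mem_coe]
  constructor
  · intro hh d hd
    exact congrArg Subtype.val (hh ⟨d, hP hd⟩ (Subgroup.mem_subgroupOf.2 hd))
  · intro hh d hd
    exact Subtype.ext (hh d (Subgroup.mem_subgroupOf.1 hd))

theorem inclusion_brauerMap {H P : Subgroup G} (hP : P ≤ H) (z : MonoidAlgebra k H) :
    inclusion H (brauerMap (P.subgroupOf H) z) = brauerMap P (inclusion H z) := by
  classical
  ext x
  rw [coeff_brauerMap]
  by_cases hx : x ∈ H
  · rw [show x = ((⟨x, hx⟩ : H) : G) from rfl, coeff_inclusion, coeff_inclusion, coeff_brauerMap]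
    simp only [mem_centralizer_subgroupOf hP]
  · rw [coeff_inclusion_of_notMem H _ hx, coeff_inclusion_of_notMem H _ hx, ite_self]

variable [Finite G] {p : ℕ} [CharP k p] {D D₁ H : Subgroup G}

/-- The Brauer map sends a relative trace from `D` to `G` to the one from `D` to `H`: by the control
of fusion, `D₁` permutes the cosets of `D` outside `H` freely. -/
theorem brauerMap_relTrace (hTI : ∀ x ∈ D, x ≠ 1 → ∀ g : G, g * x * g⁻¹ ∈ D → g ∈ H)
    (hD₁ : D₁ ≤ D) (hcard : Nat.card D₁ = p) (hDN : D ≤ H)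
    {a : MonoidAlgebra k G} (ha : ∀ x ∈ D, conjRep k G x a = a) :
    brauerMap D₁ (relTrace (conjRep k G) D a) =
      brauerMap D₁ (relTrace (restrict (conjRep k G) H) (D.subgroupOf H) a) := by
  obtain ⟨φ, hφ, hφ0, h⟩ := exists_relTrace_eq_add hDN ha
  rw [h, map_add]
  have h1 : ∑ᶠ q, φ q ∈ traceModule (restrict (conjRep k G) D₁) D₁ := by
    refine finsum_mem_traceModule_self φ (fun d q => hφ ⟨d, hDN (hD₁ d.2)⟩ q) fun q hq d hd => ?_
    by_contra hd1
    refine hφ0 q hq (hTI ((q.out)⁻¹ * d * q.out) ?_ ?_ q.out ?_)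
    · rw [← QuotientGroup.out_eq' q] at hd
      have := QuotientGroup.eq.1 (show ((q.out : G) : G ⧸ D) = ((d * q.out : G) : G ⧸ D)
        from hd.symm)
      rwa [← mul_assoc] at this
    · intro h
      refine hd1 (Subtype.ext ?_)
      rw [mul_assoc, inv_mul_eq_one] at h
      simpa using h.symm
    · have : q.out * ((q.out)⁻¹ * d * q.out) * (q.out)⁻¹ = (d : G) := by group
      rw [this]
      exact hD₁ d.2
  rw [brauerMap_eq_zero_of_mem (by rw [hcard, CharP.cast_eq_zero]) h1, add_zero]

/-- The idempotent of the Brauer correspondent is the image of the block idempotent under the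
Brauer map. -/
theorem inclusion_idem_eq_brauerMap [Fact p.Prime] {B : Block k G} (hD : B.IsDefectGroup D)
    (hH : H = Subgroup.normalizer (D₁ : Set G))
    (hTI : ∀ x ∈ D, x ≠ 1 → ∀ g : G, g * x * g⁻¹ ∈ D → g ∈ H)
    (hD₁ : D₁ ≤ D) (hcard : Nat.card D₁ = p) (hDN : D ≤ H) {B₁ : Block k H}
    (hB₁ : B₁.IsBrauerInduced B) :
    inclusion H B₁.idem = brauerMap D₁ B.idem := by
  classical
  have hDH : D₁ ≤ H := hD₁.trans hDN
  have hnormal : (D₁.subgroupOf H).Normal := by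
    subst hH
    exact Subgroup.normal_in_normalizer
  have hcard' : Nat.card (D₁.subgroupOf H) = p := by
    rw [← hcard]
    exact Nat.card_congr (Subgroup.subgroupOfEquivOfLe hDH).toEquiv
  have hcent : ∀ z ∈ Subalgebra.center k (MonoidAlgebra k H),
      brauerMap (D₁.subgroupOf H) z ∈ Subalgebra.center k (MonoidAlgebra k H) := fun z hz => by
    rw [mem_center_iff_conjRep] at hz ⊢
    intro h
    rw [← brauerMap_conjRep (by rw [Subgroup.normalizer_eq_top]; trivial), hz]
  have hnil : ∀ z ∈ Subalgebra.center k (MonoidAlgebra k H),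
      IsNilpotent (z - brauerMap (D₁.subgroupOf H) z) := fun z hz =>
    isNilpotent_of_brauerMap_eq_zero hcard' (sub_mem hz (hcent z hz))
      (by rw [map_sub, brauerMap_brauerMap, sub_self])
  have heG := mem_center_iff_conjRep.1 B.mem_center
  -- the Brauer image of the idempotent, in the group algebra of the normalizer
  set te := truncate H B.idem with hte
  have htec := truncate_mem_center H B.mem_center
  set b := brauerMap (D₁.subgroupOf H) te with hb
  have hbc : b ∈ Subalgebra.center k (MonoidAlgebra k H) := hcent _ htec
  have hιb : inclusion H b = brauerMap D₁ B.idem := by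
    ext x
    rw [hb, inclusion_brauerMap hDH, coeff_brauerMap, coeff_brauerMap]
    split_ifs with hx
    · have hxH : x ∈ H := hH ▸ Subgroup.centralizer_le_normalizer _ hx
      rw [show x = ((⟨x, hxH⟩ : H) : G) from rfl, coeff_inclusion, hte, coeff_truncate]
    · rfl
  have hbrid : brauerMap D₁ B.idem * brauerMap D₁ B.idem = brauerMap D₁ B.idem := by
    rw [← brauerMap_mul hcard (fun x _ => heG x) (fun x _ => heG x), B.isIdempotentElem.eq]
  have hbid : b * b = b := inclusion_injective H (by rw [map_mul, hιb, hbrid])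
  -- the central character of `B₁` does not vanish at `b`, so `B₁` is a summand of `b`
  obtain ⟨ω, ω', hω, hω', hωω'⟩ := hB₁
  have hb1 : ω' ⟨b, hbc⟩ = 1 := by
    have h1 : ω' ⟨te, htec⟩ = 1 := by
      rw [← hωω' ⟨B.idem, B.mem_center⟩]
      exact hω
    have h2 : IsNilpotent (⟨te, htec⟩ - ⟨b, hbc⟩ : Subalgebra.center k (MonoidAlgebra k H)) := by
      obtain ⟨n, hn⟩ := hnil te htec
      exact ⟨n, Subtype.ext hn⟩
    have h3 := (h2.map ω').eq_zero
    rw [map_sub, h1, sub_eq_zero] at h3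
    exact h3.symm
  have hbe : B₁.idem * b = B₁.idem := by
    have h1 : B₁.idem * (B₁.idem * b) = B₁.idem * b := by
      rw [← mul_assoc, B₁.isIdempotentElem.eq]
    have h2 : IsIdempotentElem (B₁.idem * b) :=
      B₁.isIdempotentElem.mul_of_commute (Subalgebra.mem_center_iff.1 hbc _) hbid
    rcases B₁.primitive _ (mul_mem B₁.mem_center hbc) h2 h1 with h3 | h3
    · exfalso
      have h4 : (⟨B₁.idem, B₁.mem_center⟩ * ⟨b, hbc⟩ :
          Subalgebra.center k (MonoidAlgebra k H)) = 0 := Subtype.ext h3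
      have h5 := congrArg ω' h4
      rw [map_mul, hb1, mul_one, map_zero] at h5
      exact one_ne_zero (hω'.symm.trans h5)
    · exact h3
  -- block idempotents of the normalizer are supported on the centralizer of `D₁`, because their
  -- Brauer images are idempotents which differ from them by nilpotents
  have hbr1 : brauerMap (D₁.subgroupOf H) B₁.idem = B₁.idem := by
    have hc1 := mem_center_iff_conjRep.1 B₁.mem_center
    refine (eq_of_isNilpotent_sub B₁.isIdempotentElem ?_ ?_ (hnil _ B₁.mem_center)).symm
    · rw [IsIdempotentElem, ← brauerMap_mul hcard' (fun x _ => hc1 x) (fun x _ => hc1 x),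
        B₁.isIdempotentElem.eq]
    · exact (Subalgebra.mem_center_iff.1 B₁.mem_center _).symm
  set f := inclusion H B₁.idem with hf
  have hff : f * f = f := by rw [hf, ← map_mul, B₁.isIdempotentElem.eq]
  have hbrf : brauerMap D₁ f = f := by rw [hf, ← inclusion_brauerMap hDH, hbr1]
  have hfe : f * brauerMap D₁ B.idem = f := by rw [hf, ← hιb, ← map_mul, hbe]
  have hfH : ∀ x ∈ H, conjRep k G x f = f := fun x hx => by
    have h1 := inclusion_conjRep H ⟨x, hx⟩ B₁.idem
    rw [mem_center_iff_conjRep.1 B₁.mem_center] at h1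
    exact h1.symm
  have hf0 : f ≠ 0 := fun h => B₁.ne_zero (inclusion_injective H (h.trans (map_zero _).symm))
  -- lift `f` along the Brauer map to the centre of `kG`
  obtain ⟨a, ha, hae⟩ := mem_traceModule_quotient.1 ((isDefectGroup_iff B D).1 hD).1
  have hfa : ∀ x ∈ D, conjRep k G x (f * a) = f * a := fun x hx => by
    rw [conjRep_mul, hfH x (hDN hx), ha x hx]
  set z := relTrace (conjRep k G) D (f * a) with hz
  have hzc : z ∈ Subalgebra.center k (MonoidAlgebra k G) :=
    traceModule_conjRep_le_center (relTrace_mem hfa)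
  have hzG := mem_center_iff_conjRep.1 hzc
  have haH : ∀ x ∈ D₁, conjRep k G x
      (relTrace (restrict (conjRep k G) H) (D.subgroupOf H) a) =
        relTrace (restrict (conjRep k G) H) (D.subgroupOf H) a := fun x hx =>
    rho_apply_of_mem_traceModule (relTrace_mem (τ := restrict (conjRep k G) H)
      (H := D.subgroupOf H) fun y hy => ha y hy) ⟨x, hDH hx⟩
  have hbrz : brauerMap D₁ z = f := by
    have h1 := map_relTrace (τ := restrict (conjRep k G) H) (τ' := restrict (conjRep k G) H)
      (LinearMap.mulLeft k f) (fun g x => by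
        change f * conjRep k G g x = conjRep k G g (f * x)
        rw [conjRep_mul, hfH g g.2]) (D.subgroupOf H) a
    simp only [LinearMap.mulLeft_apply] at h1
    rw [hz, brauerMap_relTrace hTI hD₁ hcard hDN hfa, ← h1,
      brauerMap_mul hcard (fun x hx => hfH x (hDH hx)) haH,
      ← brauerMap_relTrace hTI hD₁ hcard hDN ha, hae, hbrf, hfe]
  have hze : ∀ x ∈ D₁, conjRep k G x (z * B.idem) = z * B.idem := fun x _ => by
    rw [conjRep_mul, hzG, heG]
  have hbrze : brauerMap D₁ (z * B.idem) = f := by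
    rw [brauerMap_mul hcard (fun x _ => hzG x) (fun x _ => heG x), hbrz, hfe]
  -- the lift is not nilpotent on the block, hence invertible there, and so is its image `f` in the
  -- Brauer image of the block
  rcases isNilpotent_or_exists_mul_eq_idem B hzc with ⟨n, hn⟩ | ⟨w, hw, hzw⟩
  · exfalso
    have h1 := brauerMap_pow hcard hze n
    rw [pow_succ, hn, zero_mul, map_zero, hbrze, IsIdempotentElem.pow_succ_eq n hff] at h1
    exact hf0 h1.symm
  · have h1 := congrArg (brauerMap D₁) hzw
    rw [brauerMap_mul hcard hze (fun x _ => mem_center_iff_conjRep.1 hw x), hbrze] at h1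
    have h2 := congrArg (fun y => f * y) h1
    simp only [← mul_assoc, hff, hfe] at h2
    exact h2.symm.trans h1

end Correspondent

/-! ### Transfer of homomorphisms between a group and the local subgroup -/

section LocalPair

variable {k : Type*} [Field k] {G : Type*} [Group G] [Finite G]

/-- The relation between a central idempotent `e` of `kG` with defect group `D` and a central
idempotent `e₁` of `kH`, with `D ≤ H`, on which the Green correspondence rests: `H` controls the
fusion of the non-trivial elements of `D`, both idempotents are relative traces from `D`, the
truncation of `e` to `H` agrees with `e₁` up to a nilpotent, and modulo traces from the trivial
subgroup `e` is a relative trace from `H` of a multiple of `e₁`. -/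
structure LocalPair (D H : Subgroup G) (e : MonoidAlgebra k G) (e₁ : MonoidAlgebra k H) :
    Prop where
  le : D ≤ H
  fusion : ∀ x ∈ D, x ≠ 1 → ∀ g : G, g * x * g⁻¹ ∈ D → g ∈ H
  mem_center : e ∈ Subalgebra.center k (MonoidAlgebra k G)
  idem : e * e = e
  mem_center₁ : e₁ ∈ Subalgebra.center k (MonoidAlgebra k H)
  idem₁ : e₁ * e₁ = e₁
  isNilpotent : IsNilpotent ((truncate H e - e₁) * e₁)
  mem_trace : e ∈ traceModule (conjRep k G) (G ⧸ D)
  mem_trace₁ :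
    inclusion H e₁ ∈ traceModule (restrict (conjRep k G) H) (H ⧸ D.subgroupOf H)
  exists_relTrace : ∃ t, (∀ x ∈ H, conjRep k G x t = t) ∧
    e - relTrace (conjRep k G) H (t * inclusion H e₁ * e) ∈ traceModule (conjRep k G) G

/-- A block with a cyclic defect group and its Brauer correspondent form a local pair. -/
theorem localPair_of_isCyclic {p : ℕ} [Fact p.Prime] [CharP k p] {B : Block k G}
    {D D₁ : Subgroup G} (hD : B.IsDefectGroup D) (hcyc : IsCyclic D) (hD₁ : D₁ ≤ D)
    (hcard : Nat.card D₁ = p) {B₁ : Block k (Subgroup.normalizer (D₁ : Set G))}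
    (hB₁ : B₁.IsBrauerInduced B) :
    LocalPair D (Subgroup.normalizer (D₁ : Set G)) B.idem B₁.idem := by
  have hDp : IsPGroup p D := isPGroup_of_isDefectGroup hD
  have hTI : ∀ x ∈ D, x ≠ 1 → ∀ g : G, g * x * g⁻¹ ∈ D →
      g ∈ Subgroup.normalizer (D₁ : Set G) := fun x hx hx1 g hg =>
    mem_normalizer_of_conj_mem hcyc hDp hD₁ hcard hx hx1 hg
  obtain ⟨H, hH⟩ : ∃ H, H = Subgroup.normalizer (D₁ : Set G) := ⟨_, rfl⟩
  rw [← hH] at hTI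
  revert B₁
  rw [← hH]
  intro B₁ hB₁
  have hDH : D ≤ H := fun x hx => by
    by_cases hx1 : x = 1
    · exact hx1 ▸ H.one_mem
    · exact hTI x hx hx1 x (by simpa using hx)
  have hDH₁ := hD₁.trans hDH
  have hcard' : Nat.card (D₁.subgroupOf H) = p := by
    rw [← hcard]
    exact Nat.card_congr (Subgroup.subgroupOfEquivOfLe hDH₁).toEquiv
  have hnormal : (D₁.subgroupOf H).Normal := by
    subst hH
    exact Subgroup.normal_in_normalizer
  have hε := inclusion_idem_eq_brauerMap hD hH hTI hD₁ hcard hDH hB₁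
  have hmem := ((isDefectGroup_iff B D).1 hD).1
  have heG := mem_center_iff_conjRep.1 B.mem_center
  obtain ⟨a, ha, hae⟩ := mem_traceModule_quotient.1 hmem
  have hbrH : ∀ (h : H) x, brauerMap D₁ (restrict (conjRep k G) H h x) =
      restrict (conjRep k G) H h (brauerMap D₁ x) := fun h x =>
    brauerMap_conjRep (hH ▸ h.2) x
  have hεH : ∀ x ∈ H, conjRep k G x (inclusion H B₁.idem) = inclusion H B₁.idem := fun x hx => by
    have h1 := inclusion_conjRep H ⟨x, hx⟩ B₁.idem
    rw [mem_center_iff_conjRep.1 B₁.mem_center] at h1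
    exact h1.symm
  have hεε : inclusion H B₁.idem * inclusion H B₁.idem = inclusion H B₁.idem := by
    rw [← map_mul, B₁.isIdempotentElem.eq]
  have hbrε : brauerMap D₁ (inclusion H B₁.idem) = inclusion H B₁.idem := by
    rw [hε, brauerMap_brauerMap]
  have htrunc : brauerMap (D₁.subgroupOf H) (truncate H B.idem) = B₁.idem := by
    refine inclusion_injective H ?_
    classical
    rw [hε, inclusion_brauerMap hDH₁]
    ext x
    rw [coeff_brauerMap, coeff_brauerMap]
    split_ifs with hx
    · have hxH : x ∈ H := hH ▸ Subgroup.centralizer_le_normalizer _ hx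
      rw [show x = ((⟨x, hxH⟩ : H) : G) from rfl, coeff_inclusion, coeff_truncate]
    · rfl
  have hnil : IsNilpotent (truncate H B.idem - B₁.idem) :=
    isNilpotent_of_brauerMap_eq_zero hcard'
      (sub_mem (truncate_mem_center H B.mem_center) B₁.mem_center)
      (by rw [map_sub, htrunc, ← htrunc, brauerMap_brauerMap, sub_self])
  refine ⟨hDH, hTI, B.mem_center, B.isIdempotentElem, B₁.mem_center, B₁.isIdempotentElem, ?_,
    hmem, ?_, ?_⟩
  · exact Commute.isNilpotent_mul_right (Subalgebra.mem_center_iff.1 B₁.mem_center _) hnil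
  · rw [hε, ← hae, brauerMap_relTrace hTI hD₁ hcard hDH ha,
      map_relTrace (brauerMap D₁) hbrH]
    exact relTrace_mem fun x hx => by
      rw [← hbrH]
      exact congrArg _ (ha x hx)
  · set ε := inclusion H B₁.idem with hεdef
    set e := B.idem with hedef
    have haε : ∀ x ∈ D, conjRep k G x (a * ε * e) = a * ε * e := fun x hx => by
      rw [conjRep_mul, conjRep_mul, ha x hx, hεH x (hDH hx), heG]
    set y := a * e - a * ε * e with hy
    have hyD : ∀ x ∈ D, conjRep k G x y = y := fun x hx => by
      rw [hy, map_sub, haε x hx, conjRep_mul, ha x hx, heG]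
    have hae' : ∀ x ∈ D₁, conjRep k G x a = a := fun x hx => ha x (hD₁ hx)
    have hbry : brauerMap D₁ y = 0 := by
      have h1 : ∀ x ∈ D₁, conjRep k G x ε = ε := fun x hx => hεH x (hDH₁ hx)
      have haε' : ∀ x ∈ D₁, conjRep k G x (a * ε) = a * ε := fun x hx => by
        rw [conjRep_mul, hae' x hx, h1 x hx]
      rw [hy, map_sub, brauerMap_mul hcard hae' (fun x _ => heG x),
        brauerMap_mul hcard haε' (fun x _ => heG x), brauerMap_mul hcard hae' h1, hbrε, ← hε,
        mul_assoc, hεε, sub_self]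
    have hyt : y ∈ traceModule (restrict (conjRep k G) D) D := by
      classical
      -- an element centralized by some `d ≠ 1` in `D` is centralized by `D₁`, and `y` has no such
      -- element in its support
      refine mem_traceModule_conjRep_of_free hyD fun x hx d hd hdx => ?_
      by_contra hd1
      have h1 : D₁ ≤ Subgroup.zpowers d := le_of_isCyclic_of_ne_bot hcyc hDp hD₁ hcard
        (by simpa [Subgroup.zpowers_le] using hd) (by simpa using hd1)
      have h2 : x ∈ Subgroup.centralizer (D₁ : Set G) := by
        rw [Subgroup.mem_centralizer_iff]
        intro z hz
        obtain ⟨n, rfl⟩ := Subgroup.mem_zpowers_iff.1 (h1 hz)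
        have hc : Commute d x := mul_inv_eq_iff_eq_mul.1 hdx
        exact hc.zpow_left n
      have h3 := congrArg (fun z => z.coeff x) hbry
      simp only [coeff_brauerMap, if_pos h2] at h3
      exact hx h3
    have ha' : ∀ x ∈ D.subgroupOf H, (restrict (conjRep k G) H) x a = a := fun x hx => ha x hx
    set t := relTrace (restrict (conjRep k G) H) (D.subgroupOf H) a with ht
    have htH : ∀ x ∈ H, conjRep k G x t = t := fun x hx =>
      rho_apply_of_mem_traceModule (relTrace_mem ha') ⟨x, hx⟩
    refine ⟨t, htH, ?_⟩
    have h1 : relTrace (restrict (conjRep k G) H) (D.subgroupOf H) (a * ε * e) = t * ε * e := by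
      have := map_relTrace (τ := restrict (conjRep k G) H) (τ' := restrict (conjRep k G) H)
        (LinearMap.mulRight k e ∘ₗ LinearMap.mulRight k ε) (fun g x => by
          change conjRep k G g x * ε * e = conjRep k G g (x * ε * e)
          rw [conjRep_mul, conjRep_mul, hεH g g.2, heG]) (D.subgroupOf H) a
      exact this.symm
    have h2 : relTrace (conjRep k G) H (t * ε * e) = relTrace (conjRep k G) D (a * ε * e) := by
      rw [← h1, relTrace_relTrace hDH haε]
    have h3 : relTrace (conjRep k G) D (a * e) = e := by
      have := map_relTrace (τ := conjRep k G) (τ' := conjRep k G)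
        (LinearMap.mulRight k e) (fun g x => by
          change conjRep k G g x * e = conjRep k G g (x * e)
          rw [conjRep_mul, heG]) D a
      rw [hae] at this
      exact this.symm.trans B.isIdempotentElem
    have h4 : e - relTrace (conjRep k G) H (t * ε * e) = relTrace (conjRep k G) D y := by
      rw [h2, sub_eq_iff_eq_add, ← relTrace_add, hy, sub_add_cancel, h3]
    rw [h4]
    exact relTrace_mem_of_mem_self hyt

end LocalPair

section Modules

variable {k : Type*} [Field k] {G : Type*} [Group G]
  {V : Type*} [AddCommGroup V] [Module k V] {W : Type*} [AddCommGroup W] [Module k W]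
  {ρ : Representation k G V} {σ : Representation k G W}

theorem restrict_linHom (ρ : Representation k G V) (σ : Representation k G W) (H : Subgroup G) :
    restrict (ρ.linHom σ) H = (restrict ρ H).linHom (restrict σ H) := rfl

theorem asAlgebraHom_restrict (ρ : Representation k G V) (H : Subgroup G)
    (a : MonoidAlgebra k H) : (restrict ρ H).asAlgebraHom a = ρ.asAlgebraHom (inclusion H a) := by
  induction a using MonoidAlgebra.induction_linear with
  | zero => simp
  | add x y hx hy => rw [map_add, hx, hy, map_add, map_add]
  | single g r => simp

theorem comp_asAlgebraHom {f : V →ₗ[k] W} (hf : ρ.IsIntertwiningMap σ f) (a : MonoidAlgebra k G) :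
    f ∘ₗ ρ.asAlgebraHom a = σ.asAlgebraHom a ∘ₗ f := by
  induction a using MonoidAlgebra.induction_linear with
  | zero => simp
  | add x y hx hy => rw [map_add, map_add, LinearMap.comp_add, LinearMap.add_comp, hx, hy]
  | single g r =>
    ext v
    simp [hf.isIntertwining]

theorem asAlgebraHom_conjRep (ρ : Representation k G V) (g : G) (a : MonoidAlgebra k G) :
    ρ.asAlgebraHom (conjRep k G g a) = (ρ.linHom ρ) g (ρ.asAlgebraHom a) := by
  rw [conjRep_apply, map_mul, map_mul, Representation.asAlgebraHom_of,
    Representation.asAlgebraHom_of]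
  rfl

theorem isIntertwiningMap_asAlgebraHom {H : Subgroup G} {a : MonoidAlgebra k G}
    (ha : ∀ x ∈ H, conjRep k G x a = a) :
    (restrict ρ H).IsIntertwiningMap (restrict ρ H) (ρ.asAlgebraHom a) := by
  refine linHom_apply_eq_iff.1 fun g => ?_
  conv_rhs => rw [← ha g g.2, asAlgebraHom_conjRep]
  rfl

theorem asAlgebraHom_mem_traceModule {S : Type*} [MulAction G S] [Finite S]
    {a : MonoidAlgebra k G} (ha : a ∈ traceModule (conjRep k G) S) :
    ρ.asAlgebraHom a ∈ traceModule (ρ.linHom ρ) S :=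
  map_mem_traceModule ρ.asAlgebraHom.toLinearMap (fun g x => asAlgebraHom_conjRep ρ g x) ha

namespace LocalPair

variable [Finite G] {D H : Subgroup G} {e : MonoidAlgebra k G} {e₁ : MonoidAlgebra k H}

theorem conjRep_inclusion (h : LocalPair D H e e₁) {x : G} (hx : x ∈ H) :
    conjRep k G x (inclusion H e₁) = inclusion H e₁ := by
  have h1 := inclusion_conjRep H ⟨x, hx⟩ e₁
  rw [mem_center_iff_conjRep.1 h.mem_center₁] at h1
  exact h1.symm

/-- Mackey's formula for `e₁` composed with a relative trace: since `H` controls fusion in `D`, the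
double cosets outside `H` contribute traces from the trivial subgroup only. -/
theorem comp_relTrace_sub_mem (h : LocalPair D H e e₁) {Q : Subgroup G} (hQ : Q ≤ D) {γ : V →ₗ[k] W}
    (hγ : ∀ x ∈ Q, (ρ.linHom σ) x γ = γ) :
    σ.asAlgebraHom (inclusion H e₁) ∘ₗ relTrace (ρ.linHom σ) Q γ -
      σ.asAlgebraHom (inclusion H e₁) ∘ₗ
        relTrace (restrict (ρ.linHom σ) H) (Q.subgroupOf H) γ ∈
      traceModule ((restrict ρ H).linHom (restrict σ H)) H := by
  -- `H` acts freely on the pairs of a coset of `D` in `H` and a coset of `Q` outside `H`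
  obtain ⟨φ, hφ, hφ0, hsum⟩ := exists_relTrace_eq_add (hQ.trans h.le) hγ
  obtain ⟨ψ, hψ, hψsum⟩ := h.mem_trace₁
  rw [hsum, LinearMap.comp_add, add_sub_cancel_left, ← hψsum]
  classical
  cases nonempty_fintype (H ⧸ D.subgroupOf H)
  cases nonempty_fintype (G ⧸ Q)
  have h1 := finsum_mem_traceModule_self (G := H)
    (τ := (restrict ρ H).linHom (restrict σ H)) (S := (H ⧸ D.subgroupOf H) × (G ⧸ Q))
    (fun s => σ.asAlgebraHom (ψ s.1) ∘ₗ φ s.2) (fun g s => ?_) (fun s hs g hg => ?_)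
  · convert h1
    rw [finsum_eq_sum_of_fintype, finsum_eq_sum_of_fintype, finsum_eq_sum_of_fintype,
      Fintype.sum_prod_type, map_sum]
    refine LinearMap.ext fun v => ?_
    simp only [LinearMap.comp_apply, LinearMap.sum_apply, map_sum]
    exact Finset.sum_comm
  · simp only [Prod.smul_fst, Prod.smul_snd, hφ, hψ]
    have h2 : σ.asAlgebraHom (restrict (conjRep k G) H g (ψ s.1)) =
        (σ.linHom σ) g (σ.asAlgebraHom (ψ s.1)) := asAlgebraHom_conjRep σ g _
    rw [h2]
    refine LinearMap.ext fun v => ?_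
    simp
  · have hg1 : g • s.1 = s.1 := congrArg Prod.fst hg
    have hg2 : g • s.2 = s.2 := congrArg Prod.snd hg
    have hne : φ s.2 ≠ 0 := fun h0 => hs (by rw [h0, LinearMap.comp_zero])
    have hout := hφ0 _ hne
    by_contra hg0
    have hg1' : ((g * s.1.out : H) : H ⧸ D.subgroupOf H) = (s.1.out : H) := by
      conv_rhs => rw [QuotientGroup.out_eq', ← hg1, ← QuotientGroup.out_eq' s.1]
      rfl
    rw [← QuotientGroup.out_eq' s.2] at hg2
    have h3 : ((s.1.out : H) : G)⁻¹ * ((g : G) * (s.1.out : H)) ∈ D :=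
      (QuotientGroup.eq (s := D.subgroupOf H)).1 hg1'.symm
    have h4 : (s.2.out)⁻¹ * ((g : G) * s.2.out) ∈ D :=
      hQ (QuotientGroup.eq.1 (show ((s.2.out : G) : G ⧸ Q) = ((g * s.2.out : G) : G ⧸ Q)
        from hg2.symm))
    refine hout ?_
    have h5 := h.fusion _ h3 (fun h0 => hg0 (Subtype.ext ?_)) ((s.2.out)⁻¹ * (s.1.out : H))
      (by convert h4 using 1; group)
    · have h6 := H.mul_mem (s.1.out).2 (H.inv_mem h5)
      simpa using h6
    · rw [inv_mul_eq_one] at h0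
      simpa using h0.symm

/-- An `H`-homomorphism into the `e₁`-part lifts to a `G`-homomorphism, up to a projective map. -/
theorem exists_lift (h : LocalPair D H e e₁) {β : V →ₗ[k] W}
    (hβ : (restrict ρ H).IsIntertwiningMap (restrict σ H) β)
    (hε : σ.asAlgebraHom (inclusion H e₁) ∘ₗ β = β) :
    ∃ Φ : V →ₗ[k] W, ρ.IsIntertwiningMap σ Φ ∧
      σ.asAlgebraHom (inclusion H e₁) ∘ₗ Φ - β ∈
        traceModule ((restrict ρ H).linHom (restrict σ H)) H := by
  obtain ⟨c, hc, hcε⟩ := mem_traceModule_quotient.1 h.mem_trace₁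
  let T : MonoidAlgebra k G →ₗ[k] V →ₗ[k] W :=
    (LinearMap.lcomp k W β) ∘ₗ σ.asAlgebraHom.toLinearMap
  have hT : ∀ (g : H) x, T (restrict (conjRep k G) H g x) =
      (restrict (ρ.linHom σ) H) g (T x) := fun g x => by
    have h2 : σ.asAlgebraHom (restrict (conjRep k G) H g x) =
        (σ.linHom σ) g (σ.asAlgebraHom x) := asAlgebraHom_conjRep σ g _
    refine LinearMap.ext fun v => ?_
    have h3 := hβ.isIntertwining g⁻¹ v
    change σ.asAlgebraHom (restrict (conjRep k G) H g x) (β v) =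
      σ g (σ.asAlgebraHom x (β (ρ (g : G)⁻¹ v)))
    rw [h2]
    exact congrArg (fun y => σ g (σ.asAlgebraHom x y)) h3.symm
  have hγ : ∀ x ∈ D, (ρ.linHom σ) x (T c) = T c := fun x hx => by
    have h1 := hT ⟨x, h.le hx⟩ c
    rw [hc ⟨x, h.le hx⟩ (Subgroup.mem_subgroupOf.2 hx)] at h1
    exact h1.symm
  refine ⟨relTrace (ρ.linHom σ) D (T c), isIntertwiningMap_of_mem_traceModule (relTrace_mem hγ), ?_⟩
  have h1 := h.comp_relTrace_sub_mem le_rfl hγ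
  have h2 : relTrace (restrict (ρ.linHom σ) H) (D.subgroupOf H) (T c) = β := by
    rw [← map_relTrace T hT, hcε]
    exact hε
  rwa [h2, hε] at h1

/-- A module on which `e` acts as the identity, and `e₁` as a trace from a subgroup `P` of `H`, is
projective relative to `P`. -/
theorem mem_of_mem_restrict (h : LocalPair D H e e₁) (hρ : ρ.asAlgebraHom e = 1)
    {P : Subgroup G} (hP : P ≤ H)
    (hmem : ρ.asAlgebraHom (inclusion H e₁) ∈
      traceModule ((restrict ρ H).linHom (restrict ρ H)) (H ⧸ P.subgroupOf H)) :
    LinearMap.id ∈ traceModule (ρ.linHom ρ) (G ⧸ P) := by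
  obtain ⟨t, ht, hte⟩ := h.exists_relTrace
  have h1 := asAlgebraHom_mem_traceModule (ρ := ρ) hte
  have h2 : ρ.asAlgebraHom (relTrace (conjRep k G) H (t * inclusion H e₁ * e)) =
      relTrace (ρ.linHom ρ) H (ρ.asAlgebraHom (t * inclusion H e₁ * e)) :=
    map_relTrace ρ.asAlgebraHom.toLinearMap (fun g x => asAlgebraHom_conjRep ρ g x) _ _
  rw [map_sub, hρ, h2, map_mul, hρ, mul_one, map_mul] at h1
  have h3 := comp_mem_traceModule (isIntertwiningMap_asAlgebraHom (ρ := ρ) ht) hmem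
  rw [← restrict_linHom] at h3
  have h4 := relTrace_mem_of_mem hP h3
  have h5 := add_mem (traceModule_self_le (S := G ⧸ P) h1) h4
  rwa [Module.End.mul_eq_comp, sub_add_cancel] at h5

end LocalPair

end Modules

/-! ### Indecomposable summands -/

section Decomposition

variable {k : Type*} [Field k] {G : Type*} [Group G]
  {V : Type*} [AddCommGroup V] [Module k V] {W : Type*} [AddCommGroup W] [Module k W]
  {ρ : Representation k G V} {σ : Representation k G W}

theorem isDirectSummand_of_isUnit_comp {i : V →ₗ[k] W} {q : W →ₗ[k] V}
    (hi : ρ.IsIntertwiningMap σ i) (hq : σ.IsIntertwiningMap ρ q)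
    (hu : IsUnit (q ∘ₗ i : Module.End k V)) : IsDirectSummand ρ σ := by
  obtain ⟨u, hu⟩ := hu
  have h1 : (↑u⁻¹ : Module.End k V) ∘ₗ (q ∘ₗ i) = LinearMap.id := by
    rw [← hu]
    exact u.inv_mul
  have h2 : (q ∘ₗ i) ∘ₗ (↑u⁻¹ : Module.End k V) = LinearMap.id := by
    rw [← hu]
    exact u.mul_inv
  exact isDirectSummand_iff.2 ⟨i, (↑u⁻¹ : Module.End k V) ∘ₗ q, hi,
    isIntertwiningMap_comp (isIntertwiningMap_of_comp_eq_id (isIntertwiningMap_comp hq hi) h1 h2)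
      hq, h1⟩

theorem exists_maps_of_isCompl {A B : Subrepresentation ρ} (hAB : IsCompl A B) :
    ∃ (i : A.toSubmodule →ₗ[k] V) (q : V →ₗ[k] A.toSubmodule) (i' : B.toSubmodule →ₗ[k] V)
      (q' : V →ₗ[k] B.toSubmodule), A.toRepresentation.IsIntertwiningMap ρ i ∧
      ρ.IsIntertwiningMap A.toRepresentation q ∧ B.toRepresentation.IsIntertwiningMap ρ i' ∧
      ρ.IsIntertwiningMap B.toRepresentation q' ∧ q ∘ₗ i = LinearMap.id ∧
      q' ∘ₗ i' = LinearMap.id ∧ i ∘ₗ q + i' ∘ₗ q' = LinearMap.id := by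
  have hc := isCompl_toSubmodule_iff.2 hAB
  let q := Submodule.projectionOnto A.toSubmodule B.toSubmodule hc
  let q' := Submodule.projectionOnto B.toSubmodule A.toSubmodule hc.symm
  have hq : ∀ a : A.toSubmodule, ∀ b : B.toSubmodule, q (a + b) = a := fun a b => by
    rw [map_add, Submodule.projectionOnto_apply_left, Submodule.projectionOnto_apply_right,
      add_zero]
  have hq' : ∀ a : A.toSubmodule, ∀ b : B.toSubmodule, q' (a + b) = b := fun a b => by
    rw [map_add, Submodule.projectionOnto_apply_left, Submodule.projectionOnto_apply_right,
      zero_add]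
  have hex : ∀ v : V, ∃ (a : A.toSubmodule) (b : B.toSubmodule), (a + b : V) = v := fun v => by
    have h1 : v ∈ A.toSubmodule ⊔ B.toSubmodule := hc.sup_eq_top ▸ Submodule.mem_top
    obtain ⟨a, ha, b, hb, hv⟩ := Submodule.mem_sup.1 h1
    exact ⟨⟨a, ha⟩, ⟨b, hb⟩, hv⟩
  have hact : ∀ (g : G) (a : A.toSubmodule) (b : B.toSubmodule), ρ g (a + b : V) =
      ((A.toRepresentation g a : A.toSubmodule) + (B.toRepresentation g b : B.toSubmodule) : V) :=
    fun g a b => map_add _ _ _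
  refine ⟨A.toSubmodule.subtype, q, B.toSubmodule.subtype, q', ⟨fun g v => rfl⟩,
    ⟨fun g v => ?_⟩, ⟨fun g v => rfl⟩, ⟨fun g v => ?_⟩, LinearMap.ext fun a => ?_,
    LinearMap.ext fun b => ?_, LinearMap.ext fun v => ?_⟩
  · obtain ⟨a, b, rfl⟩ := hex v
    rw [hact, hq, hq]
  · obtain ⟨a, b, rfl⟩ := hex v
    rw [hact, hq', hq']
  · simpa using hq a 0
  · simpa using hq' 0 b
  · obtain ⟨a, b, rfl⟩ := hex v
    simp only [LinearMap.add_apply, LinearMap.comp_apply, hq, hq', Submodule.subtype_apply,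
      LinearMap.id_apply]

/-- If a property of modules passes to one of any two complementary summands and fails for the zero
module, then every module with the property has an indecomposable summand with it. -/
theorem exists_isIndecomposable_summand {k : Type u} [Field k] {G : Type v} [Group G]
    (C : Rep.{w} k G → Prop) (h0 : ∀ U, C U → Nontrivial U)
    (hsplit : ∀ U : Rep.{w} k G, ∀ A B : Subrepresentation U.ρ, IsCompl A B → C U →
      C (Rep.of A.toRepresentation) ∨ C (Rep.of B.toRepresentation))
    (U : Rep.{w} k G) (hU : FiniteDimensional k U) (h : C U) :
    ∃ M : Rep.{w} k G, FiniteDimensional k M ∧ IsIndecomposable M.ρ ∧ C M ∧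
      IsDirectSummand M.ρ U.ρ := by
  obtain ⟨n, hn⟩ : ∃ n, Module.finrank k U = n := ⟨_, rfl⟩
  induction n using Nat.strong_induction_on generalizing U with
  | _ n ih =>
    by_cases hind : IsIndecomposable U.ρ
    · exact ⟨U, hU, hind, h, isDirectSummand_iff.2 ⟨_, _, isIntertwiningMap_id,
        isIntertwiningMap_id, LinearMap.id_comp _⟩⟩
    · have : ∃ A B : Subrepresentation U.ρ, IsCompl A B ∧ A ≠ ⊥ ∧ B ≠ ⊥ := by
        by_contra hcon
        push Not at hcon
        exact hind ⟨h0 U h, fun A B hAB => by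
          by_cases hA : A = ⊥
          · exact Or.inl hA
          · exact Or.inr (hcon A B hAB hA)⟩
      obtain ⟨A, B, hAB, hA, hB⟩ := this
      have key : ∀ A B : Subrepresentation U.ρ, IsCompl A B → B ≠ ⊥ →
          C (Rep.of A.toRepresentation) → ∃ M : Rep.{w} k G, FiniteDimensional k M ∧
            IsIndecomposable M.ρ ∧ C M ∧ IsDirectSummand M.ρ U.ρ := by
        intro A B hAB hB hPA
        have hlt : Module.finrank k A.toSubmodule < n := by
          rw [← hn]
          refine Submodule.finrank_lt (fun htop => hB ?_)
          have h1 := (isCompl_toSubmodule_iff.2 hAB).inf_eq_bot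
          rw [htop, top_inf_eq] at h1
          exact Subrepresentation.toSubmodule_injective h1
        obtain ⟨M, hMf, hMi, hMP, hM⟩ := ih _ hlt (Rep.of A.toRepresentation)
          (inferInstanceAs (FiniteDimensional k A.toSubmodule)) hPA rfl
        obtain ⟨i, q, _, _, hi, hq, _, _, hqi, _, _⟩ := exists_maps_of_isCompl hAB
        exact ⟨M, hMf, hMi, hMP, hM.trans (isDirectSummand_iff.2 ⟨i, q, hi, hq, hqi⟩)⟩
      rcases hsplit U A B hAB h with h1 | h1
      · exact key A B hAB hB h1
      · exact key B A hAB.symm hA h1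

theorem exists_nonprojective_summand {k : Type u} [Field k] {G : Type v} [Group G] [Finite G]
    (U : Rep.{w} k G) (hU : FiniteDimensional k U) (h : ¬ IsProjective U.ρ) :
    ∃ M : Rep.{w} k G, FiniteDimensional k M ∧ IsIndecomposable M.ρ ∧ ¬ IsProjective M.ρ ∧
      IsDirectSummand M.ρ U.ρ := by
  refine exists_isIndecomposable_summand (fun U => ¬ IsProjective U.ρ) (fun U hU => ?_)
    (fun U A B hAB hU => ?_) U hU h
  · by_contra hn
    rw [not_nontrivial_iff_subsingleton] at hn
    refine hU (isProjective_of_mem ?_)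
    rw [Subsingleton.elim (LinearMap.id : U →ₗ[k] U) 0]
    exact zero_mem _
  · by_contra hcon
    rw [not_or, not_not, not_not] at hcon
    obtain ⟨i, q, i', q', hi, hq, hi', hq', _, _, hsum⟩ := exists_maps_of_isCompl hAB
    refine hU (isProjective_of_mem ?_)
    rw [← hsum]
    exact add_mem
      (comp_mem_traceModule hi (mem_traceModule_comp (mem_of_isProjective hcon.1) hq))
      (comp_mem_traceModule hi' (mem_traceModule_comp (mem_of_isProjective hcon.2) hq'))

theorem exists_summand_of_isDirectSummand_restrict {k : Type u} [Field k] {G : Type v} [Group G]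
    {H : Subgroup G} {X : Type*} [AddCommGroup X] [Module k X] [FiniteDimensional k X]
    {ν : Representation k H X} (hν : IsIndecomposable ν)
    (U : Rep.{w} k G) (hU : FiniteDimensional k U) (h : IsDirectSummand ν (restrict U.ρ H)) :
    ∃ M : Rep.{w} k G, FiniteDimensional k M ∧ IsIndecomposable M.ρ ∧
      IsDirectSummand ν (restrict M.ρ H) ∧ IsDirectSummand M.ρ U.ρ := by
  refine exists_isIndecomposable_summand (fun U => IsDirectSummand ν (restrict U.ρ H))
    (fun U hU => ?_) (fun U A B hAB hU => ?_) U hU h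
  · obtain ⟨i, q, _, _, hqi⟩ := isDirectSummand_iff.1 hU
    have := hν.1
    have hinj : Function.Injective i := fun x y hxy => by
      have h1 := LinearMap.congr_fun hqi x
      rw [LinearMap.comp_apply, hxy] at h1
      exact h1.symm.trans (LinearMap.congr_fun hqi y)
    exact hinj.nontrivial
  · obtain ⟨i, q, hi, hq, hqi⟩ := isDirectSummand_iff.1 hU
    obtain ⟨j, r, j', r', hj, hr, hj', hr', _, _, hsum⟩ := exists_maps_of_isCompl hAB
    have hs : (q ∘ₗ j) ∘ₗ (r ∘ₗ i) + (q ∘ₗ j') ∘ₗ (r' ∘ₗ i) = LinearMap.id := by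
      refine LinearMap.ext fun x => ?_
      have h1 := LinearMap.congr_fun hsum (i x)
      have h2 : q (j (r (i x)) + j' (r' (i x))) = q (i x) := congrArg q h1
      rw [map_add] at h2
      exact h2.trans (LinearMap.congr_fun hqi x)
    have h1 := isIntertwiningMap_comp (isIntertwiningMap_restrict hr H) hi
    have h2 := isIntertwiningMap_comp hq (isIntertwiningMap_restrict hj H)
    have h1' := isIntertwiningMap_comp (isIntertwiningMap_restrict hr' H) hi
    have h2' := isIntertwiningMap_comp hq (isIntertwiningMap_restrict hj' H)
    exact (isUnit_of_add_eq_one hν (isIntertwiningMap_comp h2 h1) hs).imp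
      (isDirectSummand_of_isUnit_comp h1 h2) (isDirectSummand_of_isUnit_comp h1' h2')

end Decomposition

/-! ### The Green correspondence for a local pair -/

section Green

variable {k : Type*} [Field k] {G : Type*} [Group G]

/-- The projective endomorphisms of a non-projective indecomposable module lie in the radical of its
endomorphism ring. -/
theorem isUnit_of_id_sub_mem [Finite G] {X : Type*} [AddCommGroup X] [Module k X]
    [FiniteDimensional k X]
    {ν : Representation k G X} (hν : IsIndecomposable ν) (hproj : ¬ IsProjective ν)
    {f : X →ₗ[k] X} (hf : ν.IsIntertwiningMap ν f)
    (hmem : LinearMap.id - f ∈ traceModule (ν.linHom ν) G) : IsUnit (f : Module.End k X) := by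
  refine (isNilpotent_or_isUnit hν hf).resolve_left fun hn => hproj (isProjective_of_mem ?_)
  obtain ⟨u, hu⟩ := hn.isUnit_one_sub
  have h1 : (↑u⁻¹ : Module.End k X) ∘ₗ (LinearMap.id - f) = LinearMap.id := by
    change (↑u⁻¹ : Module.End k X) * (1 - f) = 1
    rw [← hu, u.inv_mul]
  have h2 : (LinearMap.id - f) ∘ₗ (↑u⁻¹ : Module.End k X) = LinearMap.id := by
    change (1 - f) * (↑u⁻¹ : Module.End k X) = 1
    rw [← hu, u.mul_inv]
  rw [← h1]
  exact comp_mem_traceModule (isIntertwiningMap_of_comp_eq_id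
    (isIntertwiningMap_of_mem_traceModule hmem) h1 h2) hmem

theorem asAlgebraHom_eq_one_of_isDirectSummand {V W : Type*} [AddCommGroup V] [Module k V]
    [AddCommGroup W] [Module k W] {ρ : Representation k G V} {σ : Representation k G W}
    (h : IsDirectSummand ρ σ) {a : MonoidAlgebra k G} (ha : σ.asAlgebraHom a = 1) :
    ρ.asAlgebraHom a = 1 := by
  obtain ⟨i, q, hi, hq, hqi⟩ := isDirectSummand_iff.1 h
  have h1 := comp_asAlgebraHom hi a
  rw [ha] at h1
  calc ρ.asAlgebraHom a = (q ∘ₗ i) ∘ₗ ρ.asAlgebraHom a := by rw [hqi, LinearMap.id_comp]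
    _ = q ∘ₗ i := by rw [LinearMap.comp_assoc, h1]; rfl
    _ = 1 := hqi

namespace LocalPair

variable {D H : Subgroup G} {e : MonoidAlgebra k G} {e₁ : MonoidAlgebra k H}
  {V : Type*} [AddCommGroup V] [Module k V]
  {W : Type*} [AddCommGroup W] [Module k W]
  {X : Type*} [AddCommGroup X] [Module k X] {Y : Type*} [AddCommGroup Y] [Module k Y]
  {ρ : Representation k G V} {σ : Representation k G W}
  {ν : Representation k H X} {μ : Representation k H Y}

theorem asAlgebraHom_comp_of_eq_one {i : X →ₗ[k] V}
    (hi : ν.IsIntertwiningMap (restrict ρ H) i) (hν : ν.asAlgebraHom e₁ = 1) :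
    ρ.asAlgebraHom (inclusion H e₁) ∘ₗ i = i := by
  rw [← asAlgebraHom_restrict, ← comp_asAlgebraHom hi, hν]
  rfl

variable [Finite G]

/-- An endomorphism of an indecomposable module which agrees on the `e₁`-part, up to a projective
map, with a non-projective idempotent is invertible. -/
theorem isUnit_of_comp_sub_mem [FiniteDimensional k V] (hρ : IsIndecomposable ρ)
    {Ψ π : Module.End k V} (hΨ : ρ.IsIntertwiningMap ρ Ψ)
    (hπi : (restrict ρ H).IsIntertwiningMap (restrict ρ H) π) (hππ : π * π = π)
    (hεπ : ρ.asAlgebraHom (inclusion H e₁) * π = π)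
    (hmem : ρ.asAlgebraHom (inclusion H e₁) * Ψ - π ∈
      traceModule ((restrict ρ H).linHom (restrict ρ H)) H)
    (hπ : π ∉ traceModule ((restrict ρ H).linHom (restrict ρ H)) H) : IsUnit Ψ := by
  refine (isNilpotent_or_isUnit hρ hΨ).resolve_left fun ⟨n, hn⟩ => hπ ?_
  set E := ρ.asAlgebraHom (inclusion H e₁)
  have hc : Commute Ψ E := comp_asAlgebraHom hΨ _
  -- the powers of `Ψ` also agree with `π` on the `e₁`-part, so that `Ψ` cannot be nilpotent
  have hstep : ∀ m : ℕ, E * Ψ ^ (m + 1) - π ∈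
      traceModule ((restrict ρ H).linHom (restrict ρ H)) H := by
    intro m
    induction m with
    | zero => simpa using hmem
    | succ m ih =>
      have hcm : Ψ ^ (m + 1) * E = E * Ψ ^ (m + 1) := hc.pow_left (m + 1)
      have h1 : E * Ψ ^ (m + 1 + 1) - π =
          Ψ ^ (m + 1) * (E * Ψ - π) + (E * Ψ ^ (m + 1) - π) * π := by
        rw [mul_sub, sub_mul, hππ, ← mul_assoc, hcm, mul_assoc E, ← pow_succ, ← hcm,
          mul_assoc _ E π, hεπ]
        abel
      rw [h1]
      exact add_mem (comp_mem_traceModule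
        (isIntertwiningMap_restrict (isIntertwiningMap_pow hΨ (m + 1)) H) hmem)
        (mem_traceModule_comp ih hπi)
  have h2 := hstep n
  rw [pow_succ, hn, zero_mul, mul_zero, zero_sub] at h2
  exact (Submodule.neg_mem_iff _).1 h2

theorem comp_notMem_of_not_isProjective {i : X →ₗ[k] V} {q : V →ₗ[k] X}
    (hi : ν.IsIntertwiningMap (restrict ρ H) i) (hq : (restrict ρ H).IsIntertwiningMap ν q)
    (hqi : q ∘ₗ i = LinearMap.id) (hproj : ¬ IsProjective ν) :
    i ∘ₗ q ∉ traceModule ((restrict ρ H).linHom (restrict ρ H)) H := fun hmem => by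
  refine hproj (isProjective_of_mem ?_)
  have h1 := comp_mem_traceModule hq (mem_traceModule_comp hmem hi)
  rwa [LinearMap.comp_assoc, hqi, LinearMap.comp_id, hqi] at h1

/-- If `β' ∘ β` is the projection to a non-projective summand of the `e₁`-part of an indecomposable
module, then lifts of `β` and `β'` to homomorphisms of `G`-modules compose to an automorphism. -/
theorem isUnit_comp_of_lifts [FiniteDimensional k V] (hρ : IsIndecomposable ρ)
    {i : X →ₗ[k] V} {q : V →ₗ[k] X}
    (hi : ν.IsIntertwiningMap (restrict ρ H) i) (hq : (restrict ρ H).IsIntertwiningMap ν q)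
    (hqi : q ∘ₗ i = LinearMap.id) (hν : ν.asAlgebraHom e₁ = 1) (hproj : ¬ IsProjective ν)
    {β Φ : V →ₗ[k] W} {β' Φ' : W →ₗ[k] V} (hΦ : ρ.IsIntertwiningMap σ Φ)
    (hΦ' : σ.IsIntertwiningMap ρ Φ')
    (hβ : (restrict ρ H).IsIntertwiningMap (restrict σ H) β)
    (hεβ : σ.asAlgebraHom (inclusion H e₁) ∘ₗ β = β) (hββ : β' ∘ₗ β = i ∘ₗ q)
    (hmem : σ.asAlgebraHom (inclusion H e₁) ∘ₗ Φ - β ∈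
      traceModule ((restrict ρ H).linHom (restrict σ H)) H)
    (hmem' : ρ.asAlgebraHom (inclusion H e₁) ∘ₗ Φ' - β' ∈
      traceModule ((restrict σ H).linHom (restrict ρ H)) H) :
    IsUnit (Φ' ∘ₗ Φ : Module.End k V) := by
  refine isUnit_of_comp_sub_mem (e₁ := e₁) hρ (π := i ∘ₗ q) (isIntertwiningMap_comp hΦ' hΦ)
    (isIntertwiningMap_comp hi hq) ?_ ?_ ?_ (comp_notMem_of_not_isProjective hi hq hqi hproj)
  · change (i ∘ₗ q) ∘ₗ (i ∘ₗ q) = i ∘ₗ q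
    rw [LinearMap.comp_assoc, ← LinearMap.comp_assoc q, hqi, LinearMap.id_comp]
  · change _ ∘ₗ (i ∘ₗ q) = i ∘ₗ q
    rw [← LinearMap.comp_assoc, asAlgebraHom_comp_of_eq_one hi hν]
  · have h1 : ρ.asAlgebraHom (inclusion H e₁) ∘ₗ (Φ' ∘ₗ Φ) - i ∘ₗ q =
        Φ' ∘ₗ (σ.asAlgebraHom (inclusion H e₁) ∘ₗ Φ - β) +
          (ρ.asAlgebraHom (inclusion H e₁) ∘ₗ Φ' - β') ∘ₗ β := by
      rw [LinearMap.comp_sub, LinearMap.sub_comp, hββ, ← LinearMap.comp_assoc,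
        ← LinearMap.comp_assoc, comp_asAlgebraHom hΦ']
      have h2 : (ρ.asAlgebraHom (inclusion H e₁) ∘ₗ Φ') ∘ₗ β = Φ' ∘ₗ β := by
        rw [← comp_asAlgebraHom hΦ', LinearMap.comp_assoc, hεβ]
      rw [h2]
      abel
    have h3 := add_mem (comp_mem_traceModule (isIntertwiningMap_restrict hΦ' H) hmem)
      (mem_traceModule_comp hmem' hβ)
    rw [← h1] at h3
    exact h3

/-- The complement of a non-projective summand in the `e₁`-part of an indecomposable module is
projective. -/
theorem sub_comp_mem [FiniteDimensional k V] (h : LocalPair D H e e₁)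
    (hρ : IsIndecomposable ρ) {i : X →ₗ[k] V} {q : V →ₗ[k] X}
    (hi : ν.IsIntertwiningMap (restrict ρ H) i) (hq : (restrict ρ H).IsIntertwiningMap ν q)
    (hqi : q ∘ₗ i = LinearMap.id) (hν : ν.asAlgebraHom e₁ = 1) (hproj : ¬ IsProjective ν) :
    ρ.asAlgebraHom (inclusion H e₁) - i ∘ₗ q ∈
      traceModule ((restrict ρ H).linHom (restrict ρ H)) H := by
  set E : Module.End k V := ρ.asAlgebraHom (inclusion H e₁) with hE
  let π : Module.End k V := i ∘ₗ q
  have hππ : π * π = π := by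
    change (i ∘ₗ q) ∘ₗ (i ∘ₗ q) = i ∘ₗ q
    rw [LinearMap.comp_assoc, ← LinearMap.comp_assoc q, hqi, LinearMap.id_comp]
  have hεπ : E * π = π := by
    change _ ∘ₗ (i ∘ₗ q) = i ∘ₗ q
    rw [← LinearMap.comp_assoc, asAlgebraHom_comp_of_eq_one hi hν]
  have hπi : (restrict ρ H).IsIntertwiningMap (restrict ρ H) π := isIntertwiningMap_comp hi hq
  -- the lift `u` of `π` is an automorphism with `E * u ≡ π`, so `E ≡ u⁻¹ * π`, and multiplication
  -- by `π` on the right gives `π ≡ u⁻¹ * π`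
  obtain ⟨Φ, hΦ, hmem⟩ := h.exists_lift hπi hεπ
  obtain ⟨u, rfl⟩ := isUnit_of_comp_sub_mem hρ hΦ hπi hππ hεπ hmem
    (comp_notMem_of_not_isProjective hi hq hqi hproj)
  have hu : ρ.IsIntertwiningMap ρ (↑u⁻¹ : Module.End k V) :=
    isIntertwiningMap_of_comp_eq_id hΦ u.inv_mul u.mul_inv
  have hc : (↑u⁻¹ : Module.End k V) * E = E * (↑u⁻¹ : Module.End k V) := comp_asAlgebraHom hu _
  have h1 : E - (↑u⁻¹ : Module.End k V) * π ∈
      traceModule ((restrict ρ H).linHom (restrict ρ H)) H := by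
    have h2 := comp_mem_traceModule (isIntertwiningMap_restrict hu H) hmem
    have h3 : (↑u⁻¹ : Module.End k V) * (E * u - π) = E - (↑u⁻¹ : Module.End k V) * π := by
      rw [mul_sub, ← mul_assoc, hc, mul_assoc, u.inv_mul, mul_one]
    rw [← h3]
    exact h2
  have h4 : π - (↑u⁻¹ : Module.End k V) * π ∈
      traceModule ((restrict ρ H).linHom (restrict ρ H)) H := by
    have h2 := mem_traceModule_comp h1 hπi
    have h3 : (E - (↑u⁻¹ : Module.End k V) * π) * π = π - (↑u⁻¹ : Module.End k V) * π := by
      rw [sub_mul, mul_assoc, hππ, hεπ]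
    rw [← h3]
    exact h2
  have h5 := sub_mem h1 h4
  rwa [sub_sub_sub_cancel_right] at h5

/-- The non-projective indecomposable summand of the restriction in `e₁` is unique. -/
theorem isomorphic_of_isDirectSummand_restrict [FiniteDimensional k V] [FiniteDimensional k Y]
    (h : LocalPair D H e e₁) (hρ : IsIndecomposable ρ) (hν : IsIndecomposable ν)
    (hμ : IsIndecomposable μ) (hνp : ¬ IsProjective ν) (hμp : ¬ IsProjective μ)
    (hν1 : ν.asAlgebraHom e₁ = 1) (hμ1 : μ.asAlgebraHom e₁ = 1)
    (hνs : IsDirectSummand ν (restrict ρ H)) (hμs : IsDirectSummand μ (restrict ρ H)) :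
    Isomorphic μ ν := by
  obtain ⟨i, q, hi, hq, hqi⟩ := isDirectSummand_iff.1 hνs
  obtain ⟨j, r, hj, hr, hrj⟩ := isDirectSummand_iff.1 hμs
  have := hμ.1
  have hqj := isIntertwiningMap_comp hq hj
  have hri := isIntertwiningMap_comp hr hi
  refine isomorphic_of_isUnit_comp hν hqj hri (isUnit_of_id_sub_mem hμ hμp
    (isIntertwiningMap_comp hri hqj) ?_)
  have h1 := comp_mem_traceModule hr
    (mem_traceModule_comp (h.sub_comp_mem hρ hi hq hqi hν1 hνp) hj)
  rw [LinearMap.sub_comp, LinearMap.comp_sub, asAlgebraHom_comp_of_eq_one hj hμ1, hrj] at h1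
  exact h1

/-- Indecomposable modules with a common non-projective summand of their restrictions in `e₁` are
isomorphic. -/
theorem isomorphic_of_restrict_isDirectSummand [FiniteDimensional k V]
    (h : LocalPair D H e e₁) (hρ : IsIndecomposable ρ) (hσ : IsIndecomposable σ)
    (hνp : ¬ IsProjective ν) (hν1 : ν.asAlgebraHom e₁ = 1)
    (hνρ : IsDirectSummand ν (restrict ρ H)) (hνσ : IsDirectSummand ν (restrict σ H)) :
    Isomorphic ρ σ := by
  obtain ⟨i, q, hi, hq, hqi⟩ := isDirectSummand_iff.1 hνρ
  obtain ⟨j, r, hj, hr, hrj⟩ := isDirectSummand_iff.1 hνσ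
  have hβ := isIntertwiningMap_comp hj hq
  have hβ' := isIntertwiningMap_comp hi hr
  have hε : σ.asAlgebraHom (inclusion H e₁) ∘ₗ (j ∘ₗ q) = j ∘ₗ q := by
    rw [← LinearMap.comp_assoc, asAlgebraHom_comp_of_eq_one hj hν1]
  have hε' : ρ.asAlgebraHom (inclusion H e₁) ∘ₗ (i ∘ₗ r) = i ∘ₗ r := by
    rw [← LinearMap.comp_assoc, asAlgebraHom_comp_of_eq_one hi hν1]
  obtain ⟨Φ, hΦ, hmem⟩ := h.exists_lift hβ hε
  obtain ⟨Φ', hΦ', hmem'⟩ := h.exists_lift hβ' hε'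
  have := hρ.1
  refine isomorphic_of_isUnit_comp hσ hΦ hΦ' (isUnit_comp_of_lifts hρ hi hq hqi hν1 hνp
    hΦ hΦ' hβ hε ?_ hmem hmem')
  rw [LinearMap.comp_assoc, ← LinearMap.comp_assoc q, hrj, LinearMap.id_comp]

/-- If `V` is projective relative to `Q ≤ D`, then so is every summand of its restriction in
`e₁`. -/
theorem mem_traceModule_of_summand (h : LocalPair D H e e₁) {Q : Subgroup G} (hQ : Q ≤ D)
    (hmem : LinearMap.id ∈ traceModule (ρ.linHom ρ) (G ⧸ Q)) (hν1 : ν.asAlgebraHom e₁ = 1)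
    (hνρ : IsDirectSummand ν (restrict ρ H)) :
    LinearMap.id ∈ traceModule (ν.linHom ν) (H ⧸ Q.subgroupOf H) := by
  obtain ⟨i, q, hi, hq, hqi⟩ := isDirectSummand_iff.1 hνρ
  obtain ⟨γ, hγ, hsum⟩ := mem_traceModule_quotient.1 hmem
  have h1 := h.comp_relTrace_sub_mem hQ hγ
  rw [hsum, LinearMap.comp_id] at h1
  have hγ' : ∀ x ∈ Q.subgroupOf H, ((restrict ρ H).linHom (restrict ρ H)) x γ = γ :=
    fun x hx => hγ x hx
  have h2 := comp_mem_traceModule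
    (isIntertwiningMap_asAlgebraHom (ρ := ρ) fun x hx => h.conjRep_inclusion hx)
    (relTrace_mem hγ')
  have h3 := add_mem (traceModule_self_le (S := H ⧸ Q.subgroupOf H) h1) h2
  rw [restrict_linHom, sub_add_cancel] at h3
  have h4 := comp_mem_traceModule hq (mem_traceModule_comp h3 hi)
  rwa [asAlgebraHom_comp_of_eq_one hi hν1, hqi] at h4

/-- Conversely, `V` is projective relative to every subgroup relative to which the non-projective
summand of its restriction is. -/
theorem mem_traceModule_of_restrict_summand [FiniteDimensional k V] (h : LocalPair D H e e₁)
    (hρ : IsIndecomposable ρ) (hρ1 : ρ.asAlgebraHom e = 1) (hν1 : ν.asAlgebraHom e₁ = 1)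
    (hνp : ¬ IsProjective ν) (hνρ : IsDirectSummand ν (restrict ρ H)) {P : Subgroup G}
    (hP : P ≤ H) (hmem : LinearMap.id ∈ traceModule (ν.linHom ν) (H ⧸ P.subgroupOf H)) :
    LinearMap.id ∈ traceModule (ρ.linHom ρ) (G ⧸ P) := by
  obtain ⟨i, q, hi, hq, hqi⟩ := isDirectSummand_iff.1 hνρ
  refine h.mem_of_mem_restrict hρ1 hP ?_
  have h1 := comp_mem_traceModule hi (mem_traceModule_comp hmem hq)
  have h2 := traceModule_self_le (S := H ⧸ P.subgroupOf H) (h.sub_comp_mem hρ hi hq hqi hν1 hνp)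
  have h3 := add_mem h2 h1
  rwa [LinearMap.id_comp, sub_add_cancel] at h3

end LocalPair

end Green

section Existence

variable {k : Type u} [Field k] {G : Type v} [Group G] [Finite G]

/-- The image of an idempotent of the group algebra which acts as an endomorphism is a direct
summand. -/
theorem exists_rep_of_idempotent {k : Type u} [Field k] {G : Type v} [Group G] {V : Type w}
    [AddCommGroup V] [Module k V] [FiniteDimensional k V] {ρ : Representation k G V}
    {a : MonoidAlgebra k G} (ha : a * a = a) (hρ : ρ.IsIntertwiningMap ρ (ρ.asAlgebraHom a)) :
    ∃ (U : Rep.{w} k G) (i : U →ₗ[k] V) (q : V →ₗ[k] U), FiniteDimensional k U ∧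
      U.ρ.IsIntertwiningMap ρ i ∧ ρ.IsIntertwiningMap U.ρ q ∧ q ∘ₗ i = LinearMap.id ∧
      i ∘ₗ q = ρ.asAlgebraHom a ∧ U.ρ.asAlgebraHom a = 1 := by
  let E : V →ₗ[k] V := ρ.asAlgebraHom a
  have hEE : ∀ v, E (E v) = E v := fun v => by
    have h1 : E ∘ₗ E = E := by
      change ρ.asAlgebraHom _ * ρ.asAlgebraHom _ = _
      rw [← map_mul, ha]
    exact LinearMap.congr_fun h1 v
  let U : Subrepresentation ρ := rangeSubrep E hρ
  let i : U.toSubmodule →ₗ[k] V := U.toSubmodule.subtype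
  have hi : U.toRepresentation.IsIntertwiningMap ρ i := ⟨fun g v => rfl⟩
  refine ⟨Rep.of U.toRepresentation, i, E.rangeRestrict,
    inferInstanceAs (FiniteDimensional k U.toSubmodule), hi,
    ⟨fun g v => Subtype.ext (hρ.isIntertwining g v)⟩, LinearMap.ext ?_, rfl,
    LinearMap.ext fun x => Subtype.ext ?_⟩
  · rintro ⟨_, v, rfl⟩
    exact Subtype.ext (hEE v)
  · refine (LinearMap.congr_fun (comp_asAlgebraHom hi a) x).trans ?_
    obtain ⟨_, v, rfl⟩ := x
    exact hEE v

/-- The module coinduced from `ν`: the group algebra acts on its summand `ν` through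
truncation. -/
theorem exists_coind {H : Subgroup G} {X : Type max v w}
    [AddCommGroup X] [Module k X] [FiniteDimensional k X] (ν : Representation k H X) :
    ∃ (C : Rep.{max v w} k G) (i : X →ₗ[k] C) (q : C →ₗ[k] X), FiniteDimensional k C ∧
      ν.IsIntertwiningMap (restrict C.ρ H) i ∧ (restrict C.ρ H).IsIntertwiningMap ν q ∧
      ∀ a, q ∘ₗ C.ρ.asAlgebraHom a ∘ₗ i = ν.asAlgebraHom (truncate H a) := by
  classical
  let σ : Representation k G (Representation.coindV H.subtype ν) :=
    Representation.coind H.subtype ν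
  have hσ : ∀ g f x, (σ g f).1 x = f.1 (x * g) := fun g f x => rfl
  have hfd : FiniteDimensional k (Representation.coindV H.subtype ν) :=
    inferInstanceAs (FiniteDimensional k (Representation.coindV H.subtype ν : Submodule k (G → X)))
  -- the summand `ν` of the restriction of the coinduced module
  let i : X →ₗ[k] Representation.coindV H.subtype ν :=
    { toFun := fun x => ⟨fun g => if hg : g ∈ H then ν ⟨g, hg⟩ x else 0, fun a g => by
        by_cases hg : g ∈ H
        · have h1 : (a : G) * g ∈ H := H.mul_mem a.2 hg
          have h2 : (⟨(a : G) * g, h1⟩ : H) = a * ⟨g, hg⟩ := rfl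
          simp [hg, h1, h2]
        · have h1 : ¬ (a : G) * g ∈ H := by rwa [H.mul_mem_cancel_left a.2]
          simp [hg, h1]⟩
      map_add' := fun x y => Subtype.ext (funext fun g => by
        by_cases hg : g ∈ H <;> simp [hg])
      map_smul' := fun c x => Subtype.ext (funext fun g => by
        by_cases hg : g ∈ H <;> simp [hg]) }
  let q : Representation.coindV H.subtype ν →ₗ[k] X :=
    (LinearMap.proj 1) ∘ₗ (Representation.coindV H.subtype ν).subtype
  have hi : ν.IsIntertwiningMap (restrict σ H) i := by
    refine ⟨fun a x => Subtype.ext (funext fun g => ?_)⟩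
    change (if hg : g ∈ H then ν ⟨g, hg⟩ (ν a x) else 0) =
      (if hg : g * (a : G) ∈ H then ν ⟨g * a, hg⟩ x else 0)
    by_cases hg : g ∈ H
    · have h1 : g * (a : G) ∈ H := H.mul_mem hg a.2
      have h2 : (⟨g * (a : G), h1⟩ : H) = ⟨g, hg⟩ * a := rfl
      rw [dif_pos hg, dif_pos h1, h2, map_mul]
      rfl
    · have h1 : ¬ g * (a : G) ∈ H := by rwa [H.mul_mem_cancel_right a.2]
      rw [dif_neg hg, dif_neg h1]
  have hq : (restrict σ H).IsIntertwiningMap ν q := by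
    refine ⟨fun a f => ?_⟩
    change f.1 (1 * (a : G)) = ν a (f.1 1)
    have := f.2 a 1
    rw [mul_one] at this
    rw [one_mul]
    exact this
  refine ⟨Rep.of σ, i, q, hfd, hi, hq, fun a => LinearMap.ext fun x => ?_⟩
  change q (σ.asAlgebraHom a (i x)) = ν.asAlgebraHom (truncate H a) x
  induction a using MonoidAlgebra.induction_linear with
  | zero => simp [truncate]
  | add a b ha hb =>
    have h1 : truncate H (a + b) = truncate H a + truncate H b :=
      MonoidAlgebra.comapDomain_add _ _ _ _
    simp only [map_add, LinearMap.add_apply, ha, hb, h1]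
  | single g r =>
    rw [Representation.asAlgebraHom_single, LinearMap.smul_apply, map_smul]
    have h1 : q (σ g (i x)) = if hg : g ∈ H then ν ⟨g, hg⟩ x else 0 := by
      change (if hg : 1 * g ∈ H then ν ⟨1 * g, hg⟩ x else 0) = _
      simp only [one_mul]
    rw [h1]
    by_cases hg : g ∈ H
    · have h2 : truncate H (MonoidAlgebra.single g r) = MonoidAlgebra.single ⟨g, hg⟩ r :=
        MonoidAlgebra.comapDomain_single_map H.subtype H.subtype_injective ⟨g, hg⟩ r
      rw [h2, dif_pos hg]
      simp
    · have h2 : truncate H (MonoidAlgebra.single g r) = 0 :=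
        MonoidAlgebra.comapDomain_single_of_not_mem_range (by simpa using hg)
          H.subtype_injective
      rw [h2, dif_neg hg]
      simp

namespace LocalPair

variable {D H : Subgroup G} {e : MonoidAlgebra k G} {e₁ : MonoidAlgebra k H}

/-- The restriction of a non-projective module in `e` has a non-projective indecomposable summand in
`e₁`, since otherwise `e₁` would act on it as a trace from the trivial subgroup. -/
theorem exists_isDirectSummand_restrict (h : LocalPair D H e e₁) {V : Type w} [AddCommGroup V]
    [Module k V] [FiniteDimensional k V] {ρ : Representation k G V} (hρ1 : ρ.asAlgebraHom e = 1)
    (hρp : ¬ IsProjective ρ) :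
    ∃ N : Rep.{w} k H, FiniteDimensional k N ∧ IsIndecomposable N.ρ ∧ ¬ IsProjective N.ρ ∧
      N.ρ.asAlgebraHom e₁ = 1 ∧ IsDirectSummand N.ρ (restrict ρ H) := by
  have hE := isIntertwiningMap_asAlgebraHom (ρ := ρ) fun x hx => h.conjRep_inclusion (x := x) hx
  rw [← asAlgebraHom_restrict] at hE
  obtain ⟨U, i, q, hUf, hi, hq, hqi, hiq, hU1⟩ := exists_rep_of_idempotent h.idem₁ hE
  have hUp : ¬ IsProjective U.ρ := fun hUp => by
    have h1 := comp_mem_traceModule hi (mem_traceModule_comp (mem_of_isProjective hUp) hq)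
    rw [LinearMap.id_comp, hiq, asAlgebraHom_restrict] at h1
    exact hρp (isProjective_of_mem (traceModule_quotient_bot_le
      (h.mem_of_mem_restrict hρ1 bot_le (traceModule_self_le h1))))
  obtain ⟨N, hNf, hNi, hNp, hN⟩ := exists_nonprojective_summand U hUf hUp
  exact ⟨N, hNf, hNi, hNp, asAlgebraHom_eq_one_of_isDirectSummand hN hU1,
    hN.trans (isDirectSummand_iff.2 ⟨i, q, hi, hq, hqi⟩)⟩

/-- Every non-projective indecomposable module in `e₁` is a summand of the restriction of a
module in `e`, found inside the coinduced module. -/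
theorem exists_restrict_isDirectSummand (h : LocalPair D H e e₁) {X : Type max v w}
    [AddCommGroup X] [Module k X] [FiniteDimensional k X] {ν : Representation k H X}
    (hν : IsIndecomposable ν) (hνp : ¬ IsProjective ν) (hν1 : ν.asAlgebraHom e₁ = 1) :
    ∃ M : Rep.{max v w} k G, FiniteDimensional k M ∧ IsIndecomposable M.ρ ∧ ¬ IsProjective M.ρ ∧
      M.ρ.asAlgebraHom e = 1 ∧ IsDirectSummand ν (restrict M.ρ H) := by
  -- hence `ν` remains a summand of the `e`-part of the coinduced module
  have hunit : IsUnit (ν.asAlgebraHom (truncate H e)) := by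
    have h1 : truncate H e * e₁ = (truncate H e - e₁) * e₁ + e₁ := by
      rw [sub_mul, h.idem₁, sub_add_cancel]
    have h2 : ν.asAlgebraHom (truncate H e) =
        ν.asAlgebraHom ((truncate H e - e₁) * e₁) + 1 := by
      have h3 := congrArg ν.asAlgebraHom h1
      rwa [map_mul, map_add, hν1, mul_one] at h3
    rw [h2]
    exact (h.isNilpotent.map ν.asAlgebraHom).isUnit_add_one
  obtain ⟨C, i, q, hCf, hi, hq, hqi⟩ := exists_coind.{u, v, w} ν
  have hE : C.ρ.IsIntertwiningMap C.ρ (C.ρ.asAlgebraHom e) := linHom_apply_eq_iff.1 fun g => by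
    conv_rhs => rw [← mem_center_iff_conjRep.1 h.mem_center g, asAlgebraHom_conjRep]
  obtain ⟨U, j, r, hUf, hj, hr, -, hjr, hU1⟩ := exists_rep_of_idempotent h.idem hE
  have hνU : IsDirectSummand ν (restrict U.ρ H) := by
    refine isDirectSummand_of_isUnit_comp
      (isIntertwiningMap_comp (isIntertwiningMap_restrict hr H) hi)
      (isIntertwiningMap_comp hq (isIntertwiningMap_restrict hj H)) ?_
    rw [LinearMap.comp_assoc, ← LinearMap.comp_assoc i r j, hjr, hqi]
    exact hunit
  obtain ⟨M, hMf, hMi, hMs, hM⟩ := exists_summand_of_isDirectSummand_restrict hν U hUf hνU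
  refine ⟨M, hMf, hMi, fun hMp => hνp ?_, asAlgebraHom_eq_one_of_isDirectSummand hM hU1, hMs⟩
  refine isProjective_of_mem (mem_of_isDirectSummand hMs ?_)
  exact traceModule_self_le_restrict H (mem_of_isProjective hMp)

/-- A non-projective indecomposable module in `e` and the corresponding one in `e₁` have a common
vertex contained in `D`. -/
theorem exists_isVertex (h : LocalPair D H e e₁) {V : Type w} [AddCommGroup V]
    [Module k V] [FiniteDimensional k V] {ρ : Representation k G V} {X : Type w'} [AddCommGroup X]
    [Module k X] [FiniteDimensional k X] {ν : Representation k H X}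
    (hρ : IsIndecomposable ρ) (hρp : ¬ IsProjective ρ) (hρ1 : ρ.asAlgebraHom e = 1)
    (hνp : ¬ IsProjective ν) (hν1 : ν.asAlgebraHom e₁ = 1)
    (hνρ : IsDirectSummand ν (restrict ρ H)) :
    ∃ Q ≤ D, Q ≠ ⊥ ∧ Subgroup.normalizer (Q : Set G) ≤ H ∧ IsVertex ρ Q ∧
      IsVertex ν (Q.subgroupOf H) := by
  have hD : IsRelativelyProjective ρ D := isRelativelyProjective_iff.2 (by
    have h1 := asAlgebraHom_mem_traceModule (ρ := ρ) h.mem_trace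
    rwa [hρ1] at h1)
  obtain ⟨Q, hQD, hQ⟩ := exists_minimal_le_of_wellFoundedLT (IsRelativelyProjective ρ) D hD
  have hQne : Q ≠ ⊥ := by
    rintro rfl
    exact hρp (isProjective_of_mem (traceModule_quotient_bot_le
      (isRelativelyProjective_iff.1 hQ.1)))
  refine ⟨Q, hQD, hQne, fun g hg => ?_, hQ, ?_, fun P hP hPQ => ?_⟩
  · obtain ⟨⟨x, hx⟩, hx1⟩ := Subgroup.ne_bot_iff_exists_ne_one.1 hQne
    exact h.fusion x (hQD hx) (fun h0 => hx1 (Subtype.ext h0)) g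
      (hQD ((Subgroup.mem_normalizer_iff.1 hg x).1 hx))
  · exact isRelativelyProjective_iff.2 (h.mem_traceModule_of_summand hQD
      (isRelativelyProjective_iff.1 hQ.1) hν1 hνρ)
  · have hPs : (P.map H.subtype).subgroupOf H = P :=
      Subgroup.comap_map_eq_self_of_injective H.subtype_injective P
    have h2 := h.mem_traceModule_of_restrict_summand hρ hρ1 hν1 hνp hνρ
      (Subgroup.map_subtype_le P) (isRelativelyProjective_iff.1 (by rwa [hPs]))
    have h3 : P.map H.subtype ≤ Q := by
      rw [Subgroup.map_le_iff_le_comap]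
      exact hPQ
    have h4 := hQ.2 (isRelativelyProjective_iff.2 h2) h3
    rw [← hPs]
    exact Subgroup.comap_mono h4

end LocalPair

end Existence

/-! ### Invariant forms -/

section Forms

variable {k : Type*} [Field k] {G : Type*} [Group G]
  {V : Type*} [AddCommGroup V] [Module k V] {W : Type*} [AddCommGroup W] [Module k W]
  {ρ : Representation k G V} {σ : Representation k G W}

theorem isIntertwiningMap_transpose {f : V →ₗ[k] W} (hf : ρ.IsIntertwiningMap σ f) :
    σ.dual.IsIntertwiningMap ρ.dual (Module.Dual.transpose (R := k) f) := by
  refine ⟨fun g l => LinearMap.ext fun v => ?_⟩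
  change l (σ g⁻¹ (f v)) = l (f (ρ g⁻¹ v))
  rw [hf.isIntertwining]

theorem transpose_linHom (g : G) (f : V →ₗ[k] W) :
    Module.Dual.transpose (R := k) (ρ.linHom σ g f) =
      σ.dual.linHom ρ.dual g (Module.Dual.transpose (R := k) f) := by
  refine LinearMap.ext fun l => LinearMap.ext fun v => ?_
  change l (σ g (f (ρ g⁻¹ v))) = l (σ g⁻¹⁻¹ (f (ρ g⁻¹ v)))
  rw [inv_inv]

theorem transpose_mem_traceModule {S : Type*} [MulAction G S] [Finite S] {f : V →ₗ[k] W}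
    (hf : f ∈ traceModule (ρ.linHom σ) S) :
    Module.Dual.transpose (R := k) f ∈ traceModule (σ.dual.linHom ρ.dual) S := by
  exact map_mem_traceModule (X := V →ₗ[k] W) (Y := Module.Dual k W →ₗ[k] Module.Dual k V)
    (τ := ρ.linHom σ) (τ' := σ.dual.linHom ρ.dual) (Module.Dual.transpose (R := k))
    transpose_linHom hf

theorem flip_mem_traceModule {S : Type*} [MulAction G S] [Finite S]
    {b : V →ₗ[k] Module.Dual k V} (hb : b ∈ traceModule (ρ.linHom ρ.dual) S) :
    b.flip ∈ traceModule (ρ.linHom ρ.dual) S := by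
  obtain ⟨φ, hφ, rfl⟩ := hb
  refine ⟨fun s => (φ s).flip, fun g s => ?_, ?_⟩
  · exact congrArg LinearMap.flip (hφ g s)
  · let F : (V →ₗ[k] Module.Dual k V) →+ (V →ₗ[k] Module.Dual k V) :=
      { toFun := LinearMap.flip, map_zero' := rfl, map_add' := fun _ _ => rfl }
    exact (F.map_finsum (Set.toFinite _)).symm

theorem isIntertwiningMap_dual_iff {b : V →ₗ[k] Module.Dual k V} :
    ρ.IsIntertwiningMap ρ.dual b ↔ ∀ g x y, b (ρ g x) (ρ g y) = b x y := by
  refine ⟨fun h g x y => ?_, fun h => ⟨fun g x => LinearMap.ext fun y => ?_⟩⟩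
  · rw [h.isIntertwining]
    change b x (ρ g⁻¹ (ρ g y)) = b x y
    rw [ρ.inv_self_apply]
  · change b (ρ g x) y = b x (ρ g⁻¹ y)
    rw [← h g x, ρ.self_inv_apply]

theorem isIntertwiningMap_flip {b : V →ₗ[k] Module.Dual k V} (hb : ρ.IsIntertwiningMap ρ.dual b) :
    ρ.IsIntertwiningMap ρ.dual b.flip :=
  isIntertwiningMap_dual_iff.2 fun g x y => isIntertwiningMap_dual_iff.1 hb g y x

theorem asAlgebraHom_eq_sum [Fintype G] (a : MonoidAlgebra k G) :
    ρ.asAlgebraHom a = ∑ g, a.coeff g • ρ g := by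
  classical
  induction a using MonoidAlgebra.induction_linear with
  | zero => simp
  | add a b ha hb => simp [ha, hb, add_smul, Finset.sum_add_distrib]
  | single g r =>
    rw [Representation.asAlgebraHom_single, Finset.sum_eq_single g]
    · simp
    · intro x _ hx
      simp [hx.symm]
    · simp

/-- An element of `kG` which is fixed by the inversion of group elements acts on the dual as the
transpose of its action. -/
theorem asAlgebraHom_dual [Finite G] {a : MonoidAlgebra k G}
    (ha : ∀ g, a.coeff g⁻¹ = a.coeff g) :
    ρ.dual.asAlgebraHom a = Module.Dual.transpose (R := k) (ρ.asAlgebraHom a) := by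
  classical
  cases nonempty_fintype G
  rw [asAlgebraHom_eq_sum, asAlgebraHom_eq_sum, map_sum,
    ← Equiv.sum_comp (Equiv.inv G) fun g => a.coeff g • ρ.dual g]
  refine Finset.sum_congr rfl fun g _ => ?_
  rw [map_smul, Equiv.inv_apply, ha, Representation.dual_apply, inv_inv]

theorem exists_inverse_of_injective [FiniteDimensional k V] {b : V →ₗ[k] Module.Dual k V}
    (hb : ρ.IsIntertwiningMap ρ.dual b) (hinj : Function.Injective b) :
    ∃ c : Module.Dual k V →ₗ[k] V, ρ.dual.IsIntertwiningMap ρ c ∧ c ∘ₗ b = LinearMap.id := by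
  let φ := LinearEquiv.ofInjectiveOfFinrankEq b hinj Subspace.dual_finrank_eq.symm
  have hφ : ∀ x, φ x = b x := fun x => rfl
  refine ⟨φ.symm, ⟨fun g l => ?_⟩, LinearMap.ext fun x => φ.symm_apply_apply x⟩
  obtain ⟨x, rfl⟩ := φ.surjective l
  change φ.symm (ρ.dual g (φ x)) = ρ g (φ.symm (φ x))
  rw [φ.symm_apply_apply, φ.symm_apply_eq, hφ, hφ, hb.isIntertwining]

variable (ρ) in
/-- The module affords a non-degenerate invariant bilinear form `b` with `b y x = s * b x y`. The
form is encoded as an injective homomorphism to the dual module, which amounts to non-degeneracy on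
a finite-dimensional module; in odd characteristic `s = 1` stands for symmetric and `s = -1` for
alternating forms. -/
def HasForm (s : k) : Prop :=
  ∃ b : V →ₗ[k] Module.Dual k V, ρ.IsIntertwiningMap ρ.dual b ∧ Function.Injective b ∧
    b.flip = s • b

theorem isSelfDual_iff [FiniteDimensional k V] : IsSelfDual ρ ↔
    ∃ b : V →ₗ[k] Module.Dual k V, ρ.IsIntertwiningMap ρ.dual b ∧ Function.Injective b := by
  refine ⟨fun ⟨f⟩ => ⟨f.toLinearMap,
    ⟨Representation.IntertwiningMap.isIntertwining _ _ f.toIntertwiningMap⟩, f.injective⟩,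
    fun ⟨b, hb, hinj⟩ => ?_⟩
  exact isomorphic_of_bijective hb ⟨hinj, (LinearMap.injective_iff_surjective_of_finrank_eq_finrank
    Subspace.dual_finrank_eq.symm).1 hinj⟩

theorem nondegenerate_of_injective {b : LinearMap.BilinForm k V} {s : k} (hs : s * s = 1)
    (hb : b.flip = s • b) (hinj : Function.Injective b) : b.Nondegenerate := by
  have h1 : b.SeparatingLeft :=
    LinearMap.separatingLeft_iff_ker_eq_bot.2 (LinearMap.ker_eq_bot.2 hinj)
  refine ⟨h1, fun y hy => h1 y fun x => ?_⟩
  have h2 : b x y = s * b y x := LinearMap.congr_fun₂ hb y x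
  have h3 : b y x = s * b x y := by rw [h2, ← mul_assoc, hs, one_mul]
  rw [h3, hy, mul_zero]

theorem injective_of_nondegenerate {b : LinearMap.BilinForm k V} (hb : b.Nondegenerate) :
    Function.Injective b :=
  LinearMap.ker_eq_bot.1 (LinearMap.separatingLeft_iff_ker_eq_bot.1 hb.1)

theorem isOrthogonal_iff (h2 : (2 : k) ≠ 0) : IsOrthogonal ρ ↔ HasForm ρ 1 := by
  constructor
  · rintro ⟨Q, hQ, hnd⟩
    refine ⟨QuadraticMap.polarBilin Q, isIntertwiningMap_dual_iff.2 fun g x y => ?_,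
      injective_of_nondegenerate hnd, ?_⟩
    · simp only [QuadraticMap.polarBilin_apply_apply, QuadraticMap.polar, ← map_add, hQ]
    · rw [one_smul]
      exact LinearMap.ext fun x => LinearMap.ext fun y => QuadraticMap.polar_comm Q y x
  · rintro ⟨b, hb, hinj, hsymm⟩
    refine ⟨LinearMap.BilinMap.toQuadraticMap b,
      fun g x => isIntertwiningMap_dual_iff.1 hb g x x, ?_⟩
    have h3 : QuadraticMap.polarBilin (LinearMap.BilinMap.toQuadraticMap b) = (2 : k) • b := by
      rw [LinearMap.BilinMap.polarBilin_toQuadraticMap]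
      change b + b.flip = _
      rw [hsymm, one_smul, two_smul]
    rw [h3]
    refine nondegenerate_of_injective (mul_one 1) ?_ ?_
    · change (2 : k) • b.flip = _
      rw [hsymm, one_smul, one_smul]
    · exact (smul_right_injective _ h2).comp hinj

theorem isSymplectic_iff (h2 : (2 : k) ≠ 0) : IsSymplectic ρ ↔ HasForm ρ (-1) := by
  constructor
  · rintro ⟨b, hb, halt, hnd⟩
    refine ⟨b, isIntertwiningMap_dual_iff.2 hb, injective_of_nondegenerate hnd, ?_⟩
    refine LinearMap.ext fun x => LinearMap.ext fun y => ?_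
    change b y x = -1 * b x y
    rw [neg_one_mul]
    exact (LinearMap.IsAlt.neg halt x y).symm
  · rintro ⟨b, hb, hinj, hskew⟩
    refine ⟨b, isIntertwiningMap_dual_iff.1 hb, fun x => ?_,
      nondegenerate_of_injective (by ring) hskew hinj⟩
    have h3 : b x x = (-1) * b x x := LinearMap.congr_fun₂ hskew x x
    have h4 : (2 : k) * b x x = 0 := by linear_combination h3
    exact (mul_eq_zero.1 h4).resolve_left h2

end Forms

section GreenForms

theorem half_smul_add_sub {k M : Type*} [Field k] [AddCommGroup M] [Module k M] {s : k}
    (h2 : (2 : k) ≠ 0) (hs : s * s = 1) (x y z : M) :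
    (2 : k)⁻¹ • (x + s • y) - z = (2 : k)⁻¹ • ((x - z) + s • (y - s • z)) := by
  have h1 : z = (2 : k)⁻¹ • (z + z) := by
    rw [← two_smul k, smul_smul, inv_mul_cancel₀ h2, one_smul]
  conv_lhs => rw [h1]
  rw [smul_sub s, smul_smul, hs, one_smul, ← smul_sub]
  congr 1
  abel

variable {k : Type*} [Field k] {G : Type*} [Group G] [Finite G]

namespace LocalPair

variable {D H : Subgroup G} {e : MonoidAlgebra k G} {e₁ : MonoidAlgebra k H}
  {V : Type*} [AddCommGroup V] [Module k V] {X : Type*} [AddCommGroup X] [Module k X]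
  {ρ : Representation k G V} {ν : Representation k H X} {i : X →ₗ[k] V} {q : V →ₗ[k] X}

/-- The extension by zero of a form on the summand lies in the `e₁`-part. -/
theorem asAlgebraHom_dual_comp_form
    (hreal : ∀ g, (inclusion H e₁).coeff g⁻¹ = (inclusion H e₁).coeff g)
    (hν1 : ν.asAlgebraHom e₁ = 1) (hq : (restrict ρ H).IsIntertwiningMap ν q)
    (b : X →ₗ[k] Module.Dual k X) :
    ρ.dual.asAlgebraHom (inclusion H e₁) ∘ₗ Module.Dual.transpose (R := k) q ∘ₗ b ∘ₗ q =
      Module.Dual.transpose (R := k) q ∘ₗ b ∘ₗ q := by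
  rw [asAlgebraHom_dual hreal]
  refine LinearMap.ext fun x => LinearMap.ext fun y => ?_
  have h1 := LinearMap.congr_fun (comp_asAlgebraHom hq e₁) y
  rw [hν1, asAlgebraHom_restrict] at h1
  exact congrArg (b (q x)) h1

variable [FiniteDimensional k V] [FiniteDimensional k X]

/-- A non-degenerate invariant form restricts to a non-degenerate form on the non-projective
summand of the restriction of an indecomposable module in a real local pair. -/
theorem injective_form_of_summand (h : LocalPair D H e e₁)
    (hreal : ∀ g, (inclusion H e₁).coeff g⁻¹ = (inclusion H e₁).coeff g)
    (hρ : IsIndecomposable ρ) (hν : IsIndecomposable ν) (hνp : ¬ IsProjective ν)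
    (hν1 : ν.asAlgebraHom e₁ = 1) (hi : ν.IsIntertwiningMap (restrict ρ H) i)
    (hq : (restrict ρ H).IsIntertwiningMap ν q) (hqi : q ∘ₗ i = LinearMap.id)
    {b : V →ₗ[k] Module.Dual k V} (hb : ρ.IsIntertwiningMap ρ.dual b)
    (hinj : Function.Injective b) :
    Function.Injective (Module.Dual.transpose (R := k) i ∘ₗ b ∘ₗ i) := by
  obtain ⟨c, hc, hcb⟩ := exists_inverse_of_injective hb hinj
  -- the adjoint of the projection to the summand is again that projection, up to projective maps
  have h1 := transpose_mem_traceModule (h.sub_comp_mem hρ hi hq hqi hν1 hνp)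
  rw [map_sub, ← asAlgebraHom_dual hreal] at h1
  have hbH : (restrict ρ H).IsIntertwiningMap (restrict ρ H).dual b :=
    isIntertwiningMap_restrict hb H
  have hcH : (restrict ρ H).dual.IsIntertwiningMap (restrict ρ H) c :=
    isIntertwiningMap_restrict hc H
  have h2 := comp_mem_traceModule (isIntertwiningMap_comp hq hcH)
    (mem_traceModule_comp h1 (isIntertwiningMap_comp hbH hi))
  let T := Module.Dual.transpose (R := k) i ∘ₗ b ∘ₗ i
  let S := (q ∘ₗ c) ∘ₗ Module.Dual.transpose (R := k) q
  have h3 : (q ∘ₗ c) ∘ₗ (ρ.dual.asAlgebraHom (inclusion H e₁) -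
      Module.Dual.transpose (R := k) (i ∘ₗ q)) ∘ₗ (b ∘ₗ i) = LinearMap.id - S ∘ₗ T := by
    refine LinearMap.ext fun x => ?_
    have h4 : ρ.dual.asAlgebraHom (inclusion H e₁) (b (i x)) = b (i x) := by
      have h5 := LinearMap.congr_fun (comp_asAlgebraHom hb (inclusion H e₁)) (i x)
      have h6 := LinearMap.congr_fun (asAlgebraHom_comp_of_eq_one hi hν1) x
      exact h5.symm.trans (congrArg b h6)
    have h7 : q (c (b (i x))) = x := by
      rw [show c (b (i x)) = i x from LinearMap.congr_fun hcb (i x)]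
      exact LinearMap.congr_fun hqi x
    change q (c (ρ.dual.asAlgebraHom (inclusion H e₁) (b (i x)) - _)) = x - S (T x)
    rw [h4, map_sub, map_sub, h7]
    rfl
  rw [h3] at h2
  have hT : ν.IsIntertwiningMap ν.dual T :=
    isIntertwiningMap_comp (isIntertwiningMap_transpose hi) (isIntertwiningMap_comp hbH hi)
  have hS : ν.dual.IsIntertwiningMap ν S :=
    isIntertwiningMap_comp (isIntertwiningMap_comp hq hcH) (isIntertwiningMap_transpose hq)
  have h8 := (Module.End.isUnit_iff _).1
    (isUnit_of_id_sub_mem hν hνp (isIntertwiningMap_comp hS hT) h2)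
  exact Function.Injective.of_comp (f := S) h8.1

/-- A lift of a non-degenerate form on the summand is non-degenerate. -/
theorem injective_of_lift_form (h : LocalPair D H e e₁)
    (hreal : ∀ g, (inclusion H e₁).coeff g⁻¹ = (inclusion H e₁).coeff g)
    (hρ : IsIndecomposable ρ) (hνp : ¬ IsProjective ν)
    (hν1 : ν.asAlgebraHom e₁ = 1) (hi : ν.IsIntertwiningMap (restrict ρ H) i)
    (hq : (restrict ρ H).IsIntertwiningMap ν q) (hqi : q ∘ₗ i = LinearMap.id)
    {b : X →ₗ[k] Module.Dual k X} (hb : ν.IsIntertwiningMap ν.dual b)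
    (hinj : Function.Injective b) {Φ : V →ₗ[k] Module.Dual k V}
    (hΦ : ρ.IsIntertwiningMap ρ.dual Φ)
    (hmem : ρ.dual.asAlgebraHom (inclusion H e₁) ∘ₗ Φ -
      Module.Dual.transpose (R := k) q ∘ₗ b ∘ₗ q ∈
        traceModule ((restrict ρ H).linHom (restrict ρ.dual H)) H) :
    Function.Injective Φ := by
  obtain ⟨c, hc, hcb⟩ := exists_inverse_of_injective hb hinj
  have hβ' : (restrict ρ.dual H).IsIntertwiningMap (restrict ρ H)
      (i ∘ₗ c ∘ₗ Module.Dual.transpose (R := k) i) :=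
    isIntertwiningMap_comp hi (isIntertwiningMap_comp hc
      (isIntertwiningMap_transpose (σ := restrict ρ H) hi))
  have hβ : (restrict ρ H).IsIntertwiningMap (restrict ρ.dual H)
      (Module.Dual.transpose (R := k) q ∘ₗ b ∘ₗ q) :=
    isIntertwiningMap_comp (isIntertwiningMap_transpose (ρ := restrict ρ H) hq)
      (isIntertwiningMap_comp hb hq)
  obtain ⟨Φ', hΦ', hmem'⟩ := h.exists_lift hβ' (by
    rw [← LinearMap.comp_assoc, asAlgebraHom_comp_of_eq_one hi hν1])
  have h1 := isUnit_comp_of_lifts hρ hi hq hqi hν1 hνp hΦ hΦ' hβ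
    (asAlgebraHom_dual_comp_form hreal hν1 hq b) (LinearMap.ext fun x => ?_) hmem hmem'
  · exact Function.Injective.of_comp (f := Φ') ((Module.End.isUnit_iff _).1 h1).1
  · have h2 : Module.Dual.transpose (R := k) i (Module.Dual.transpose (R := k) q (b (q x))) =
        b (q x) :=
      LinearMap.ext fun y => congrArg (b (q x)) (LinearMap.congr_fun hqi y)
    change i (c (Module.Dual.transpose (R := k) i
      (Module.Dual.transpose (R := k) q (b (q x))))) = i (q x)
    rw [h2]
    exact congrArg i (LinearMap.congr_fun hcb (q x))

theorem isSelfDual_iff_of_summand (h : LocalPair D H e e₁)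
    (hreal : ∀ g, (inclusion H e₁).coeff g⁻¹ = (inclusion H e₁).coeff g)
    (hρ : IsIndecomposable ρ) (hν : IsIndecomposable ν) (hνp : ¬ IsProjective ν)
    (hν1 : ν.asAlgebraHom e₁ = 1) (hνρ : IsDirectSummand ν (restrict ρ H)) :
    IsSelfDual ρ ↔ IsSelfDual ν := by
  obtain ⟨i, q, hi, hq, hqi⟩ := isDirectSummand_iff.1 hνρ
  rw [isSelfDual_iff, isSelfDual_iff]
  constructor
  · rintro ⟨b, hb, hinj⟩
    exact ⟨_, isIntertwiningMap_comp (isIntertwiningMap_transpose hi)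
      (isIntertwiningMap_comp (isIntertwiningMap_restrict hb H) hi),
      h.injective_form_of_summand hreal hρ hν hνp hν1 hi hq hqi hb hinj⟩
  · rintro ⟨b, hb, hinj⟩
    obtain ⟨Φ, hΦ, hmem⟩ := h.exists_lift (σ := ρ.dual)
      (isIntertwiningMap_comp (isIntertwiningMap_transpose (ρ := restrict ρ H) hq)
        (isIntertwiningMap_comp hb hq)) (asAlgebraHom_dual_comp_form hreal hν1 hq b)
    exact ⟨Φ, hΦ, h.injective_of_lift_form hreal hρ hνp hν1 hi hq hqi hb hinj hΦ hmem⟩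

/-- In odd characteristic a lift of a symmetric or alternating form can be symmetrized. -/
theorem hasForm_iff_of_summand (h : LocalPair D H e e₁)
    (hreal : ∀ g, (inclusion H e₁).coeff g⁻¹ = (inclusion H e₁).coeff g)
    (hρ : IsIndecomposable ρ) (hν : IsIndecomposable ν) (hνp : ¬ IsProjective ν)
    (hν1 : ν.asAlgebraHom e₁ = 1) (hνρ : IsDirectSummand ν (restrict ρ H))
    (h2 : (2 : k) ≠ 0) {s : k} (hs : s * s = 1) :
    HasForm ρ s ↔ HasForm ν s := by
  obtain ⟨i, q, hi, hq, hqi⟩ := isDirectSummand_iff.1 hνρ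
  constructor
  · rintro ⟨b, hb, hinj, hflip⟩
    exact ⟨_, isIntertwiningMap_comp (isIntertwiningMap_transpose hi)
      (isIntertwiningMap_comp (isIntertwiningMap_restrict hb H) hi),
      h.injective_form_of_summand hreal hρ hν hνp hν1 hi hq hqi hb hinj,
      LinearMap.ext fun x => LinearMap.ext fun y => LinearMap.congr_fun₂ hflip (i x) (i y)⟩
  · rintro ⟨b, hb, hinj, hflip⟩
    let β : V →ₗ[k] Module.Dual k V := Module.Dual.transpose (R := k) q ∘ₗ b ∘ₗ q
    have hβ : β.flip = s • β :=
      LinearMap.ext fun x => LinearMap.ext fun y => LinearMap.congr_fun₂ hflip (q x) (q y)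
    obtain ⟨Φ, hΦ, hmem⟩ := h.exists_lift (σ := ρ.dual) (β := β)
      (isIntertwiningMap_comp (isIntertwiningMap_transpose (ρ := restrict ρ H) hq)
        (isIntertwiningMap_comp hb hq)) (asAlgebraHom_dual_comp_form hreal hν1 hq b)
    let Ψ : V →ₗ[k] Module.Dual k V := (2 : k)⁻¹ • (Φ + s • Φ.flip)
    have hΨ : ρ.IsIntertwiningMap ρ.dual Ψ :=
      isIntertwiningMap_smul _ (isIntertwiningMap_add hΦ
        (isIntertwiningMap_smul _ (isIntertwiningMap_flip hΦ)))
    have hmem' := flip_mem_traceModule (ρ := restrict ρ H) hmem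
    have h3 : (ρ.dual.asAlgebraHom (inclusion H e₁) ∘ₗ Φ - β).flip =
        ρ.dual.asAlgebraHom (inclusion H e₁) ∘ₗ Φ.flip - s • β := by
      have h4 : (ρ.dual.asAlgebraHom (inclusion H e₁) ∘ₗ Φ).flip =
          ρ.dual.asAlgebraHom (inclusion H e₁) ∘ₗ Φ.flip := by
        rw [← comp_asAlgebraHom (isIntertwiningMap_flip hΦ), asAlgebraHom_dual hreal]
        rfl
      rw [← h4, ← hβ]
      rfl
    have h5 : ρ.dual.asAlgebraHom (inclusion H e₁) ∘ₗ Ψ - β = (2 : k)⁻¹ •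
        ((ρ.dual.asAlgebraHom (inclusion H e₁) ∘ₗ Φ - β) +
          s • (ρ.dual.asAlgebraHom (inclusion H e₁) ∘ₗ Φ.flip - s • β)) := by
      rw [LinearMap.comp_smul, LinearMap.comp_add, LinearMap.comp_smul]
      exact half_smul_add_sub (M := V →ₗ[k] Module.Dual k V) h2 hs _ _ _
    refine ⟨Ψ, hΨ, h.injective_of_lift_form hreal hρ hνp hν1 hi hq hqi hb hinj hΨ ?_, ?_⟩
    · change ρ.dual.asAlgebraHom (inclusion H e₁) ∘ₗ Ψ - β ∈ _
      rw [h5, ← h3]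
      exact Submodule.smul_mem _ _ (add_mem hmem (Submodule.smul_mem _ _ hmem'))
    · change (2 : k)⁻¹ • (Φ.flip + s • Φ) = s • ((2 : k)⁻¹ • (Φ + s • Φ.flip))
      rw [smul_comm s, smul_add s, smul_smul s s, hs, one_smul, add_comm]

end LocalPair

end GreenForms

/-! ### Green correspondence on isomorphism classes -/

section IsoClasses

theorem exists_equiv_of_existsUnique {α β : Type*} {R : α → β → Prop} (h₁ : ∀ a, ∃! b, R a b)
    (h₂ : ∀ b, ∃! a, R a b) : ∃ f : α ≃ β, ∀ a b, f a = b ↔ R a b := by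
  choose f hf hf' using h₁
  choose g hg hg' using h₂
  refine ⟨⟨f, g, fun a => (hg' _ _ (hf a)).symm, fun b => (hf' _ _ (hg b)).symm⟩, fun a b => ?_⟩
  exact ⟨fun h => h ▸ hf a, fun h => (hf' _ _ h).symm⟩

variable {k : Type u} [Field k] {G : Type v} [Group G]

/-- The idempotent of the Brauer correspondent of a real block with cyclic defect group is
invariant under inversion, as its support is the intersection of that of the block idempotent
with a centralizer. -/
theorem coeff_inclusion_idem_inv [Finite G] {p : ℕ} [Fact p.Prime] [CharP k p] {B : Block k G}
    (hB : B.IsReal) {D D₁ : Subgroup G} (hD : B.IsDefectGroup D) (hcyc : IsCyclic D)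
    (hD₁ : D₁ ≤ D) (hcard : Nat.card D₁ = p)
    {B₁ : Block k (Subgroup.normalizer (D₁ : Set G))} (hB₁ : B₁.IsBrauerInduced B) (g : G) :
    (inclusion _ B₁.idem).coeff g⁻¹ = (inclusion _ B₁.idem).coeff g := by
  have h := localPair_of_isCyclic hD hcyc hD₁ hcard hB₁
  rw [inclusion_idem_eq_brauerMap hD rfl h.fusion hD₁ hcard h.le hB₁]
  classical
  rw [coeff_brauerMap, coeff_brauerMap, hB g]
  exact if_congr (inv_mem_iff (H := Subgroup.centralizer (D₁ : Set G))) rfl rfl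

theorem Block.NonprojIndec.isoClass_eq_iff {B : Block k G} {M N : B.NonprojIndec} :
    M.isoClass = N.isoClass ↔ Isomorphic M.rep N.rep :=
  Quotient.eq (r := Block.NonprojIndec.setoid B)

theorem Block.NonprojIndec.exists_isoClass {B : Block k G} (m : B.IsoClass) :
    ∃ M : B.NonprojIndec, M.isoClass = m :=
  Quotient.exists_rep m

theorem isSelfDual_of_isomorphic {V : Type w} [AddCommGroup V] [Module k V]
    {W : Type w'} [AddCommGroup W] [Module k W] {ρ : Representation k G V}
    [FiniteDimensional k V] [FiniteDimensional k W] {σ : Representation k G W}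
    (h : Isomorphic ρ σ) (hρ : IsSelfDual ρ) : IsSelfDual σ := by
  obtain ⟨b, hb, hinj⟩ := isSelfDual_iff.1 hρ
  obtain ⟨f⟩ := h.symm
  have hf : σ.IsIntertwiningMap ρ f.toLinearMap :=
    ⟨Representation.IntertwiningMap.isIntertwining _ _ f.toIntertwiningMap⟩
  refine isSelfDual_iff.2 ⟨_, isIntertwiningMap_comp (isIntertwiningMap_transpose hf)
    (isIntertwiningMap_comp hb hf), ?_⟩
  have h1 : Function.Injective (Module.Dual.transpose (R := k) f.toLinearMap) :=
    LinearMap.dualMap_injective_of_surjective f.surjective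
  exact h1.comp (hinj.comp f.injective)

theorem isoClass_mem_selfDualClasses {B : Block k G} {M : B.NonprojIndec} :
    M.isoClass ∈ B.selfDualClasses ↔ IsSelfDual M.rep := by
  refine ⟨fun ⟨M', h, h'⟩ => ?_, fun h => ⟨M, h, rfl⟩⟩
  obtain ⟨hMf, -⟩ := M.2
  obtain ⟨hMf', -⟩ := M'.2
  exact isSelfDual_of_isomorphic (Block.NonprojIndec.isoClass_eq_iff.1 h') h

variable [Finite G] {D H : Subgroup G} {B : Block k G} {B₁ : Block k H}

/-- The Green correspondence: each of `M` and `N` determines the other up to isomorphism. -/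
theorem LocalPair.exists_equiv (h : LocalPair D H B.idem B₁.idem) :
    ∃ f : B.IsoClass ≃ B₁.IsoClass, ∀ (M : B.NonprojIndec) (N : B₁.NonprojIndec),
      f M.isoClass = N.isoClass ↔ IsDirectSummand N.rep (restrict M.rep H) := by
  let R : B.IsoClass → B₁.IsoClass → Prop := fun m n =>
    ∃ (M : B.NonprojIndec) (N : B₁.NonprojIndec), M.isoClass = m ∧ N.isoClass = n ∧
      IsDirectSummand N.rep (restrict M.rep H)
  suffices hR : (∀ m, ∃! n, R m n) ∧ ∀ n, ∃! m, R m n by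
    obtain ⟨f, hf⟩ := exists_equiv_of_existsUnique hR.1 hR.2
    refine ⟨f, fun M N => (hf _ _).trans ⟨?_, fun hs => ⟨M, N, rfl, rfl, hs⟩⟩⟩
    rintro ⟨M', N', hM, hN, hs⟩
    rw [Block.NonprojIndec.isoClass_eq_iff] at hM hN
    exact hN.symm.isDirectSummand.trans (hs.trans (hM.isDirectSummand.restrict H))
  refine ⟨fun m => ?_, fun n => ?_⟩
  · obtain ⟨M, rfl⟩ := Block.NonprojIndec.exists_isoClass m
    obtain ⟨hMf, hMi, hMp, hM1⟩ := M.2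
    obtain ⟨N, hNf, hNi, hNp, hN1, hN⟩ := h.exists_isDirectSummand_restrict hM1 hMp
    let N' : B₁.NonprojIndec := ⟨N, hNf, hNi, hNp, hN1⟩
    refine ⟨N'.isoClass, ⟨M, N', rfl, rfl, hN⟩, ?_⟩
    rintro _ ⟨M', L, hM', rfl, hs⟩
    obtain ⟨hLf, hLi, hLp, hL1⟩ := L.2
    rw [Block.NonprojIndec.isoClass_eq_iff] at hM'
    exact Block.NonprojIndec.isoClass_eq_iff.2 (h.isomorphic_of_isDirectSummand_restrict hMi hNi
      hLi hNp hLp hN1 hL1 hN (hs.trans (hM'.isDirectSummand.restrict H)))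
  · obtain ⟨N, rfl⟩ := Block.NonprojIndec.exists_isoClass n
    obtain ⟨hNf, hNi, hNp, hN1⟩ := N.2
    obtain ⟨M, hMf, hMi, hMp, hM1, hM⟩ :=
      LocalPair.exists_restrict_isDirectSummand.{u, v, u} h hNi hNp hN1
    let M' : B.NonprojIndec := ⟨M, hMf, hMi, hMp, hM1⟩
    refine ⟨M'.isoClass, ⟨M', N, rfl, rfl, hM⟩, ?_⟩
    rintro _ ⟨L, N', rfl, hN', hs⟩
    obtain ⟨hLf, hLi, hLp, hL1⟩ := L.2
    rw [Block.NonprojIndec.isoClass_eq_iff] at hN'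
    exact Block.NonprojIndec.isoClass_eq_iff.2 (h.isomorphic_of_restrict_isDirectSummand hLi hMi
      hNp hN1 (hN'.symm.isDirectSummand.trans hs) hM)

end IsoClasses

end
end BlockTheory

theorem lemma3p1 {k : Type u} [Field k] [IsAlgClosed k] (p : ℕ) [Fact p.Prime] (hp : p ≠ 2)
    [CharP k p] {G : Type v} [Group G] [Finite G]
    (B : BlockTheory.Block k G) (hB : B.IsReal)
    (D : Subgroup G) (hD : B.IsDefectGroup D) (hcyc : IsCyclic D)
    (D₁ : Subgroup G) (hD₁ : D₁ ≤ D) (hcard : Nat.card D₁ = p)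
    (B₁ : BlockTheory.Block k (Subgroup.normalizer (D₁ : Set G)))
    (hB₁ : B₁.IsBrauerInduced B) :
    ∃ f : B.IsoClass ≃ B₁.IsoClass,
      -- `f` is the Green correspondence
      (∀ (M : B.NonprojIndec) (N : B₁.NonprojIndec), f M.isoClass = N.isoClass ↔
        ∃ Q ≤ D, Q ≠ ⊥ ∧ BlockTheory.IsGreenCorrespondent Q
          (Subgroup.normalizer (D₁ : Set G)) M.rep N.rep) ∧
      -- it restricts to a bijection between the self-dual modules
      Set.BijOn f B.selfDualClasses B₁.selfDualClasses ∧
      -- which preserves the type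
      ∀ (M : B.NonprojIndec) (N : B₁.NonprojIndec), BlockTheory.IsSelfDual M.rep →
        f M.isoClass = N.isoClass →
        (BlockTheory.IsOrthogonal M.rep ↔ BlockTheory.IsOrthogonal N.rep) ∧
        (BlockTheory.IsSymplectic M.rep ↔ BlockTheory.IsSymplectic N.rep) := by
  have h := BlockTheory.localPair_of_isCyclic hD hcyc hD₁ hcard hB₁
  have hreal := BlockTheory.coeff_inclusion_idem_inv hB hD hcyc hD₁ hcard hB₁
  have h2 : (2 : k) ≠ 0 := Ring.two_ne_zero (by rwa [← CharP.eq k ‹CharP k p› (ringChar.charP k)])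
  obtain ⟨f, hf⟩ := h.exists_equiv
  have hdual : ∀ (M : B.NonprojIndec) (N : B₁.NonprojIndec), f M.isoClass = N.isoClass →
      (BlockTheory.IsSelfDual M.rep ↔ BlockTheory.IsSelfDual N.rep) := fun M N hMN => by
    obtain ⟨hMf, hMi, hMp, hM1⟩ := M.2
    obtain ⟨hNf, hNi, hNp, hN1⟩ := N.2
    exact h.isSelfDual_iff_of_summand hreal hMi hNi hNp hN1 ((hf M N).1 hMN)
  refine ⟨f, fun M N => (hf M N).trans ⟨fun hs => ?_, fun ⟨Q, _, _, hQ⟩ => hQ.summand⟩,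
    ⟨?_, f.injective.injOn, ?_⟩, fun M N _ hMN => ?_⟩
  · obtain ⟨hMf, hMi, hMp, hM1⟩ := M.2
    obtain ⟨hNf, hNi, hNp, hN1⟩ := N.2
    obtain ⟨Q, hQD, hQ, hle, hQM, hQN⟩ := h.exists_isVertex hMi hMp hM1 hNp hN1 hs
    exact ⟨Q, hQD, hQ, hle, hMi, hNi, hQM, hQN, hs⟩
  · rintro _ ⟨M, hM, rfl⟩
    obtain ⟨N, hN⟩ := BlockTheory.Block.NonprojIndec.exists_isoClass (f M.isoClass)
    rw [← hN, BlockTheory.isoClass_mem_selfDualClasses]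
    exact (hdual M N hN.symm).1 hM
  · rintro _ ⟨N, hN, rfl⟩
    obtain ⟨M, hM⟩ := BlockTheory.Block.NonprojIndec.exists_isoClass (f.symm N.isoClass)
    have hMN : f M.isoClass = N.isoClass := by rw [hM, f.apply_symm_apply]
    exact ⟨M.isoClass, ⟨M, (hdual M N hMN).2 hN, rfl⟩, hMN⟩
  · obtain ⟨hMf, hMi, hMp, hM1⟩ := M.2
    obtain ⟨hNf, hNi, hNp, hN1⟩ := N.2
    have hs := (hf M N).1 hMN
    rw [BlockTheory.isOrthogonal_iff h2, BlockTheory.isOrthogonal_iff h2,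
      BlockTheory.isSymplectic_iff h2, BlockTheory.isSymplectic_iff h2]
    exact ⟨h.hasForm_iff_of_summand hreal hMi hNi hNp hN1 hs h2 (mul_one 1),
      h.hasForm_iff_of_summand hreal hMi hNi hNp hN1 hs h2 (by ring)⟩
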